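/- Let $V=\mathbb C^2$ with a hermitian form $\langle\cdot,\cdot\rangle$ of signature $(1,1)$, so that $\mathrm{PU}(V)=\mathrm{PU}(1,1)$ is the group of orientation-preserving isometries of the hyperbolic plane $\{p\in\mathbb P V:\langle p,p\rangle>0\}$. For $\langle c,c\rangle>0$ and $|k|=1$ let $R_{c,k}\colon p\mapsto(\bar k-k)\frac{\langle p,c\rangle}{\langle c,c\rangle}c+kp$ (it induces the counterclockwise rotation about $c$ by the angle $\operatorname{Arg}k^2$). Let $a_0,a_1,a_2,a_3\in\,]0,\pi[$. Let $R(a_0,a_1,a_2,a_3)$ be the space of all relations $R_3R_2R_1R_0=1$ in $\mathrm{PU}(V)$, labeled by a permutation $\beta$ of $\{0,1,2,3\}$ with $\beta(0)=0$, such that $R_j$ lies in the conjugacy class of $R_{c,k}$, $k=e^{ia_{\beta(j)}}$, for all $j$ (the labels are kept even if some $a_j$ coincide), taken modulo simultaneous conjugation in $\mathrm{PU}(V)$. Let $S=S(a_0,a_1,a_2,a_3)$ be its quotient (with the quotient topology) by the cyclic group of order $3$ generated by $(R_0,R_1,R_2,R_3)\mapsto(R_1R_0R_1^{-1},R_2,R_3,R_1)$,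 which permutes the labels accordingly. The type of a point of $S$ is the cyclic order of the labels $\beta(1),\beta(2),\beta(3)$. For $l=1,2,3$, let $n_l\colon S\to S$ be the involution defined as follows: represent a point of $S$ by a relation with $\beta(2)=l$ and replace $(R_0,R_1,R_2,R_3)$ by $(R_0,R_2,R_2R_1R_2^{-1},R_3)$, interchanging the labels at the positions $1$ and $2$. Let $M_3$ be the group of transformations of $S$ generated by $n_1,n_2,n_3$, and let $M\le M_3$ be the subgroup of the type-preserving elements. We say that $M$ acts discretely on a connected component $C$ of $S$ if every point of $C$ has a neighbourhood $U$ in $C$ such that only finitely many of the transformations $g|_C$, $g\in M$, satisfy $gU\cap U\ne\varnothing$. **Lemma.** Let $C$ be a connected component of $S$ that is not a single point, and suppose that $M$ acts discretely on $C$. Then $C$ is the noncompact component, i.e., $C$ is noncompact and every noncompact connected component of $S$ of the same type as $C$ equals $C$; moreover, either $a_j+a_k\le\pi$ for all $j\ne k$, or $a_j+a_k\ge\pi$ for all $j\ne k$. -/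

import Mathlib

open scoped ComplexConjugate Topology

namespace HexagonSpace

/-- The hermitian form of signature `(1,1)` on `V = ℂ²`, linear in the first argument. -/
def herm (x y : Fin 2 → ℂ) : ℂ := x 0 * conj (y 0) - x 1 * conj (y 1)

/-- The unitary group `U(1,1)` of `(V, herm)`. -/
def U11 : Subgroup (GL (Fin 2) ℂ) where
  carrier := {A | ∀ x y : Fin 2 → ℂ,
    herm ((A : Matrix (Fin 2) (Fin 2) ℂ).mulVec x) ((A : Matrix (Fin 2) (Fin 2) ℂ).mulVec y)
      = herm x y}
  mul_mem' := by
    intro A B hA hB x y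
    simp only [Units.val_mul, ← Matrix.mulVec_mulVec]
    rw [hA, hB]
  one_mem' := by
    intro x y
    simp
  inv_mem' := by
    intro A hA x y
    rw [← hA, Matrix.mulVec_mulVec, Matrix.mulVec_mulVec, ← Units.val_mul]
    simp

/-- The projective unitary group `PU(1,1)`, with its quotient topology: the group of
orientation-preserving isometries of the hyperbolic plane `{p ∈ ℙV | ⟨p,p⟩ > 0}`. -/
abbrev PU : Type := U11 ⧸ Subgroup.center U11

/-- `A ∈ U(1,1)` is the map `R_{c,k} : p ↦ (k̄ - k) (⟨p,c⟩ / ⟨c,c⟩) c + k p`. -/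
def IsRot (c : Fin 2 → ℂ) (k : ℂ) (A : U11) : Prop :=
  ∀ p : Fin 2 → ℂ, ((A : GL (Fin 2) ℂ) : Matrix (Fin 2) (Fin 2) ℂ).mulVec p
    = ((conj k - k) * (herm p c / herm c c)) • c + k • p

/-- `g ∈ PU(1,1)` belongs to the conjugacy class of the rotations `R_{c,k}`, `k = e^{ia}`, about
the points `c` of the hyperbolic plane (counterclockwise rotations by the angle `2a`). -/
def InClass (a : ℝ) (g : PU) : Prop :=
  ∃ (c : Fin 2 → ℂ) (A : U11), 0 < (herm c c).re ∧ IsRot c (Complex.exp (a * Complex.I)) A ∧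
    (QuotientGroup.mk A : PU) = g

theorem herm_smul_add (r s : ℂ) (x y z : Fin 2 → ℂ) :
    herm (r • x + s • y) z = r * herm x z + s * herm y z := by
  simp [herm]; ring

/-- The set `InClass a` is invariant under conjugation. -/
theorem InClass.conj {a : ℝ} {g : PU} (h : InClass a g) (b : PU) : InClass a (b * g * b⁻¹) := by
  obtain ⟨c, A, hc, hA, rfl⟩ := h
  induction b using QuotientGroup.induction_on with
  | H B =>
    refine ⟨((B : GL (Fin 2) ℂ) : Matrix (Fin 2) (Fin 2) ℂ).mulVec c, B * A * B⁻¹, ?_, ?_, rfl⟩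
    · rw [B.2]; exact hc
    · intro p
      have h1 : ((B : GL (Fin 2) ℂ) : Matrix (Fin 2) (Fin 2) ℂ).mulVec
          ((((B⁻¹ : U11) : GL (Fin 2) ℂ) : Matrix (Fin 2) (Fin 2) ℂ).mulVec p) = p := by
        rw [Matrix.mulVec_mulVec, ← Units.val_mul]; simp
      simp only [Subgroup.coe_mul, Units.val_mul, ← Matrix.mulVec_mulVec]
      rw [hA, Matrix.mulVec_add, Matrix.mulVec_smul, Matrix.mulVec_smul, h1]
      congr 3
      rw [B.2]
      congr 1
      conv_rhs => rw [← h1]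
      rw [B.2]

/-- Labelings of the positions `0,1,2,3`: the position `j` gets the conjugacy class number `β j`,
the position `0` the class number `0`. -/
abbrev Labeling : Type := {β : Equiv.Perm (Fin 4) // β 0 = 0}

/-- The space `R(a₀,a₁,a₂,a₃)` before passing to conjugacy classes: relations `R₃R₂R₁R₀ = 1` in
`PU(1,1)` where the class of `R_j` is that of `R_{c,k}`, `k = e^{i a_{β j}}`.
The labeling `β` is part of a point (even if some `a_j` coincide), so that the space is the disjoint
union over `β` of subspaces of `PU(1,1)⁴`. -/
abbrev Relations (a : Fin 4 → ℝ) : Type :=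
  Σ β : Labeling, {ρ : Fin 4 → PU // (∀ j, InClass (a (β.1 j)) (ρ j)) ∧ ρ 3 * ρ 2 * ρ 1 * ρ 0 = 1}

variable {a : Fin 4 → ℝ}

/-- The move `R₀ ↦ R₁R₀R₁⁻¹, R₁ ↦ R₂, R₂ ↦ R₃, R₃ ↦ R₁`; in terms of the hexagon
`c₁,p₁,c₂,p₂,c₃,p₃`, where `c_j` is the fixed point of `R_j`, `p₃ = c₀`, `p_j = R_j p_{j-1}`,
it shifts the label `c₀` from `p₃` to `p₁`. -/
def shift (P : Relations a) : Relations a :=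
  ⟨⟨P.1.1 * (Equiv.swap 1 2 * Equiv.swap 2 3), by
      have h : (Equiv.swap 1 2 * Equiv.swap 2 3 : Equiv.Perm (Fin 4)) 0 = 0 := by decide
      rw [Equiv.Perm.mul_apply, h, P.1.2]⟩,
    ![P.2.1 1 * P.2.1 0 * (P.2.1 1)⁻¹, P.2.1 2, P.2.1 3, P.2.1 1], by
      have h0 : (Equiv.swap 1 2 * Equiv.swap 2 3 : Equiv.Perm (Fin 4)) 0 = 0 := by decide
      have h1 : (Equiv.swap 1 2 * Equiv.swap 2 3 : Equiv.Perm (Fin 4)) 1 = 2 := by decide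
      have h2 : (Equiv.swap 1 2 * Equiv.swap 2 3 : Equiv.Perm (Fin 4)) 2 = 3 := by decide
      have h3 : (Equiv.swap 1 2 * Equiv.swap 2 3 : Equiv.Perm (Fin 4)) 3 = 1 := by decide
      constructor
      · intro j
        rw [Equiv.Perm.mul_apply]
        fin_cases j
        · simpa only [Fin.zero_eta, h0, Matrix.cons_val] using (P.2.2.1 0).conj _
        · simpa only [Fin.mk_one, h1, Matrix.cons_val] using P.2.2.1 2
        · simpa only [Fin.reduceFinMk, h2, Matrix.cons_val] using P.2.2.1 3
        · simpa only [Fin.reduceFinMk, h3, Matrix.cons_val] using P.2.2.1 1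
      · have h := P.2.2.2
        simp only [Matrix.cons_val]
        calc _ = P.2.1 1 * (P.2.1 3 * P.2.1 2 * P.2.1 1 * P.2.1 0) * (P.2.1 1)⁻¹ := by group
          _ = 1 := by rw [h]; group⟩

/-- The surgery of the hexagon `c₁,p₁,c₂,p₂,c₃,p₃` along the segment `[p₃,c₂]`: the piece
`p₃,c₁,p₁,c₂` is rotated by `R₂` and glued along `[c₂,p₂]`, which gives the hexagon with the
consecutive vertices `c₂, R₂p₃, R₂c₁, p₂, c₃, p₃`. Thus `R₁ ↦ R₂`, `R₂ ↦ R₂R₁R₂⁻¹`. -/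
def surgery (P : Relations a) : Relations a :=
  ⟨⟨P.1.1 * Equiv.swap 1 2, by
      have h : (Equiv.swap 1 2 : Equiv.Perm (Fin 4)) 0 = 0 := by decide
      rw [Equiv.Perm.mul_apply, h, P.1.2]⟩,
    ![P.2.1 0, P.2.1 2, P.2.1 2 * P.2.1 1 * (P.2.1 2)⁻¹, P.2.1 3], by
      have h0 : (Equiv.swap 1 2 : Equiv.Perm (Fin 4)) 0 = 0 := by decide
      have h1 : (Equiv.swap 1 2 : Equiv.Perm (Fin 4)) 1 = 2 := by decide
      have h2 : (Equiv.swap 1 2 : Equiv.Perm (Fin 4)) 2 = 1 := by decide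
      have h3 : (Equiv.swap 1 2 : Equiv.Perm (Fin 4)) 3 = 3 := by decide
      constructor
      · intro j
        rw [Equiv.Perm.mul_apply]
        fin_cases j
        · simpa only [Fin.zero_eta, h0, Matrix.cons_val] using P.2.2.1 0
        · simpa only [Fin.mk_one, h1, Matrix.cons_val] using P.2.2.1 2
        · simpa only [Fin.reduceFinMk, h2, Matrix.cons_val] using (P.2.2.1 1).conj _
        · simpa only [Fin.reduceFinMk, h3, Matrix.cons_val] using P.2.2.1 3
      · have h := P.2.2.2
        simp only [Matrix.cons_val]
        calc _ = P.2.1 3 * P.2.1 2 * P.2.1 1 * P.2.1 0 := by group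
          _ = 1 := h⟩

/-- Simultaneous conjugation by an element of `PU(1,1)`. -/
def ConjRel (P Q : Relations a) : Prop :=
  Q.1 = P.1 ∧ ∃ g : PU, ∀ j, Q.2.1 j = g * P.2.1 j * g⁻¹

/-- The relation that generates the equivalence defining the space of hexagons. -/
def Step (P Q : Relations a) : Prop := ConjRel P Q ∨ Q = shift P

/-- The space `S(a₀,a₁,a₂,a₃)` of hexagons, with its quotient topology: relations up to
conjugation in `PU(1,1)` and up to the action of the cyclic group generated by `shift`. -/
def S (a : Fin 4 → ℝ) : Type :=
  Quot (Step (a := a))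

instance (a : Fin 4 → ℝ) : TopologicalSpace (S a) :=
  inferInstanceAs (TopologicalSpace (Quot _))

/-- The hexagon given by a relation. -/
def S.mk (P : Relations a) : S a := Quot.mk _ P

/-- Two relations with the same labeling and the same isometries are equal. -/
theorem Relations.ext' {P Q : Relations a} (h1 : P.1 = Q.1) (h2 : ∀ j, P.2.1 j = Q.2.1 j) :
    P = Q := by
  obtain ⟨β, ρ⟩ := P
  obtain ⟨β', ρ'⟩ := Q
  obtain rfl : β = β' := h1
  congr 1
  exact Subtype.ext (funext h2)

theorem shift_shift_shift (P : Relations a) : shift (shift (shift P)) = P := by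
  have hs : (Equiv.swap 1 2 * Equiv.swap 2 3 * (Equiv.swap 1 2 * Equiv.swap 2 3) *
    (Equiv.swap 1 2 * Equiv.swap 2 3) : Equiv.Perm (Fin 4)) = 1 := by decide
  have h : P.2.1 3 * P.2.1 2 * P.2.1 1 * P.2.1 0 = 1 := P.2.2.2
  refine Relations.ext' (Subtype.ext ?_) fun j => ?_
  · simp only [shift]
    rw [mul_assoc, mul_assoc, ← mul_assoc (Equiv.swap 1 2 * Equiv.swap 2 3), hs, mul_one]
  · have h' : P.2.1 3 * P.2.1 2 * P.2.1 1 = (P.2.1 0)⁻¹ := eq_inv_of_mul_eq_one_left h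
    fin_cases j
    · simp only [shift, Fin.zero_eta, Matrix.cons_val]
      calc _ = (P.2.1 3 * P.2.1 2 * P.2.1 1) * P.2.1 0 * (P.2.1 3 * P.2.1 2 * P.2.1 1)⁻¹ := by group
        _ = P.2.1 0 := by rw [h']; group
    · simp [shift]
    · simp [shift]
    · simp [shift]

theorem S.mk_shift (P : Relations a) : S.mk (shift P) = S.mk P :=
  (Quot.sound (r := Step) (Or.inr rfl)).symm

theorem S.mk_conj {P Q : Relations a} (h : ConjRel P Q) : S.mk P = S.mk Q :=
  Quot.sound (r := Step) (Or.inl h)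

theorem ConjRel.shift {P Q : Relations a} (h : ConjRel P Q) :
    ConjRel (HexagonSpace.shift P) (HexagonSpace.shift Q) := by
  obtain ⟨h1, g, hg⟩ := h
  refine ⟨Subtype.ext (by simp only [HexagonSpace.shift, h1]), g, fun j => ?_⟩
  fin_cases j <;> simp [HexagonSpace.shift, hg, mul_assoc]

theorem ConjRel.surgery {P Q : Relations a} (h : ConjRel P Q) :
    ConjRel (HexagonSpace.surgery P) (HexagonSpace.surgery Q) := by
  obtain ⟨h1, g, hg⟩ := h
  refine ⟨Subtype.ext (by simp only [HexagonSpace.surgery, h1]), g, fun j => ?_⟩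
  fin_cases j <;> simp [HexagonSpace.surgery, hg, mul_assoc]

/-- The modification of a hexagon at its vertex with the label `l ∈ {1,2,3}`: the label `c₀` is
shifted until the vertex with the label `l` stands at the position `2`, then `surgery` is applied. -/
def modify (l : Fin 4) (P : Relations a) : Relations a :=
  if P.1.1 2 = l then surgery P
  else if P.1.1 3 = l then surgery (shift P)
  else surgery (shift (shift P))

theorem shift_label (P : Relations a) : (shift P).1.1 1 = P.1.1 2 ∧ (shift P).1.1 2 = P.1.1 3 ∧
    (shift P).1.1 3 = P.1.1 1 := by
  have h1 : (Equiv.swap 1 2 * Equiv.swap 2 3 : Equiv.Perm (Fin 4)) 1 = 2 := by decide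
  have h2 : (Equiv.swap 1 2 * Equiv.swap 2 3 : Equiv.Perm (Fin 4)) 2 = 3 := by decide
  have h3 : (Equiv.swap 1 2 * Equiv.swap 2 3 : Equiv.Perm (Fin 4)) 3 = 1 := by decide
  refine ⟨?_, ?_, ?_⟩ <;> simp only [shift, Equiv.Perm.mul_apply (f := P.1.1), h1, h2, h3]

theorem surgery_label (P : Relations a) : (surgery P).1.1 1 = P.1.1 2 ∧
    (surgery P).1.1 2 = P.1.1 1 ∧ (surgery P).1.1 3 = P.1.1 3 := by
  have h1 : (Equiv.swap 1 2 : Equiv.Perm (Fin 4)) 1 = 2 := by decide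
  have h2 : (Equiv.swap 1 2 : Equiv.Perm (Fin 4)) 2 = 1 := by decide
  have h3 : (Equiv.swap 1 2 : Equiv.Perm (Fin 4)) 3 = 3 := by decide
  refine ⟨?_, ?_, ?_⟩ <;> simp only [surgery, Equiv.Perm.mul_apply, h1, h2, h3]

theorem exists_label {l : Fin 4} (hl : l ≠ 0) (P : Relations a) :
    P.1.1 1 = l ∨ P.1.1 2 = l ∨ P.1.1 3 = l := by
  obtain ⟨j, rfl⟩ := P.1.1.surjective l
  fin_cases j
  · exact absurd P.1.2 hl
  · exact Or.inl rfl
  · exact Or.inr (Or.inl rfl)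
  · exact Or.inr (Or.inr rfl)

theorem label_ne (P : Relations a) {i j : Fin 4} (h : i ≠ j) : P.1.1 i ≠ P.1.1 j :=
  fun h' => h (P.1.1.injective h')

theorem modify_shift {l : Fin 4} (hl : l ≠ 0) (P : Relations a) :
    modify l (shift P) = modify l P := by
  obtain ⟨-, h2, h3⟩ := shift_label P
  have h12 := label_ne P (show (1 : Fin 4) ≠ 2 by decide)
  have h13 := label_ne P (show (1 : Fin 4) ≠ 3 by decide)
  have h23 := label_ne P (show (2 : Fin 4) ≠ 3 by decide)
  unfold modify
  rw [h2, h3, shift_shift_shift]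
  rcases exists_label hl P with h | h | h <;> subst h
  · simp [h12.symm, h13.symm]
  · simp [h23.symm, h12]
  · simp [h23]

theorem ConjRel.modify {P Q : Relations a} (h : ConjRel P Q) (l : Fin 4) :
    ConjRel (HexagonSpace.modify l P) (HexagonSpace.modify l Q) := by
  unfold HexagonSpace.modify
  rw [h.1]
  split_ifs
  · exact h.surgery
  · exact h.shift.surgery
  · exact h.shift.shift.surgery

/-- The modification `n_{l+1}` on the space of hexagons, `l = 0,1,2`. -/
def modS (l : Fin 3) : S a → S a :=
  Quot.lift (fun P => S.mk (modify l.succ P)) (by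
    rintro P Q (h | rfl)
    · exact S.mk_conj (h.modify _)
    · rw [modify_shift l.succ_ne_zero])

theorem modS_of_label (l : Fin 3) (P : Relations a) (h : P.1.1 2 = l.succ) :
    modS l (S.mk P) = S.mk (surgery P) := by
  change S.mk (modify l.succ P) = _
  rw [modify, if_pos h]

theorem S.exists_label (l : Fin 3) (x : S a) :
    ∃ P : Relations a, P.1.1 2 = l.succ ∧ S.mk P = x := by
  obtain ⟨P, rfl⟩ := Quot.exists_rep x
  rcases HexagonSpace.exists_label l.succ_ne_zero P with h | h | h
  · exact ⟨shift (shift P), by rw [(shift_label _).2.1, (shift_label _).2.2, h],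
      by rw [S.mk_shift, S.mk_shift]; rfl⟩
  · exact ⟨P, h, rfl⟩
  · exact ⟨shift P, by rw [(shift_label _).2.1, h], by rw [S.mk_shift]; rfl⟩

/-- The modifications are involutions. -/
theorem modS_modS (l : Fin 3) : Function.Involutive (modS l : S a → S a) := by
  intro x
  obtain ⟨P, hP, rfl⟩ := S.exists_label l x
  rw [modS_of_label l P hP]
  have h1 : S.mk (surgery P) = S.mk (shift (shift (surgery P))) := by
    rw [S.mk_shift, S.mk_shift]
  rw [h1, modS_of_label]
  · rw [← S.mk_shift P]
    have hs : (Equiv.swap 1 2 * (Equiv.swap 1 2 * Equiv.swap 2 3) *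
      (Equiv.swap 1 2 * Equiv.swap 2 3) * Equiv.swap 1 2 : Equiv.Perm (Fin 4)) =
        Equiv.swap 1 2 * Equiv.swap 2 3 := by decide
    have h : P.2.1 3 * P.2.1 2 * P.2.1 1 * P.2.1 0 = 1 := P.2.2.2
    have h' : P.2.1 0 = (P.2.1 3 * P.2.1 2 * P.2.1 1)⁻¹ := eq_inv_of_mul_eq_one_right h
    refine S.mk_conj ⟨Subtype.ext ?_, (P.2.1 2)⁻¹, fun j => ?_⟩
    · simp only [surgery, shift]
      conv_lhs => rw [← hs]
      simp only [mul_assoc]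
    · fin_cases j
      · simp [surgery, shift, h', mul_assoc]
      · simp [surgery, shift, mul_assoc]
      · simp [surgery, shift, mul_assoc]
      · simp [surgery, shift, mul_assoc]
  · rw [(shift_label _).2.1, (shift_label _).2.2, (surgery_label _).1, hP]

/-- The group `M₃` generated by the modifications, as a transformation group of `S`. -/
def M3 (a : Fin 4 → ℝ) : Subgroup (Equiv.Perm (S a)) :=
  Subgroup.closure (Set.range fun l : Fin 3 => (modS_modS l).toPerm)

/-- The type of a hexagon, i.e., the cyclic order of the labels `1,2,3` along it: `1` if the order
is `1,2,3`, and `-1` if it is `3,2,1`. -/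
def hexType : S a → ℤˣ :=
  Quot.lift (fun P => Equiv.Perm.sign P.1.1) (by
    have hs : Equiv.Perm.sign (Equiv.swap 1 2 * Equiv.swap 2 3 : Equiv.Perm (Fin 4)) = 1 := by
      decide
    rintro P Q (h | rfl)
    · rw [h.1]
    · simp only [shift]
      rw [Equiv.Perm.sign_mul P.1.1, hs, mul_one])

/-- The subgroup `M` of the type-preserving elements of `M₃`. -/
def M (a : Fin 4 → ℝ) : Subgroup (Equiv.Perm (S a)) where
  carrier := {g | g ∈ M3 a ∧ ∀ x, hexType (g x) = hexType x}
  mul_mem' := by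
    rintro g h ⟨hg, hg'⟩ ⟨hh, hh'⟩
    exact ⟨mul_mem hg hh, fun x => by rw [Equiv.Perm.mul_apply, hg', hh']⟩
  one_mem' := ⟨one_mem _, fun _ => rfl⟩
  inv_mem' := by
    rintro g ⟨hg, hg'⟩
    exact ⟨inv_mem hg, fun x => by
    rw [← hg' (g⁻¹ x), ← Equiv.Perm.mul_apply, mul_inv_cancel, Equiv.Perm.one_apply]⟩

/-- The transformation group `G` of `X` acts discretely on `C ⊆ X`: every point of `C` has a
neighbourhood `U` in `C` such that only finitely many of the transformations of `C` induced by `G`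
move `U` to a set that meets `U`. (Elements of `G` with the same restriction to `C` count once.) -/
def ActsDiscretely {X : Type*} [TopologicalSpace X] (G : Subgroup (Equiv.Perm X)) (C : Set X) :
    Prop :=
  ∀ x ∈ C, ∃ U ∈ 𝓝 x,
    {f : C → X | ∃ g ∈ G, f = (fun y : C => g y) ∧ (g '' (U ∩ C) ∩ (U ∩ C)).Nonempty}.Finite

end HexagonSpace

open scoped ComplexConjugate Topology
namespace HexagonSpace

/-! Each R_j has a unique lift A_j to SL(2,ℝ) with trace 2 cos a_{β(j)} and positive lower left
entry, and A₃A₂A₁A₀ = ±1. This sign (`relSign`) is constant on connected components. Traceless 2×2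
matrices form a Minkowski 3-space in which the traceless parts of these lifts are future timelike
vectors, so trace estimates are reversed Cauchy–Schwarz inequalities. The sign, the labeling and the
traces of the three products A_iA_j with i, j ≠ 0 determine a relation up to conjugation
(`exists_conj_of_invariants`).

The product of two modifications is a Dehn twist: it conjugates A₁ and A₂ by g = A₂A₁. If g is
elliptic, its centralizer is a circle, which sweeps out a circle in S on which the twist acts as a
rotation by the angle of g. If this angle is an irrational multiple of π and neither {A₁, A₂} nor
{A₀, A₃} has a common centre, the powers of the twist recur without repeating, and M is not discrete
(`not_actsDiscretely`). Only countably many traces are excluded here. So discreteness makes tr g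
constant on a component as soon as it takes an elliptic value there (`pairTr_eq_of_actsDiscretely`).

If the sign is −1, all pair traces are elliptic, hence constant under discreteness, and the
component is a point. These components are compact in any case (`isCompact_of_relSign`). So the sign
of C is 1. If a_{β(1)} + a_{β(2)} and a_{β(0)} + a_{β(3)} lie strictly on opposite sides of π, the
relations of sign 1 with that labeling lie in one component, on which tr g takes elliptic and
hyperbolic values; this contradicts discreteness. As every label l ≠ 0 can be shifted to position 3,
the remaining possibilities are exactly the two systems of inequalities (`sums_of_not_bad`).

Under these inequalities g is hyperbolic, or g = −1 and all a_j = π/2 (`hyperbolic_of_good`). A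
continuous section over the hyperbolic traces, together with connected fibres, shows that the
relations of sign 1 and given type form one component (`connected_of_good`). It is noncompact
because tr g is unbounded below. -/

/-- The group `SL(2,ℝ)`, the double cover of `PU(1,1)`. -/
abbrev SL : Type := Matrix.SpecialLinearGroup (Fin 2) ℝ

/-! ### Elliptic elements of SL(2,ℝ) and trace invariants of pairs and triples. -/

namespace SL

/-- The trace of an element of `SL(2,ℝ)`. -/
def tr (A : SL) : ℝ := A.1 0 0 + A.1 1 1

theorem det_eq (A : SL) : A.1 0 0 * A.1 1 1 - A.1 0 1 * A.1 1 0 = 1 := by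
  rw [← Matrix.det_fin_two]; exact A.2

theorem mul_apply (A B : SL) (i j : Fin 2) :
    (A * B).1 i j = A.1 i 0 * B.1 0 j + A.1 i 1 * B.1 1 j := by
  rw [Matrix.SpecialLinearGroup.coe_mul, Matrix.mul_apply, Fin.sum_univ_two]

theorem inv_zero_zero (A : SL) : (A⁻¹).1 0 0 = A.1 1 1 := by
  rw [Matrix.SpecialLinearGroup.SL2_inv_expl]; rfl

theorem inv_zero_one (A : SL) : (A⁻¹).1 0 1 = -A.1 0 1 := by
  rw [Matrix.SpecialLinearGroup.SL2_inv_expl]; rfl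

theorem inv_one_zero (A : SL) : (A⁻¹).1 1 0 = -A.1 1 0 := by
  rw [Matrix.SpecialLinearGroup.SL2_inv_expl]; rfl

theorem inv_one_one (A : SL) : (A⁻¹).1 1 1 = A.1 0 0 := by
  rw [Matrix.SpecialLinearGroup.SL2_inv_expl]; rfl

theorem neg_apply (A : SL) (i j : Fin 2) : (-A).1 i j = -A.1 i j := by
  rw [Matrix.SpecialLinearGroup.coe_neg, Matrix.neg_apply]

theorem one_zero_zero : (1 : SL).1 0 0 = 1 := rfl
theorem one_zero_one : (1 : SL).1 0 1 = 0 := rfl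
theorem one_one_zero : (1 : SL).1 1 0 = 0 := rfl
theorem one_one_one : (1 : SL).1 1 1 = 1 := rfl

theorem ext_entries {A B : SL} (h00 : A.1 0 0 = B.1 0 0) (h01 : A.1 0 1 = B.1 0 1)
    (h10 : A.1 1 0 = B.1 1 0) (h11 : A.1 1 1 = B.1 1 1) : A = B := by
  refine Matrix.SpecialLinearGroup.ext _ _ fun i j => ?_
  fin_cases i <;> fin_cases j <;> assumption

/-- The element of `SL(2,ℝ)` with given entries. -/
def of (x y z t : ℝ) (h : x * t - y * z = 1) : SL :=
  ⟨!![x, y; z, t], by rw [Matrix.det_fin_two_of]; exact h⟩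

section
variable {x y z t : ℝ} {h : x * t - y * z = 1}
theorem of_zero_zero : (of x y z t h).1 0 0 = x := rfl
theorem of_zero_one : (of x y z t h).1 0 1 = y := rfl
theorem of_one_zero : (of x y z t h).1 1 0 = z := rfl
theorem of_one_one : (of x y z t h).1 1 1 = t := rfl
end

theorem tr_mul_comm (A B : SL) : tr (A * B) = tr (B * A) := by
  simp only [tr, mul_apply]; ring

theorem tr_conj (B A : SL) : tr (B * A * B⁻¹) = tr A := by
  rw [tr_mul_comm, ← mul_assoc, inv_mul_cancel, one_mul]

theorem tr_inv (A : SL) : tr A⁻¹ = tr A := by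
  simp only [tr, inv_zero_zero, inv_one_one]; ring

theorem tr_neg (A : SL) : tr (-A) = -tr A := by
  simp only [tr, neg_apply]; ring

theorem tr_mul_inv (A B : SL) : tr (A * B⁻¹) = tr A * tr B - tr (A * B) := by
  simp only [tr, mul_apply, inv_zero_zero, inv_zero_one, inv_one_zero, inv_one_one]; ring

theorem tr_one : tr 1 = 2 := by
  simp only [tr, one_zero_zero, one_one_one]; norm_num

/-- The rotation about the point `i` of the upper half-plane. -/
noncomputable def rot (φ : ℝ) : SL :=
  of (Real.cos φ) (-Real.sin φ) (Real.sin φ) (Real.cos φ) (by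
    have := Real.sin_sq_add_cos_sq φ; linarith)

theorem rot_zero_zero (φ : ℝ) : (rot φ).1 0 0 = Real.cos φ := rfl
theorem rot_zero_one (φ : ℝ) : (rot φ).1 0 1 = -Real.sin φ := rfl
theorem rot_one_zero (φ : ℝ) : (rot φ).1 1 0 = Real.sin φ := rfl
theorem rot_one_one (φ : ℝ) : (rot φ).1 1 1 = Real.cos φ := rfl

/-- The elliptic elements of `SL(2,ℝ)` conjugate to `rot a`, for `0 < a < π`. -/
def Ell (a : ℝ) (A : SL) : Prop := tr A = 2 * Real.cos a ∧ 0 < A.1 1 0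

theorem ell_rot {a : ℝ} (ha : a ∈ Set.Ioo 0 Real.pi) : Ell a (rot a) :=
  ⟨by rw [tr, rot_zero_zero, rot_one_one]; ring, Real.sin_pos_of_pos_of_lt_pi ha.1 ha.2⟩

/-- Coordinates on a class of elliptic elements. -/
theorem Ell.coords {a : ℝ} {A : SL} (h : Ell a A) (hs : Real.sin a ≠ 0) : ∃ m y z : ℝ,
    A.1 0 0 = Real.cos a + m ∧ A.1 0 1 = -y ∧ A.1 1 0 = z ∧ A.1 1 1 = Real.cos a - m ∧
    0 < y ∧ 0 < z ∧ y * z = m ^ 2 + Real.sin a ^ 2 := by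
  have hd := det_eq A
  obtain ⟨ht, hz⟩ := h
  rw [tr] at ht
  have h1 : A.1 1 1 = 2 * Real.cos a - A.1 0 0 := by linarith
  have hyz : (-A.1 0 1) * A.1 1 0 = (A.1 0 0 - Real.cos a) ^ 2 + Real.sin a ^ 2 := by
    have := Real.sin_sq_add_cos_sq a
    rw [h1] at hd
    linear_combination hd - this
  have hpos : 0 < (-A.1 0 1) * A.1 1 0 := by rw [hyz]; positivity
  refine ⟨A.1 0 0 - Real.cos a, -A.1 0 1, A.1 1 0, by ring, by ring, rfl, by linarith,
    pos_of_mul_pos_left hpos hz.le, hz, hyz⟩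

theorem sin_pos {a : ℝ} (ha : a ∈ Set.Ioo 0 Real.pi) : 0 < Real.sin a :=
  Real.sin_pos_of_pos_of_lt_pi ha.1 ha.2

theorem Ell.conj {a : ℝ} {A : SL} (h : Ell a A) (hs : Real.sin a ≠ 0) (B : SL) :
    Ell a (B * A * B⁻¹) := by
  obtain ⟨m, y, z, h00, h01, h10, h11, hy, hz, hyz⟩ := h.coords hs
  refine ⟨by rw [tr_conj, h.1], ?_⟩
  have hB := det_eq B
  simp only [mul_apply, inv_zero_zero, inv_one_zero, h00, h01, h10, h11]
  have key : 0 < z * (B.1 1 1 ^ 2 * z + 2 * B.1 1 0 * B.1 1 1 * m + B.1 1 0 ^ 2 * y) := by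
    have e : z * (B.1 1 1 ^ 2 * z + 2 * B.1 1 0 * B.1 1 1 * m + B.1 1 0 ^ 2 * y) =
        (B.1 1 1 * z + B.1 1 0 * m) ^ 2 + B.1 1 0 ^ 2 * Real.sin a ^ 2 := by
      linear_combination B.1 1 0 ^ 2 * hyz
    rw [e]
    by_cases hr : B.1 1 0 = 0
    · have ht : B.1 1 1 ≠ 0 := by
        intro ht; rw [hr, ht] at hB; norm_num at hB
      rw [hr]; simp only [zero_mul, add_zero]; positivity
    · positivity
  have := pos_of_mul_pos_right key hz.le
  linarith

/-- Reversed Cauchy–Schwarz for the future timelike traceless parts, whose Minkowski lengths are sin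
a and sin b. This is the source of all upper bounds on traces. -/
theorem tr_mul_le {a b : ℝ} {A B : SL} (hA : Ell a A) (hB : Ell b B) (ha : Real.sin a ≠ 0)
    (hb : Real.sin b ≠ 0) : tr (A * B) ≤ 2 * Real.cos (a + b) := by
  obtain ⟨m, y, z, h00, h01, h10, h11, hy, hz, hyz⟩ := hA.coords ha
  obtain ⟨m', y', z', h00', h01', h10', h11', hy', hz', hyz'⟩ := hB.coords hb
  simp only [tr, mul_apply, h00, h01, h10, h11, h00', h01', h10', h11', Real.cos_add]
  have key : m * m' + Real.sin a * Real.sin b ≤ (y * z' + z * y') / 2 := by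
    refine le_of_abs_le (abs_le_of_sq_le_sq ?_ (by positivity))
    have : (m * m' + Real.sin a * Real.sin b) ^ 2 ≤ (y * z) * (y' * z') := by
      rw [hyz, hyz']; nlinarith [sq_nonneg (m * Real.sin b - m' * Real.sin a)]
    nlinarith [sq_nonneg (y * z' - z * y')]
  linarith

theorem exists_conj_rot {a : ℝ} {A : SL} (h : Ell a A) (hs : 0 < Real.sin a) :
    ∃ B : SL, A = B * rot a * B⁻¹ := by
  obtain ⟨m, y, z, h00, h01, h10, h11, hy, hz, hyz⟩ := h.coords hs.ne'
  obtain ⟨w, hw, hw2⟩ : ∃ w : ℝ, 0 < w ∧ w ^ 2 = Real.sin a / z :=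
    ⟨√(Real.sin a / z), Real.sqrt_pos.2 (by positivity), Real.sq_sqrt (by positivity)⟩
  have hw3 : w ^ 2 * z = Real.sin a := by rw [hw2]; field_simp
  -- This upper triangular matrix sends i to (m + i sin a)/z, the fixed point of A in the upper
  -- half-plane.
  refine ⟨of w (m / (z * w)) 0 w⁻¹ (by field_simp; ring), ?_⟩
  rw [eq_mul_inv_iff_mul_eq]
  apply ext_entries <;>
  simp only [mul_apply, of_zero_zero, of_zero_one, of_one_zero, of_one_one, rot_zero_zero,
    rot_zero_one, rot_one_zero, rot_one_one, h00, h01, h10, h11] <;> field_simp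
  · linear_combination m * hw3
  · rw [← hw3] at hyz ⊢
    linear_combination (-1) * hyz
  · linear_combination hw3
  · ring

/-- Conjugation by rotations acts transitively on the elements with given trace and given
antisymmetric part. -/
theorem exists_rot_conj {A B : SL} (h1 : tr A = tr B)
    (h2 : A.1 1 0 - A.1 0 1 = B.1 1 0 - B.1 0 1) : ∃ φ, rot φ * A * (rot φ)⁻¹ = B := by
  have hA := det_eq A
  have hB := det_eq B
  rw [tr, tr] at h1
  obtain ⟨a, x, e1, e2⟩ : ∃ a x, (A.1 0 0 - A.1 1 1) = a * Real.cos x ∧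
      A.1 0 1 + A.1 1 0 = a * Real.sin x ∧ 0 ≤ a := by
    refine ⟨‖(⟨A.1 0 0 - A.1 1 1, A.1 0 1 + A.1 1 0⟩ : ℂ)‖, Complex.arg ⟨A.1 0 0 - A.1 1 1, A.1 0 1 + A.1 1 0⟩,
      ?_, ?_, norm_nonneg _⟩
    · rw [Complex.norm_mul_cos_arg]
    · rw [Complex.norm_mul_sin_arg]
  obtain ⟨b, y, f1, f2⟩ : ∃ a x, (B.1 0 0 - B.1 1 1) = a * Real.cos x ∧
      B.1 0 1 + B.1 1 0 = a * Real.sin x ∧ 0 ≤ a := by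
    refine ⟨‖(⟨B.1 0 0 - B.1 1 1, B.1 0 1 + B.1 1 0⟩ : ℂ)‖, Complex.arg ⟨B.1 0 0 - B.1 1 1, B.1 0 1 + B.1 1 0⟩,
      ?_, ?_, norm_nonneg _⟩
    · rw [Complex.norm_mul_cos_arg]
    · rw [Complex.norm_mul_sin_arg]
  obtain ⟨e2, ha⟩ := e2
  obtain ⟨f2, hb⟩ := f2
  -- The symmetric traceless part is a plane vector whose length is determined by det = 1, the trace
  -- and the antisymmetric part.
  have hab : a = b := by
    have : a ^ 2 = b ^ 2 := by
      have ex := Real.sin_sq_add_cos_sq x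
      have ey := Real.sin_sq_add_cos_sq y
      have e : a ^ 2 = (A.1 0 0 - A.1 1 1) ^ 2 + (A.1 0 1 + A.1 1 0) ^ 2 := by
        rw [e1, e2]; linear_combination (-a ^ 2) * ex
      have f : b ^ 2 = (B.1 0 0 - B.1 1 1) ^ 2 + (B.1 0 1 + B.1 1 0) ^ 2 := by
        rw [f1, f2]; linear_combination (-b ^ 2) * ey
      rw [e, f]
      linear_combination (A.1 0 0 + A.1 1 1 + B.1 0 0 + B.1 1 1) * h1 +
        (A.1 1 0 - A.1 0 1 + B.1 1 0 - B.1 0 1) * h2 - 4 * hA + 4 * hB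
    exact (pow_left_inj₀ ha hb two_ne_zero).1 this
  subst hab
  -- Conjugation by `rot φ` turns the symmetric traceless part by 2φ.
  have hy : y = x + 2 * ((y - x) / 2) := by ring
  generalize (y - x) / 2 = φ at hy
  subst hy
  rw [Real.cos_add, Real.cos_two_mul, Real.sin_two_mul] at f1
  rw [Real.sin_add, Real.cos_two_mul, Real.sin_two_mul] at f2
  have hφ := Real.sin_sq_add_cos_sq φ
  have g1 : B.1 0 0 - B.1 1 1 = (A.1 0 0 - A.1 1 1) * (2 * Real.cos φ ^ 2 - 1) -
      (A.1 0 1 + A.1 1 0) * (2 * Real.sin φ * Real.cos φ) := by rw [f1, e1, e2]; ring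
  have g2 : B.1 0 1 + B.1 1 0 = (A.1 0 1 + A.1 1 0) * (2 * Real.cos φ ^ 2 - 1) +
      (A.1 0 0 - A.1 1 1) * (2 * Real.sin φ * Real.cos φ) := by rw [f2, e1, e2]; ring
  refine ⟨φ, ?_⟩
  apply ext_entries <;> simp only [mul_apply, inv_zero_zero, inv_zero_one, inv_one_zero,
    inv_one_one, rot_zero_zero, rot_zero_one, rot_one_zero, rot_one_one]
  · linear_combination (1/2) * h1 - (1/2) * g1 + A.1 1 1 * hφ
  · linear_combination (-1/2) * h2 - (1/2) * g2 - A.1 1 0 * hφ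
  · linear_combination (1/2) * h2 - (1/2) * g2 - A.1 0 1 * hφ
  · linear_combination (1/2) * h1 + (1/2) * g1 + A.1 0 0 * hφ

theorem rot_conj_rot (φ a : ℝ) : rot φ * rot a * (rot φ)⁻¹ = rot a := by
  rw [mul_inv_eq_iff_eq_mul]
  apply ext_entries <;> simp only [mul_apply, rot_zero_zero, rot_zero_one, rot_one_zero,
    rot_one_one] <;> ring

theorem tr_rot_mul (a : ℝ) (A : SL) :
    tr (rot a * A) = Real.cos a * tr A - Real.sin a * (A.1 1 0 - A.1 0 1) := by
  simp only [tr, mul_apply, rot_zero_zero, rot_zero_one, rot_one_zero, rot_one_one]; ring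

/-- Once the first element is `rot a`, the trace of the product fixes the antisymmetric part of the
second, and the centralizer of `rot a` does the rest. -/
theorem exists_conj_pair {a : ℝ} (hs : 0 < Real.sin a) {A₁ A₂ B₁ B₂ : SL} (hA : Ell a A₁)
    (hB : Ell a B₁) (h2 : tr A₂ = tr B₂) (h12 : tr (A₁ * A₂) = tr (B₁ * B₂)) :
    ∃ g : SL, g * A₁ * g⁻¹ = B₁ ∧ g * A₂ * g⁻¹ = B₂ := by
  obtain ⟨P, rfl⟩ := exists_conj_rot hA hs
  obtain ⟨Q, rfl⟩ := exists_conj_rot hB hs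
  have e1 : tr (rot a * (P⁻¹ * A₂ * P)) = tr (rot a * (Q⁻¹ * B₂ * Q)) := by
    rw [← tr_conj P, ← tr_conj Q (rot a * (Q⁻¹ * B₂ * Q))]
    convert h12 using 2 <;> group
  have e2 : tr (P⁻¹ * A₂ * P) = tr (Q⁻¹ * B₂ * Q) := by
    rw [← tr_conj P, ← tr_conj Q (Q⁻¹ * B₂ * Q)]
    convert h2 using 2 <;> group
  rw [tr_rot_mul, tr_rot_mul, e2] at e1
  obtain ⟨φ, hφ⟩ := exists_rot_conj e2 (mul_left_cancel₀ hs.ne' (by linarith))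
  refine ⟨Q * rot φ * P⁻¹, ?_, ?_⟩
  · calc _ = Q * (rot φ * rot a * (rot φ)⁻¹) * Q⁻¹ := by group
      _ = _ := by rw [rot_conj_rot]
  · calc _ = Q * (rot φ * (P⁻¹ * A₂ * P) * (rot φ)⁻¹) * Q⁻¹ := by group
      _ = _ := by rw [hφ]; group

theorem tr_mul_eq (B C : SL) : 2 * tr (B * C) = tr B * tr C
    - (B.1 1 0 - B.1 0 1) * (C.1 1 0 - C.1 0 1) + ((B.1 0 0 - B.1 1 1) * (C.1 0 0 - C.1 1 1) +
      (B.1 0 1 + B.1 1 0) * (C.1 0 1 + C.1 1 0)) := by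
  simp only [tr, mul_apply]; ring

theorem tr_mul_mul_rot (a : ℝ) (B C : SL) : 2 * tr (C * B * rot a) = 2 * Real.cos a * tr (B * C)
    - Real.sin a * (tr B * (C.1 1 0 - C.1 0 1) + (B.1 1 0 - B.1 0 1) * tr C)
    - Real.sin a * ((B.1 0 0 - B.1 1 1) * (C.1 0 1 + C.1 1 0) -
      (B.1 0 1 + B.1 1 0) * (C.1 0 0 - C.1 1 1)) := by
  simp only [tr, mul_apply, rot_zero_zero, rot_zero_one, rot_one_zero, rot_one_one]; ring

/-- The first two traces fix the scalar and antisymmetric parts of C. The other two fix the inner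
product and the oriented area of its symmetric traceless part with that of B, which determines it
because the latter is nonzero by `hB`. -/
theorem eq_of_tr_eq {a : ℝ} (hs : 0 < Real.sin a) {B C D : SL} (h : tr C = tr D)
    (h1 : tr (rot a * C) = tr (rot a * D)) (h2 : tr (B * C) = tr (B * D))
    (h3 : tr (C * B * rot a) = tr (D * B * rot a))
    (hB : ¬(B.1 0 0 - B.1 1 1 = 0 ∧ B.1 0 1 + B.1 1 0 = 0)) : C = D := by
  rw [tr_rot_mul, tr_rot_mul, h] at h1
  have i : C.1 1 0 - C.1 0 1 = D.1 1 0 - D.1 0 1 := mul_left_cancel₀ hs.ne' (by linarith)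
  have k2 := tr_mul_eq B C
  have k2' := tr_mul_eq B D
  have k3 := tr_mul_mul_rot a B C
  have k3' := tr_mul_mul_rot a B D
  rw [h, i, h2, k2'] at k2
  rw [h, i, h2, h3, k3'] at k3
  rw [tr, tr] at h
  clear k2' k3' h1 h2 h3
  have k4 := mul_left_cancel₀ hs.ne' (sub_right_inj.1 k3)
  have k5 := add_left_cancel k2
  clear k2 k3
  generalize B.1 0 0 - B.1 1 1 = m at *
  generalize B.1 0 1 + B.1 1 0 = l at *
  have hpos : m ^ 2 + l ^ 2 ≠ 0 := by
    intro h0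
    exact hB ⟨by nlinarith [sq_nonneg m, sq_nonneg l], by nlinarith [sq_nonneg m, sq_nonneg l]⟩
  have d1 : C.1 0 0 - C.1 1 1 = D.1 0 0 - D.1 1 1 := by
    apply mul_left_cancel₀ hpos
    linear_combination (-m) * k5 + l * k4
  have d2 : C.1 0 1 + C.1 1 0 = D.1 0 1 + D.1 1 0 := by
    apply mul_left_cancel₀ hpos
    linear_combination (-l) * k5 - m * k4
  apply ext_entries <;> linarith

theorem exists_conj_triple_rot {a : ℝ} (hs : 0 < Real.sin a) {A₂ A₃ B₂ B₃ : SL}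
    (h2 : tr A₂ = tr B₂) (h3 : tr A₃ = tr B₃)
    (h12 : tr (rot a * A₂) = tr (rot a * B₂)) (h13 : tr (rot a * A₃) = tr (rot a * B₃))
    (h23 : tr (A₂ * A₃) = tr (B₂ * B₃)) (h123 : tr (A₃ * A₂ * rot a) = tr (B₃ * B₂ * rot a)) :
    ∃ φ, rot φ * A₂ * (rot φ)⁻¹ = B₂ ∧ rot φ * A₃ * (rot φ)⁻¹ = B₃ := by
  have k2 := h12
  have k3 := h13
  rw [tr_rot_mul, tr_rot_mul, h2] at k2
  rw [tr_rot_mul, tr_rot_mul, h3] at k3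
  have i2 : A₂.1 1 0 - A₂.1 0 1 = B₂.1 1 0 - B₂.1 0 1 := mul_left_cancel₀ hs.ne' (by linarith)
  have i3 : A₃.1 1 0 - A₃.1 0 1 = B₃.1 1 0 - B₃.1 0 1 := mul_left_cancel₀ hs.ne' (by linarith)
  -- In the degenerate case B₂ commutes with all rotations about i, so the rotation can be chosen to
  -- match the third element only.
  by_cases hB : B₂.1 0 0 - B₂.1 1 1 = 0 ∧ B₂.1 0 1 + B₂.1 1 0 = 0
  · obtain ⟨φ, hφ⟩ := exists_rot_conj h3 i3
    obtain ⟨ψ, hψ⟩ := exists_rot_conj h2.symm i2.symm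
    refine ⟨φ, ?_, hφ⟩
    have comm : ∀ χ, rot χ * B₂ * (rot χ)⁻¹ = B₂ := by
      intro χ
      rw [mul_inv_eq_iff_eq_mul]
      have e1 : B₂.1 1 1 = B₂.1 0 0 := by linarith [hB.1]
      have e2 : B₂.1 1 0 = -B₂.1 0 1 := by linarith [hB.2]
      apply ext_entries <;> simp only [mul_apply, rot_zero_zero, rot_zero_one, rot_one_zero,
        rot_one_one, e1, e2] <;> ring
    rw [comm] at hψ
    rw [← hψ, comm]
  · obtain ⟨φ, hφ⟩ := exists_rot_conj h2 i2
    refine ⟨φ, hφ, ?_⟩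
    obtain ⟨C, hC⟩ : ∃ C, C = rot φ * A₃ * (rot φ)⁻¹ := ⟨_, rfl⟩
    rw [← hC]
    have c3 : tr C = tr B₃ := by rw [hC, tr_conj, h3]
    have c13 : tr (rot a * C) = tr (rot a * B₃) := by
      rw [← h13, hC, ← tr_conj (rot φ) (rot a * A₃)]
      calc _ = tr ((rot φ * rot a * (rot φ)⁻¹) * (rot φ * A₃ * (rot φ)⁻¹)) := by rw [rot_conj_rot]
        _ = _ := by congr 1; group
    have c23 : tr (B₂ * C) = tr (B₂ * B₃) := by
      rw [← h23, hC, ← tr_conj (rot φ) (A₂ * A₃), ← hφ]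
      congr 1
      group
    have c123 : tr (C * B₂ * rot a) = tr (B₃ * B₂ * rot a) := by
      rw [← h123, hC, ← tr_conj (rot φ) (A₃ * A₂ * rot a), ← hφ]
      calc _ = tr (rot φ * A₃ * (rot φ)⁻¹ * (rot φ * A₂ * (rot φ)⁻¹) *
            (rot φ * rot a * (rot φ)⁻¹)) := by rw [rot_conj_rot]
        _ = _ := by congr 1; group
    exact eq_of_tr_eq hs c3 c13 c23 c123 hB

/-- The trace of the triple product is needed to tell a configuration from its mirror image, which
has the same traces of pairs. -/
theorem exists_conj_triple {a : ℝ} (hs : 0 < Real.sin a) {A₁ A₂ A₃ B₁ B₂ B₃ : SL}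
    (hA : Ell a A₁) (hB : Ell a B₁) (h2 : tr A₂ = tr B₂) (h3 : tr A₃ = tr B₃)
    (h12 : tr (A₁ * A₂) = tr (B₁ * B₂)) (h13 : tr (A₁ * A₃) = tr (B₁ * B₃))
    (h23 : tr (A₂ * A₃) = tr (B₂ * B₃)) (h123 : tr (A₃ * A₂ * A₁) = tr (B₃ * B₂ * B₁)) :
    ∃ g : SL, g * A₁ * g⁻¹ = B₁ ∧ g * A₂ * g⁻¹ = B₂ ∧ g * A₃ * g⁻¹ = B₃ := by
  obtain ⟨P, rfl⟩ := exists_conj_rot hA hs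
  obtain ⟨Q, rfl⟩ := exists_conj_rot hB hs
  obtain ⟨φ, h, h'⟩ := exists_conj_triple_rot (a := a) hs (A₂ := P⁻¹ * A₂ * P)
    (A₃ := P⁻¹ * A₃ * P) (B₂ := Q⁻¹ * B₂ * Q) (B₃ := Q⁻¹ * B₃ * Q)
    (by rw [← tr_conj P, ← tr_conj Q (Q⁻¹ * B₂ * Q)]; convert h2 using 2 <;> group)
    (by rw [← tr_conj P, ← tr_conj Q (Q⁻¹ * B₃ * Q)]; convert h3 using 2 <;> group)
    (by
      rw [← tr_conj P, ← tr_conj Q (rot a * (Q⁻¹ * B₂ * Q))]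
      convert h12 using 2 <;> group)
    (by
      rw [← tr_conj P, ← tr_conj Q (rot a * (Q⁻¹ * B₃ * Q))]
      convert h13 using 2 <;> group)
    (by
      rw [← tr_conj P, ← tr_conj Q (Q⁻¹ * B₂ * Q * (Q⁻¹ * B₃ * Q))]
      convert h23 using 2 <;> group)
    (by
      rw [← tr_conj P, ← tr_conj Q (Q⁻¹ * B₃ * Q * (Q⁻¹ * B₂ * Q) * rot a)]
      convert h123 using 2 <;> group)
  refine ⟨Q * rot φ * P⁻¹, ?_, ?_, ?_⟩
  · calc _ = Q * (rot φ * rot a * (rot φ)⁻¹) * Q⁻¹ := by group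
      _ = _ := by rw [rot_conj_rot]
  · calc _ = Q * (rot φ * (P⁻¹ * A₂ * P) * (rot φ)⁻¹) * Q⁻¹ := by group
      _ = _ := by rw [h]; group
  · calc _ = Q * (rot φ * (P⁻¹ * A₃ * P) * (rot φ)⁻¹) * Q⁻¹ := by group
      _ = _ := by rw [h']; group

/-- Two rotations with distinct centres have trivial common centralizer. -/
theorem eq_one_or_neg_one_of_commute {a b : ℝ} {A B h : SL} (ha : 0 < Real.sin a)
    (hb : 0 < Real.sin b) (hA : Ell a A) (hB : Ell b B) (hne : tr (A * B) ≠ 2 * Real.cos (a + b))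
    (h1 : h * A = A * h) (h2 : h * B = B * h) : h = 1 ∨ h = -1 := by
  obtain ⟨P, rfl⟩ := exists_conj_rot hA ha
  set k := P⁻¹ * h * P with hk
  set C := P⁻¹ * B * P with hC
  have hCe : Ell b C := by simpa [hC] using hB.conj hb.ne' P⁻¹
  have k1 : k * rot a = rot a * k := by
    calc _ = P⁻¹ * (h * (P * rot a * P⁻¹)) * P := by rw [hk]; group
      _ = _ := by rw [h1, hk]; group
  have k2 : k * C = C * k := by
    calc _ = P⁻¹ * (h * B) * P := by rw [hk, hC]; group
      _ = _ := by rw [h2, hk, hC]; group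
  have hne' : tr (rot a * C) ≠ 2 * Real.cos (a + b) := by
    rwa [← tr_conj P, show P * (rot a * C) * P⁻¹ = P * rot a * P⁻¹ * B by rw [hC]; group]
  obtain ⟨m, y, z, h00, h01, h10, h11, hy, hz, hyz⟩ := hCe.coords hb.ne'
  have kd := det_eq k
  have e1 : k.1 0 1 = -k.1 1 0 := by
    have := congrArg (fun X : SL => X.1 0 0) k1
    simp only [mul_apply, rot_zero_zero, rot_zero_one, rot_one_zero] at this
    apply mul_left_cancel₀ ha.ne'; linarith
  have e2 : k.1 1 1 = k.1 0 0 := by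
    have := congrArg (fun X : SL => X.1 1 0) k1
    simp only [mul_apply, rot_zero_zero, rot_one_zero, rot_one_one] at this
    apply mul_left_cancel₀ ha.ne'; linarith
  have f1 : k.1 1 0 * (y - z) = 0 := by
    have := congrArg (fun X : SL => X.1 0 0) k2
    simp only [mul_apply, h00, h01, h10, e1] at this
    linarith
  have f2 : k.1 1 0 * m = 0 := by
    have := congrArg (fun X : SL => X.1 1 0) k2
    simp only [mul_apply, h00, h10, h11, e2] at this
    linarith
  have hk0 : k.1 1 0 = 0 := by
    by_contra h0
    have hm : m = 0 := (mul_eq_zero.1 f2).resolve_left h0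
    have hyz' : y = z := by linarith [(mul_eq_zero.1 f1).resolve_left h0]
    subst hm hyz'
    have : y = Real.sin b := (pow_left_inj₀ hy.le hb.le two_ne_zero).1 (by linarith)
    apply hne'
    rw [tr_rot_mul, hCe.1, h10, h01, this, Real.cos_add]; ring
  rw [hk0] at e1
  rw [hk0, e1, e2] at kd
  have hh : h = P * k * P⁻¹ := by rw [hk]; group
  have : (k.1 0 0 - 1) * (k.1 0 0 + 1) = 0 := by linarith
  rcases mul_eq_zero.1 this with h0 | h0
  · left
    have : k = 1 := by
      apply ext_entries <;> simp only [one_zero_zero, one_zero_one, one_one_zero, one_one_one] <;>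
        linarith
    rw [hh, this]; group
  · right
    have : k = -1 := by
      apply ext_entries <;> simp only [neg_apply, one_zero_zero, one_zero_one, one_one_zero,
        one_one_one] <;> linarith
    rw [hh, this]; simp

end SL
end HexagonSpace

/-! ### Causality in the Minkowski space of traceless matrices, and centralizers. -/

namespace HexagonSpace
namespace SL

theorem le_mixed_product {s m y z m' y' z' : ℝ} (hy : 0 < y) (hz : 0 < z) (hy' : 0 < y')
    (hz' : 0 < z') (h : y * z = m ^ 2 + s ^ 2) (h' : y' * z' = m' ^ 2 + s ^ 2) :
    2 * m * m' + 2 * s ^ 2 ≤ y * z' + z * y' := by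
  have key : m * m' + s ^ 2 ≤ (y * z' + z * y') / 2 := by
    refine le_of_abs_le (abs_le_of_sq_le_sq ?_ (by positivity))
    have : (m * m' + s ^ 2) ^ 2 ≤ (y * z) * (y' * z') := by
      rw [h, h']; nlinarith [sq_nonneg (m * s - m' * s)]
    nlinarith [sq_nonneg (y * z' - z * y')]
  linarith

/-- A causal vector whose product with some future timelike vector has the sign of the future lies
in the closed future cone. -/
theorem nonneg_of_causal {m y z n u v : ℝ} (h : m ^ 2 ≤ y * z) (hu : 0 < u) (hv : 0 < v)
    (h' : n ^ 2 < u * v) (hp : 0 ≤ y * v + z * u - 2 * m * n) : 0 ≤ y ∧ 0 ≤ z := by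
  have hyz : 0 ≤ y * z := (sq_nonneg m).trans h
  by_cases hm : m = 0
  · subst hm
    rcases eq_or_ne y 0 with rfl | hy
    · exact ⟨le_rfl, le_of_mul_le_mul_right (by linarith) hu⟩
    rcases eq_or_ne z 0 with rfl | hz
    · exact ⟨le_of_mul_le_mul_right (by linarith) hv, le_rfl⟩
    rcases lt_or_gt_of_ne hy with hy | hy
    · have hz : z < 0 := by
        rcases lt_or_gt_of_ne hz with hz | hz
        · exact hz
        · nlinarith
      nlinarith
    · exact ⟨hy.le, le_of_not_gt fun hz => by nlinarith⟩
  · have hm2 : 0 < m ^ 2 := by positivity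
    have hyz' : 0 < y * z := hm2.trans_le h
    rcases lt_or_gt_of_ne (left_ne_zero_of_mul hyz'.ne') with hy | hy
    · exfalso
      have hz : z < 0 := by nlinarith
      have h1 : (m * n) ^ 2 < (y * z) * (u * v) := by
        rw [mul_pow]
        calc m ^ 2 * n ^ 2 < m ^ 2 * (u * v) := mul_lt_mul_of_pos_left h' hm2
          _ ≤ _ := mul_le_mul_of_nonneg_right h (by positivity)
      have h2 : |m * n| < (-(y * v) - z * u) / 2 := by
        refine abs_lt_of_sq_lt_sq ?_ (by nlinarith)
        nlinarith [sq_nonneg (y * v - z * u)]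
      have := (abs_lt.1 h2).1
      nlinarith
    · exact ⟨hy.le, le_of_not_gt fun hz => by nlinarith⟩

theorem cos_add_cos_nonneg {a b : ℝ} (ha : 0 ≤ a) (hb : 0 ≤ b) (h : a + b ≤ Real.pi) :
    0 ≤ Real.cos a + Real.cos b := by
  have := Real.cos_le_cos_of_nonneg_of_le_pi ha (by linarith) (show a ≤ Real.pi - b by linarith)
  rw [Real.cos_pi_sub] at this
  linarith

theorem cos_add_cos_nonpos {a b : ℝ} (ha : a ≤ Real.pi) (hb : b ≤ Real.pi)
    (h : Real.pi ≤ a + b) : Real.cos a + Real.cos b ≤ 0 := by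
  have := cos_add_cos_nonneg (a := Real.pi - a) (b := Real.pi - b) (by linarith) (by linarith)
    (by linarith)
  rw [Real.cos_pi_sub, Real.cos_pi_sub] at this
  linarith

/-- A non-hyperbolic product of two elliptic elements rotates in the direction determined by the
sign of the sum of the cosines of their angles. -/
theorem causal_mul {ε a b : ℝ} {A B : SL} (hε : ε ^ 2 = 1) (ha : 0 < Real.sin a)
    (hb : 0 < Real.sin b) (hA : Ell a A) (hB : Ell b B)
    (h : 0 ≤ ε * (Real.cos a + Real.cos b)) (ht : -2 ≤ tr (B * A)) (ht' : tr (B * A) ≤ 2) :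
    0 ≤ ε * (B * A).1 1 0 ∧ ε * (B * A).1 0 1 ≤ 0 := by
  obtain ⟨m, y, z, h00, h01, h10, h11, hy, hz, hyz⟩ := hA.coords ha.ne'
  obtain ⟨m', y', z', h00', h01', h10', h11', hy', hz', hyz'⟩ := hB.coords hb.ne'
  obtain ⟨g, hg⟩ : ∃ g, g = B * A := ⟨_, rfl⟩
  have e1 : tr (g * A⁻¹) = tr B := by rw [hg]; congr 1; group
  have e2 : tr (g * B⁻¹) = tr A := by rw [hg, tr_conj]
  rw [← hg] at ht ht' ⊢
  rw [tr_mul_inv, hA.1, hB.1] at e1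
  rw [tr_mul_inv, hA.1, hB.1] at e2
  have gd := det_eq g
  simp only [tr, mul_apply, h00, h01, h10, h11, h00', h01', h10', h11'] at e1 e2 ht ht'
  have f1 : -g.1 0 1 * z + g.1 1 0 * y - 2 * ((g.1 0 0 - g.1 1 1) / 2) * m =
      2 * (Real.cos b - (g.1 0 0 + g.1 1 1) / 2 * Real.cos a) := by linear_combination e1
  have f2 : -g.1 0 1 * z' + g.1 1 0 * y' - 2 * ((g.1 0 0 - g.1 1 1) / 2) * m' =
      2 * (Real.cos a - (g.1 0 0 + g.1 1 1) / 2 * Real.cos b) := by linear_combination e2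
  have hK : (ε * ((g.1 0 0 - g.1 1 1) / 2)) ^ 2 ≤ (ε * -g.1 0 1) * (ε * g.1 1 0) := by
    have : (ε * -g.1 0 1) * (ε * g.1 1 0) - (ε * ((g.1 0 0 - g.1 1 1) / 2)) ^ 2 =
        1 - ((g.1 0 0 + g.1 1 1) / 2) ^ 2 := by
      linear_combination (-g.1 0 1 * g.1 1 0 - ((g.1 0 0 - g.1 1 1) / 2) ^ 2) * hε + gd
    nlinarith
  -- With 2α = tr g the sum is ε(1 − α)(cos a + cos b). So the traceless part of εg has a
  -- nonnegative product with the traceless part of A or of B, and either suffices.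
  have hsum : 0 ≤ ε * (Real.cos b - (g.1 0 0 + g.1 1 1) / 2 * Real.cos a) +
      ε * (Real.cos a - (g.1 0 0 + g.1 1 1) / 2 * Real.cos b) := by
    have : 0 ≤ (1 - (g.1 0 0 + g.1 1 1) / 2) * (ε * (Real.cos a + Real.cos b)) :=
      mul_nonneg (by linarith) h
    linarith
  have key : 0 ≤ ε * -g.1 0 1 ∧ 0 ≤ ε * g.1 1 0 := by
    rcases le_or_gt 0 (ε * (Real.cos b - (g.1 0 0 + g.1 1 1) / 2 * Real.cos a)) with h0 | h0
    · exact nonneg_of_causal (n := m) hK hy hz (by rw [hyz]; exact lt_add_of_pos_right _ (pow_pos ha 2))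
        (by linear_combination 2 * h0 - ε * f1)
    · exact nonneg_of_causal (n := m') hK hy' hz' (by rw [hyz']; exact lt_add_of_pos_right _ (pow_pos hb 2))
        (by linear_combination 2 * hsum + 2 * h0 - ε * f2)
  exact ⟨key.2, by linarith [key.1]⟩

theorem cos_add_lt_one {a b : ℝ} (ha : a ∈ Set.Ioo 0 Real.pi) (hb : b ∈ Set.Ioo 0 Real.pi) :
    Real.cos (a + b) < 1 := by
  refine lt_of_le_of_ne (Real.cos_le_one _) fun h => ?_
  have := (Real.cos_eq_one_iff_of_lt_of_lt (by linarith [ha.1, hb.1, Real.pi_pos])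
    (by linarith [ha.2, hb.2])).1 h
  linarith [ha.1, hb.1]

theorem neg_one_lt_cos_add {a b : ℝ} (ha : a ∈ Set.Ioo 0 Real.pi) (hb : b ∈ Set.Ioo 0 Real.pi)
    (h : a + b ≠ Real.pi) : -1 < Real.cos (a + b) := by
  refine lt_of_le_of_ne (Real.neg_one_le_cos _) fun h' => h ?_
  have h1 : Real.cos (a + b - Real.pi) = 1 := by rw [Real.cos_sub_pi, ← h']; norm_num
  have := (Real.cos_eq_one_iff_of_lt_of_lt (by linarith [ha.1, hb.1, Real.pi_pos])
    (by linarith [ha.2, hb.2, Real.pi_pos])).1 h1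
  linarith

theorem add_eq_pi_of_mul_eq_neg_one {a b : ℝ} (ha : a ∈ Set.Ioo 0 Real.pi)
    (hb : b ∈ Set.Ioo 0 Real.pi) {A B : SL} (hA : Ell a A) (hB : Ell b B) (h : B * A = -1) :
    a + b = Real.pi := by
  have h1 : B = -A⁻¹ := by
    rw [eq_mul_inv_of_mul_eq h, neg_one_mul]
  have h2 : Real.cos b = Real.cos (Real.pi - a) := by
    have := hB.1
    rw [h1, tr_neg, tr_inv, hA.1] at this
    rw [Real.cos_pi_sub]; linarith
  have := Real.injOn_cos ⟨hb.1.le, hb.2.le⟩ ⟨by linarith [ha.2], by linarith [ha.1]⟩ h2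
  linarith

/-- Otherwise `causal_mul`, with one and the same ε, puts the traceless parts of A₂A₁ and of its
inverse A₀A₃ into the same closed cone. They are opposite, hence zero, and the product is central;
as its trace is less than 2 it is −1. -/
theorem hyperbolic_of_good {b : Fin 4 → ℝ} (hb : ∀ j, b j ∈ Set.Ioo 0 Real.pi) {A : Fin 4 → SL}
    (hA : ∀ j, Ell (b j) (A j)) (h : A 3 * A 2 * A 1 * A 0 = 1)
    (hg : b 1 + b 2 ≤ Real.pi ∧ b 0 + b 3 ≤ Real.pi ∨ Real.pi ≤ b 1 + b 2 ∧ Real.pi ≤ b 0 + b 3) :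
    tr (A 2 * A 1) < -2 ∨ (A 2 * A 1 = -1 ∧ b 1 + b 2 = Real.pi ∧ b 0 + b 3 = Real.pi) := by
  by_contra! hc
  obtain ⟨ht, hc⟩ := hc
  have hs := fun j => sin_pos (hb j)
  have hinv : A 0 * A 3 = (A 2 * A 1)⁻¹ := by
    rw [eq_inv_iff_mul_eq_one]
    calc _ = A 0 * (A 3 * A 2 * A 1 * A 0) * (A 0)⁻¹ := by group
      _ = 1 := by rw [h]; group
  have ht2 : tr (A 2 * A 1) < 2 := by
    have h1 := tr_mul_le (hA 2) (hA 1) (hs 2).ne' (hs 1).ne'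
    have h2 := cos_add_lt_one (hb 2) (hb 1)
    linarith
  obtain ⟨ε, hε, h12, h03⟩ : ∃ ε : ℝ, ε ^ 2 = 1 ∧ 0 ≤ ε * (Real.cos (b 1) + Real.cos (b 2)) ∧
      0 ≤ ε * (Real.cos (b 3) + Real.cos (b 0)) := by
    rcases hg with ⟨h1, h2⟩ | ⟨h1, h2⟩
    · exact ⟨1, by norm_num, by linarith [cos_add_cos_nonneg (hb 1).1.le (hb 2).1.le h1],
        by linarith [cos_add_cos_nonneg (hb 0).1.le (hb 3).1.le h2]⟩
    · exact ⟨-1, by norm_num, by linarith [cos_add_cos_nonpos (hb 1).2.le (hb 2).2.le h1],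
        by linarith [cos_add_cos_nonpos (hb 0).2.le (hb 3).2.le h2]⟩
  have k1 := causal_mul hε (hs 1) (hs 2) (hA 1) (hA 2) h12 ht ht2.le
  have k2 := causal_mul hε (hs 3) (hs 0) (hA 3) (hA 0) h03 (by rwa [hinv, tr_inv])
    (by rw [hinv, tr_inv]; exact ht2.le)
  rw [hinv, inv_one_zero, inv_zero_one] at k2
  obtain ⟨g, hgd⟩ : ∃ g, g = A 2 * A 1 := ⟨_, rfl⟩
  rw [← hgd] at k1 k2 ht ht2
  have hε0 : ε ≠ 0 := fun h0 => by rw [h0] at hε; norm_num at hε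
  have g10 : g.1 1 0 = 0 := mul_left_cancel₀ hε0 (by linarith [k1.1, k2.1])
  have g01 : g.1 0 1 = 0 := mul_left_cancel₀ hε0 (by linarith [k1.2, k2.2])
  have gd := det_eq g
  rw [g10, g01] at gd
  rw [tr] at ht ht2
  have e : (g.1 0 0 - g.1 1 1) ^ 2 = 0 := by
    refine le_antisymm ?_ (sq_nonneg _)
    nlinarith
  have e' : g.1 1 1 = g.1 0 0 := by linarith [pow_eq_zero_iff (two_ne_zero) |>.1 e]
  rw [e'] at gd ht2
  have e'' : (g.1 0 0 - 1) * (g.1 0 0 + 1) = 0 := by linarith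
  have g00 : g.1 0 0 = -1 := by
    rcases mul_eq_zero.1 e'' with h0 | h0 <;> linarith
  have hgm : A 2 * A 1 = -1 := by
    rw [← hgd]
    apply ext_entries <;> simp only [neg_apply, one_zero_zero, one_zero_one, one_one_zero,
        one_one_one, g10, g01, e', g00, neg_zero]
  refine hc hgm (add_eq_pi_of_mul_eq_neg_one (hb 1) (hb 2) (hA 1) (hA 2) hgm) ?_
  rw [add_comm]
  exact add_eq_pi_of_mul_eq_neg_one (hb 3) (hb 0) (hA 3) (hA 0) (by rw [hinv, hgm]; simp)

theorem continuous_of_entries {X : Type*} [TopologicalSpace X] {f : X → SL}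
    (h00 : Continuous fun x => (f x).1 0 0) (h01 : Continuous fun x => (f x).1 0 1)
    (h10 : Continuous fun x => (f x).1 1 0) (h11 : Continuous fun x => (f x).1 1 1) :
    Continuous f := by
  refine continuous_induced_rng.2 (continuous_matrix fun i j => ?_)
  fin_cases i <;> fin_cases j <;> assumption

theorem continuous_entry (i j : Fin 2) : Continuous fun A : SL => A.1 i j :=
  continuous_subtype_val.matrix_elem i j

theorem continuous_tr : Continuous tr :=
  (continuous_entry 0 0).add (continuous_entry 1 1)

/-- The normalization of the element `m + n K` of the centralizer of `g`, where `K` is the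
traceless part of `g`. -/
noncomputable def cen (g : SL) (m n : ℝ) (h : 0 < m ^ 2 + n ^ 2 * (1 - (tr g / 2) ^ 2)) : SL :=
  of ((√(m ^ 2 + n ^ 2 * (1 - (tr g / 2) ^ 2)))⁻¹ * (m + n * ((g.1 0 0 - g.1 1 1) / 2)))
    ((√(m ^ 2 + n ^ 2 * (1 - (tr g / 2) ^ 2)))⁻¹ * (n * g.1 0 1))
    ((√(m ^ 2 + n ^ 2 * (1 - (tr g / 2) ^ 2)))⁻¹ * (n * g.1 1 0))
    ((√(m ^ 2 + n ^ 2 * (1 - (tr g / 2) ^ 2)))⁻¹ * (m - n * ((g.1 0 0 - g.1 1 1) / 2))) (by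
      have h1 := Real.sq_sqrt h.le
      have h2 := Real.sqrt_pos.2 h
      have gd := det_eq g
      generalize √(m ^ 2 + n ^ 2 * (1 - (tr g / 2) ^ 2)) = r at *
      field_simp
      rw [tr] at h1
      rw [h1]
      linear_combination (4 * n ^ 2) * gd)

section cen
variable {g : SL} {m n : ℝ} {h : 0 < m ^ 2 + n ^ 2 * (1 - (tr g / 2) ^ 2)}

theorem cen_mul_comm : cen g m n h * g = g * cen g m n h := by
  apply ext_entries <;> simp only [cen, mul_apply, of_zero_zero, of_zero_one, of_one_zero,
    of_one_one] <;> ring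

theorem continuous_cen {X : Type*} [TopologicalSpace X] (g : SL) {m n : X → ℝ} (hm : Continuous m)
    (hn : Continuous n) (h : ∀ x, 0 < m x ^ 2 + n x ^ 2 * (1 - (tr g / 2) ^ 2)) :
    Continuous fun x => cen g (m x) (n x) (h x) := by
  have hr : Continuous fun x => (√(m x ^ 2 + n x ^ 2 * (1 - (tr g / 2) ^ 2)))⁻¹ :=
    Continuous.inv₀ (by fun_prop) fun x => (Real.sqrt_pos.2 (h x)).ne'
  apply continuous_of_entries <;> simp only [cen, of_zero_zero, of_zero_one, of_one_zero,
    of_one_one] <;> fun_prop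

end cen

theorem cen_one_zero {g : SL} {h} : cen g 1 0 h = 1 := by
  apply ext_entries <;> simp [cen, of_zero_zero, of_zero_one, of_one_zero,
    of_one_one]

theorem eq_zero_of_sum_sq_nonpos {x y z : ℝ} (h : x ^ 2 + y ^ 2 + z ^ 2 ≤ 0) :
    x = 0 ∧ y = 0 ∧ z = 0 := by
  refine ⟨?_, ?_, ?_⟩ <;> nlinarith [sq_nonneg x, sq_nonneg y, sq_nonneg z]

/-- Let X, X′, K be the traceless parts of A, A′, g. X and X′ are future timelike of equal length
and have the same product with K, so a transformation fixing K carries one to the other. The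
conclusion 0 ≤ m is what later allows a path to the identity. -/
theorem exists_cen_conj {b : ℝ} (hs : 0 < Real.sin b) {A A' g : SL} (hA : Ell b A)
    (hA' : Ell b A') (ht : tr (g * A) = tr (g * A')) (hg : g ≠ 1) (hg' : g ≠ -1) :
    ∃ (m n : ℝ) (h : 0 < m ^ 2 + n ^ 2 * (1 - (tr g / 2) ^ 2)), 0 ≤ m ∧
      cen g m n h * A = A' * cen g m n h := by
  obtain ⟨x, y, z, h00, h01, h10, h11, hy, hz, hyz⟩ := hA.coords hs.ne'
  obtain ⟨x', y', z', h00', h01', h10', h11', hy', hz', hyz'⟩ := hA'.coords hs.ne'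
  have gd := det_eq g
  obtain ⟨μ, hμ⟩ : ∃ μ, μ = (g.1 0 0 - g.1 1 1) / 2 := ⟨_, rfl⟩
  obtain ⟨Y, hY⟩ : ∃ Y, Y = -g.1 0 1 := ⟨_, rfl⟩
  obtain ⟨Z, hZ⟩ : ∃ Z, Z = g.1 1 0 := ⟨_, rfl⟩
  obtain ⟨k, hk⟩ : ∃ k, k = 1 - (tr g / 2) ^ 2 := ⟨_, rfl⟩
  have hkK : k = Y * Z - μ ^ 2 := by
    rw [hk, hY, hZ, hμ, tr]; linear_combination -gd
  have hK : ¬(μ = 0 ∧ Y = 0 ∧ Z = 0) := by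
    rintro ⟨h1, h2, h3⟩
    have e1 : g.1 1 1 = g.1 0 0 := by linarith
    have e2 : g.1 0 1 = 0 := by linarith
    have e3 : g.1 1 0 = 0 := by linarith
    rw [e1, e2, e3] at gd
    have : (g.1 0 0 - 1) * (g.1 0 0 + 1) = 0 := by linarith
    rcases mul_eq_zero.1 this with h0 | h0
    · exact hg (by apply ext_entries <;> simp only [one_zero_zero, one_zero_one, one_one_zero,
        one_one_one] <;> linarith)
    · exact hg' (by apply ext_entries <;> simp only [neg_apply, one_zero_zero, one_zero_one,
        one_one_zero, one_one_one] <;> linarith)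
  simp only [tr, mul_apply, h00, h01, h10, h11, h00', h01', h10', h11'] at ht
  have E1 : 2 * μ * (x - x') - Z * (y - y') - Y * (z - z') = 0 := by
    rw [hμ, hY, hZ]; linear_combination ht
  have E2 : 2 * (x + x') * (x - x') - (z + z') * (y - y') - (y + y') * (z - z') = 0 := by
    linear_combination 2 * hyz' - 2 * hyz
  have hYpos : 0 < (y + y') * (z + z') - (x + x') ^ 2 := by
    have := le_mixed_product hy hz hy' hz' hyz hyz'
    nlinarith [sq_pos_of_pos hs]
  -- it suffices to solve `m (X - X') = n ((X + X') K - τ)`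
  have red : ∀ m n : ℝ, (h : 0 < m ^ 2 + n ^ 2 * (1 - (tr g / 2) ^ 2)) →
      m * (x - x') = n * (((z + z') * Y - (y + y') * Z) / 2) →
      m * (y - y') = n * ((x + x') * Y - (y + y') * μ) →
      m * (z - z') = n * ((z + z') * μ - (x + x') * Z) →
      cen g m n h * A = A' * cen g m n h := by
    intro m n h e1 e2 e3
    have g01 : g.1 0 1 = -Y := by linarith
    apply ext_entries <;> simp only [cen, mul_apply, of_zero_zero, of_zero_one, of_one_zero,
      of_one_one, h00, h01, h10, h11, h00', h01', h10', h11', ← hμ, g01, ← hZ] <;>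
      generalize (√(m ^ 2 + n ^ 2 * (1 - (tr g / 2) ^ 2)))⁻¹ = r
    · linear_combination r * e1 + r * n / 2 * E1
    · linear_combination -r * e2
    · linear_combination r * e3
    · linear_combination -r * e1 + r * n / 2 * E1
  generalize hp : x + x' = p at *
  generalize hq : y + y' = q at *
  generalize hr : z + z' = r at *
  generalize hd1 : x - x' = d₁ at *
  generalize hd2 : y - y' = d₂ at *
  generalize hd3 : z - z' = d₃ at *
  have hDY : d₂ * d₃ - d₁ ^ 2 + (q * r - p ^ 2) = 4 * Real.sin b ^ 2 := by
    rw [← hp, ← hq, ← hr, ← hd1, ← hd2, ← hd3]; linear_combination 2 * hyz + 2 * hyz'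
  have hqpos : 0 < q := by rw [← hq]; linarith
  have hW : (p * Y - q * μ) * (r * μ - p * Z) - ((r * Y - q * Z) / 2) ^ 2 =
      k * (q * r - p ^ 2) - ((q * Z + r * Y - 2 * p * μ) / 2) ^ 2 := by
    rw [hkK]; ring
  -- X − X′ is orthogonal to K by `E1` and to X + X′ by `E2`, hence parallel to their cross product
  -- (w₁, w₂, w₃).
  have w12 : ((r * Y - q * Z) / 2) * d₂ = (p * Y - q * μ) * d₁ := by
    linear_combination (q / 2) * E1 - Y / 2 * E2
  have w13 : ((r * Y - q * Z) / 2) * d₃ = (r * μ - p * Z) * d₁ := by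
    linear_combination (-r / 2) * E1 + Z / 2 * E2
  have w23 : (p * Y - q * μ) * d₃ = (r * μ - p * Z) * d₂ := by
    linear_combination (-p) * E1 + μ * E2
  generalize hw1 : (r * Y - q * Z) / 2 = w₁ at *
  generalize hw2 : p * Y - q * μ = w₂ at *
  generalize hw3 : r * μ - p * Z = w₃ at *
  -- If the cross product vanishes, K is a nonzero multiple of the timelike vector X + X′, and the
  -- half-turn about this axis, given by K itself, exchanges X and X′.
  by_cases hw : w₁ = 0 ∧ w₂ = 0 ∧ w₃ = 0
  · obtain ⟨rfl, rfl, rfl⟩ := hw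
    have hkpos : 0 < 0 ^ 2 + 1 ^ 2 * k := by
      by_contra hneg
      apply hK
      have hk0 : k * (q * r - p ^ 2) ≤ 0 := mul_nonpos_of_nonpos_of_nonneg (by linarith) hYpos.le
      have hκ : (q * Z + r * Y - 2 * p * μ) / 2 = 0 := by
        have : ((q * Z + r * Y - 2 * p * μ) / 2) ^ 2 ≤ 0 := by
          linear_combination hk0 + hW
        exact pow_eq_zero_iff two_ne_zero |>.1 (le_antisymm this (sq_nonneg _))
      have hY0 : Y = 0 := by
        apply mul_left_cancel₀ hYpos.ne'
        linear_combination q * hκ + q * hw1 - p * hw2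
      subst hY0
      have hμ0 : μ = 0 := mul_left_cancel₀ hqpos.ne' (by linarith)
      exact ⟨hμ0, rfl, mul_left_cancel₀ hqpos.ne' (by linarith)⟩
    rw [hk] at hkpos
    exact ⟨0, 1, hkpos, le_rfl, red 0 1 hkpos (by ring) (by ring) (by ring)⟩
  · have hm : 0 < w₁ ^ 2 + w₂ ^ 2 + w₃ ^ 2 := by
      by_contra hneg
      exact hw (eq_zero_of_sum_sq_nonpos (not_lt.1 hneg))
    -- n/m is the factor in (d₁, d₂, d₃) = (n/m)(w₁, w₂, w₃), written with Euclidean products to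
    -- avoid division.
    obtain ⟨m, hmd⟩ : ∃ m, m = w₁ ^ 2 + w₂ ^ 2 + w₃ ^ 2 := ⟨_, rfl⟩
    obtain ⟨n, hn⟩ : ∃ n, n = d₁ * w₁ + d₂ * w₂ + d₃ * w₃ := ⟨_, rfl⟩
    rw [← hmd] at hm
    have f1 : m * d₁ = n * w₁ := by rw [hmd, hn]; linear_combination (-w₂) * w12 - w₃ * w13
    have f2 : m * d₂ = n * w₂ := by rw [hmd, hn]; linear_combination w₁ * w12 - w₃ * w23
    have f3 : m * d₃ = n * w₃ := by rw [hmd, hn]; linear_combination w₁ * w13 + w₂ * w23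
    have hpos : 0 < m ^ 2 + n ^ 2 * k := by
      have e : (m ^ 2 + n ^ 2 * k) * (q * r - p ^ 2) = 4 * m ^ 2 * Real.sin b ^ 2 +
          n ^ 2 * ((q * Z + r * Y - 2 * p * μ) / 2) ^ 2 := by
        linear_combination m ^ 2 * hDY - n ^ 2 * hW - m * d₃ * f2 - n * w₂ * f3 +
          (m * d₁ + n * w₁) * f1
      refine pos_of_mul_pos_left ?_ hYpos.le
      rw [e]; positivity
    rw [hk] at hpos
    exact ⟨m, n, hpos, hm.le, red m n hpos f1 f2 f3⟩

/-- The centralizer of `g` acts on its fixed circles through a connected group. -/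
theorem exists_path_conj {b : ℝ} (hs : 0 < Real.sin b) {A A' g : SL} (hA : Ell b A)
    (hA' : Ell b A') (ht : tr (g * A) = tr (g * A')) (hg : g ≠ 1) (hg' : g ≠ -1) :
    ∃ γ : unitInterval → SL, Continuous γ ∧ (∀ t, γ t * g = g * γ t) ∧ γ 0 = 1 ∧
      γ 1 * A * (γ 1)⁻¹ = A' := by
  obtain ⟨m, n, h, hm, e⟩ := exists_cen_conj hs hA hA' ht hg hg'
  -- The segment from (1, 0) to (m, n) keeps a positive determinant because the cross term is
  -- nonnegative for m ≥ 0.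
  have hp : ∀ t : unitInterval, 0 < (1 - (t : ℝ) + t * m) ^ 2 +
      (t * n) ^ 2 * (1 - (tr g / 2) ^ 2) := by
    intro t
    have h0 := t.2.1
    have h1 := t.2.2
    have : (1 - (t : ℝ) + t * m) ^ 2 + (t * n) ^ 2 * (1 - (tr g / 2) ^ 2) = (1 - (t : ℝ)) ^ 2 +
      2 * (1 - t) * t * m + t ^ 2 * (m ^ 2 + n ^ 2 * (1 - (tr g / 2) ^ 2)) := by ring
    rw [this]
    have h2 : 0 ≤ 2 * (1 - (t : ℝ)) * t * m :=
      mul_nonneg (mul_nonneg (by linarith) h0) hm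
    rcases h0.eq_or_lt with h3 | h3
    · rw [← h3]; norm_num
    · have := mul_pos (pow_pos h3 2) h
      nlinarith [sq_nonneg (1 - (t : ℝ))]
  refine ⟨fun t => cen g _ _ (hp t), continuous_cen g (by fun_prop) (by fun_prop) _,
    fun t => cen_mul_comm, ?_, ?_⟩
  · convert cen_one_zero (g := g) (h := by norm_num) using 2 <;> simp
  · have e1 : cen g (1 - ((1 : unitInterval) : ℝ) + (1 : unitInterval) * m)
      ((1 : unitInterval) * n) (hp 1) = cen g m n h := by congr 1 <;> simp
    simp only [mul_inv_eq_iff_eq_mul]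
    rw [e1, e]

end SL
end HexagonSpace

/-! ### Explicit families of relations with prescribed trace of A₂A₁. -/

namespace HexagonSpace
namespace SL

/-- If B turned the other way, `tr_mul_le` applied to A and B⁻¹ would give tr(AB) ≥ 2 cos(a − b) > 2
cos(a + b). -/
theorem ell_of_tr_mul_le {a b : ℝ} {A B : SL} (ha : 0 < Real.sin a) (hb : 0 < Real.sin b)
    (hA : Ell a A) (hB : tr B = 2 * Real.cos b) (h : tr (A * B) ≤ 2 * Real.cos (a + b)) :
    Ell b B := by
  refine ⟨hB, ?_⟩
  have hd := det_eq B
  have hsc := Real.sin_sq_add_cos_sq b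
  rcases lt_trichotomy (B.1 1 0) 0 with h0 | h0 | h0
  · have hB' : Ell b B⁻¹ := ⟨by rw [tr_inv, hB], by rw [inv_one_zero]; linarith⟩
    have := tr_mul_le hA hB' ha.ne' hb.ne'
    rw [tr_mul_inv, hA.1, hB] at this
    rw [Real.cos_add] at this h
    nlinarith [mul_pos ha hb]
  · rw [h0] at hd
    rw [tr] at hB
    have h2 : (B.1 0 0 + B.1 1 1) ^ 2 = (2 * Real.cos b) ^ 2 := by rw [hB]
    nlinarith [sq_nonneg (B.1 0 0 - B.1 1 1), pow_pos hb 2]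
  · exact h0

/-- The lower left entry of an elliptic element with constant diagonal and given trace of its
product with `!![α, -η; η (1 - α ^ 2), α]`. -/
noncomputable def secRoot (η a b α : ℝ) : ℝ :=
  η * (Real.cos b - α * Real.cos a) +
    √((Real.cos b - α * Real.cos a) ^ 2 - (1 - α ^ 2) * Real.sin a ^ 2)

/-- A quarter of the discriminant is (cos(a + b) − α)(cos(a − b) − α) ≥ 0. The chosen root is
positive: for α < −1 the product of the roots is negative, otherwise η(cos b − α cos a), half their
sum, is positive. -/
theorem secRoot_spec {η a b α : ℝ} (hη : η ^ 2 = 1) (ha : 0 < Real.sin a) (hb : 0 < Real.sin b)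
    (h : α ≤ Real.cos (a + b))
    (h' : α < -1 ∨ 0 < η * (Real.cos b - α * Real.cos a)) :
    0 < secRoot η a b α ∧ secRoot η a b α ^ 2 - 2 * η * (Real.cos b - α * Real.cos a) *
      secRoot η a b α + (1 - α ^ 2) * Real.sin a ^ 2 = 0 := by
  have h1 := Real.sin_sq_add_cos_sq a
  have h2 := Real.sin_sq_add_cos_sq b
  have hdisc : 0 ≤ (Real.cos b - α * Real.cos a) ^ 2 - (1 - α ^ 2) * Real.sin a ^ 2 := by
    have e : (Real.cos b - α * Real.cos a) ^ 2 - (1 - α ^ 2) * Real.sin a ^ 2 =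
        (Real.cos (a + b) - α) * (Real.cos (a + b) - α + 2 * (Real.sin a * Real.sin b)) := by
      rw [Real.cos_add]
      linear_combination (α ^ 2 - 1 + Real.sin b ^ 2) * h1 + (1 - Real.cos a ^ 2) * h2
    rw [e]
    exact mul_nonneg (by linarith) (by nlinarith [mul_pos ha hb])
  have hsq := Real.sq_sqrt hdisc
  rw [secRoot]
  generalize hκ : Real.cos b - α * Real.cos a = κ at *
  refine ⟨?_, ?_⟩
  · rcases h' with h' | h'
    · have : |η * κ| < √(κ ^ 2 - (1 - α ^ 2) * Real.sin a ^ 2) := by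
        apply Real.lt_sqrt_of_sq_lt
        rw [sq_abs, mul_pow, hη]
        nlinarith [mul_pos (show 0 < α ^ 2 - 1 by nlinarith) (pow_pos ha 2)]
      linarith [neg_abs_le (η * κ)]
    · exact add_pos_of_pos_of_nonneg h' (Real.sqrt_nonneg _)
  · linear_combination hsq - κ ^ 2 * hη

/-- The normal form of the product g is elliptic, parabolic or hyperbolic according to α, depends
continuously on α and is never ±1, so the family can pass through α = −1. The sign η is the
direction of g at elliptic values. -/
theorem exists_section_half {η a b : ℝ} (hη : η ^ 2 = 1) (ha : 0 < Real.sin a)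
    (hb : 0 < Real.sin b) (I : Set ℝ) (hI : ∀ α ∈ I, α ≤ Real.cos (a + b) ∧
      (α < -1 ∨ 0 < η * (Real.cos b - α * Real.cos a))) :
    ∃ F : I → SL, Continuous F ∧ ∀ α : I, Ell a (F α) ∧
      Ell b (of α (-η) (η * (1 - (α : ℝ) ^ 2)) α (by linear_combination (1 - (α : ℝ) ^ 2) * hη) *
        (F α)⁻¹) := by
  have hr : ∀ α : I, 0 < secRoot η a b α := fun α =>
    (secRoot_spec hη ha hb (hI α α.2).1 (hI α α.2).2).1
  have hc : Continuous fun α : I => secRoot η a b α := by unfold secRoot; fun_prop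
  have hd : ∀ α : I, Real.cos a * Real.cos a -
      -(Real.sin a ^ 2 / secRoot η a b α) * secRoot η a b α = 1 := by
    intro α
    have := Real.sin_sq_add_cos_sq a
    rw [neg_mul, div_mul_cancel₀ _ (hr α).ne']
    linarith
  refine ⟨fun α => of (Real.cos a) (-(Real.sin a ^ 2 / secRoot η a b α)) (secRoot η a b α)
    (Real.cos a) (hd α), ?_, fun α => ⟨?_, ?_⟩⟩
  · have : Continuous fun α : I => -(Real.sin a ^ 2 / secRoot η a b α) :=
      (continuous_const.div hc fun α => (hr α).ne').neg
    apply continuous_of_entries <;> simp only [of_zero_zero, of_zero_one, of_one_zero, of_one_one]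
      <;> first | exact continuous_const | assumption
  · exact ⟨by rw [tr, of_zero_zero, of_one_one]; ring, hr α⟩
  · refine ell_of_tr_mul_le ha hb (A := of (Real.cos a) (-(Real.sin a ^ 2 / secRoot η a b α))
      (secRoot η a b α) (Real.cos a) (hd α)) ⟨by rw [tr, of_zero_zero, of_one_one]; ring, hr α⟩ ?_ ?_
    · have h1 := (secRoot_spec hη ha hb (hI α α.2).1 (hI α α.2).2).2
      have h0 := (hr α).ne'
      simp only [tr, mul_apply, inv_zero_zero, inv_zero_one, inv_one_zero, inv_one_one,
        of_zero_zero, of_zero_one, of_one_zero, of_one_one]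
      generalize secRoot η a b α = r at *
      field_simp
      linear_combination η * h1 + 2 * r * (Real.cos b - α * Real.cos a) * hη
    · rw [tr_mul_comm, inv_mul_cancel_right, tr, of_zero_zero, of_one_one]
      linarith [(hI α α.2).1]

/-- A continuous family of relations with prescribed trace of a partial product. -/
theorem exists_section {η : ℝ} (hη : η ^ 2 = 1) {b : Fin 4 → ℝ} (hs : ∀ j, 0 < Real.sin (b j))
    (I : Set ℝ) (hI : ∀ α ∈ I, α ≤ Real.cos (b 1 + b 2) ∧ α ≤ Real.cos (b 0 + b 3) ∧
      (α < -1 ∨ 0 < η * (Real.cos (b 2) - α * Real.cos (b 1)) ∧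
        0 < η * (α * Real.cos (b 3) - Real.cos (b 0)))) :
    ∃ F : I → Fin 4 → SL, Continuous F ∧ ∀ α : I, (∀ j, Ell (b j) (F α j)) ∧
      F α 3 * F α 2 * F α 1 * F α 0 = 1 ∧ tr (F α 2 * F α 1) = 2 * α := by
  obtain ⟨F, hF, hF'⟩ := exists_section_half hη (hs 1) (hs 2) I fun α hα =>
    ⟨(hI α hα).1, (hI α hα).2.2.imp_right And.left⟩
  -- The other pair has the product A₀A₃ = (A₂A₁)⁻¹, whose normal form is the one with −η.
  obtain ⟨G, hG, hG'⟩ := exists_section_half (η := -η) (by linarith) (hs 3) (hs 0) I fun α hα =>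
    ⟨by rw [add_comm]; exact (hI α hα).2.1, (hI α hα).2.2.imp_right fun h => by linarith [h.2]⟩
  have hcont : ∀ ε : ℝ, ∀ h : ∀ α : I, (α : ℝ) * α - -ε * (ε * (1 - (α : ℝ) ^ 2)) = 1, Continuous fun α : I =>
      of (α : ℝ) (-ε) (ε * (1 - (α : ℝ) ^ 2)) α (h α) := by
    intro ε h
    apply continuous_of_entries <;> simp only [of_zero_zero, of_zero_one, of_one_zero, of_one_one]
      <;> fun_prop
  refine ⟨fun α => ![of α (- -η) (-η * (1 - (α : ℝ) ^ 2)) α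
      (by linear_combination (1 - (α : ℝ) ^ 2) * hη) * (G α)⁻¹, F α,
      of α (-η) (η * (1 - (α : ℝ) ^ 2)) α (by linear_combination (1 - (α : ℝ) ^ 2) * hη) *
        (F α)⁻¹, G α], ?_, fun α => ⟨?_, ?_, ?_⟩⟩
  · refine continuous_pi fun j => ?_
    fin_cases j
    · exact (hcont (-η) _).mul hG.inv
    · exact hF
    · exact (hcont η _).mul hF.inv
    · exact hG
  · intro j
    fin_cases j
    · exact (hG' α).2
    · exact (hF' α).1
    · exact (hF' α).2
    · exact (hG' α).1
  · simp only [Matrix.cons_val]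
    have e : ∀ h h', of (α : ℝ) (-η) (η * (1 - (α : ℝ) ^ 2)) α h *
        of (α : ℝ) (- -η) (-η * (1 - (α : ℝ) ^ 2)) α h' = 1 := by
      intro h h'
      apply ext_entries <;> simp only [mul_apply, of_zero_zero, of_zero_one, of_one_zero,
        of_one_one, one_zero_zero, one_zero_one, one_one_zero, one_one_one]
      · linear_combination (1 - (α : ℝ) ^ 2) * hη
      · ring
      · ring
      · linear_combination (1 - (α : ℝ) ^ 2) * hη
    rw [← mul_assoc, mul_assoc (G α), mul_assoc (G α), inv_mul_cancel_right, mul_assoc (G α), e,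
      one_mul, mul_inv_cancel]
  · simp only [Matrix.cons_val]
    rw [inv_mul_cancel_right, tr, of_zero_zero, of_one_one]; ring

/-- The half-turn about the point `e ^ (-t) i` of the upper half-plane. -/
noncomputable def halfTurn (t : ℝ) : SL :=
  of 0 (-Real.exp (-t)) (Real.exp t) 0 (by rw [zero_mul, neg_mul, ← Real.exp_add]; simp)

theorem continuous_halfTurn : Continuous halfTurn := by
  apply continuous_of_entries <;> simp only [halfTurn, of_zero_zero, of_zero_one, of_one_zero,
    of_one_one] <;> fun_prop

theorem ell_halfTurn (t : ℝ) : Ell (Real.pi / 2) (halfTurn t) :=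
  ⟨by rw [Real.cos_pi_div_two, tr, halfTurn, of_zero_zero, of_one_one]; ring, Real.exp_pos _⟩

theorem tr_halfTurn_mul (s t : ℝ) : tr (halfTurn s * halfTurn t) = -2 * Real.cosh (s - t) := by
  simp only [tr, halfTurn, mul_apply, of_zero_zero, of_zero_one, of_one_zero, of_one_one]
  rw [Real.cosh_eq, zero_mul, zero_add, add_zero, neg_mul, mul_neg,
    ← Real.exp_add, ← Real.exp_add, neg_add_eq_sub, ← sub_eq_add_neg, neg_sub]
  ring_nf

theorem halfTurn_relation (s t : ℝ) :
    halfTurn s * halfTurn t * halfTurn 0 * halfTurn (s - t) = 1 := by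
  have h1 := Real.exp_pos s
  have h2 := Real.exp_pos t
  apply ext_entries <;> simp only [mul_apply, halfTurn, of_zero_zero, of_zero_one, of_one_zero,
    of_one_one, one_zero_zero, one_zero_one, one_one_zero, one_one_one, Real.exp_neg,
    Real.exp_sub, Real.exp_zero] <;> field_simp <;> ring

/-- Relations between half-turns with `A₂A₁ = -1` deform to relations with `A₂A₁` hyperbolic. -/
theorem exists_halfTurn_path {A : Fin 4 → SL} (hA : ∀ j, Ell (Real.pi / 2) (A j))
    (h : A 3 * A 2 * A 1 * A 0 = 1) (h' : A 2 * A 1 = -1) :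
    ∃ γ : ℝ → Fin 4 → SL, Continuous γ ∧ (∀ t, (∀ j, Ell (Real.pi / 2) (γ t j)) ∧
      γ t 3 * γ t 2 * γ t 1 * γ t 0 = 1) ∧ (∃ B, ∀ j, γ 0 j = B * A j * B⁻¹) ∧
      tr (γ 1 2 * γ 1 1) < -2 := by
  have hinv : ∀ X : SL, Ell (Real.pi / 2) X → X⁻¹ = -X := by
    intro X hX
    have := hX.1
    rw [Real.cos_pi_div_two, tr] at this
    apply ext_entries <;> simp only [neg_apply, inv_zero_zero, inv_zero_one, inv_one_zero,
      inv_one_one] <;> linarith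
  have e1 : A 2 = A 1 := by
    rw [eq_mul_inv_of_mul_eq h', hinv _ (hA 1), neg_one_mul, neg_neg]
  have e0 : A 0 = A 3 := by
    have : A 3 * A 0 = -1 := by
      rw [mul_assoc (A 3), h', mul_neg_one, neg_mul] at h
      rw [← h, neg_neg]
    rw [eq_inv_mul_of_mul_eq this, hinv _ (hA 3), neg_mul_neg, mul_one]
  have hs : 0 < Real.sin (Real.pi / 2) := by rw [Real.sin_pi_div_two]; norm_num
  have h13 := tr_mul_le (hA 1) (hA 3) hs.ne' hs.ne'
  rw [add_halves, Real.cos_pi] at h13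
  -- Now A₂ = A₁ and A₀ = A₃, and s is, up to sign, the distance between the two centres. The path
  -- slides the centres of A₂ and A₀ along the geodesic in the normalized position.
  obtain ⟨s, hs0⟩ : ∃ s, tr (A 1 * A 3) = -2 * Real.cosh s := by
    obtain ⟨s, hs⟩ : ∃ s, Real.cosh s = -tr (A 1 * A 3) / 2 := by
      refine ⟨Real.arcosh (-tr (A 1 * A 3) / 2), Real.cosh_arcosh (by linarith)⟩
    exact ⟨s, by linarith⟩
  obtain ⟨B, hB1, hB3⟩ := exists_conj_pair (A₂ := A 3) (B₂ := halfTurn s) hs (hA 1) (ell_halfTurn 0)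
    (by rw [(hA 3).1, (ell_halfTurn s).1])
    (by rw [hs0, tr_halfTurn_mul, zero_sub, Real.cosh_neg])
  refine ⟨fun t => ![halfTurn (s - t), halfTurn 0, halfTurn t, halfTurn s], ?_, fun t => ⟨?_, ?_⟩,
    ⟨B, ?_⟩, ?_⟩
  · refine continuous_pi fun j => ?_
    fin_cases j
    · exact continuous_halfTurn.comp (by fun_prop)
    · exact continuous_const
    · exact continuous_halfTurn
    · exact continuous_const
  · intro j
    fin_cases j <;> exact ell_halfTurn _
  · exact halfTurn_relation s t
  · intro j
    fin_cases j
    · simp only [Fin.zero_eta, Matrix.cons_val, sub_zero, e0, hB3]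
    · simp only [Fin.mk_one, Matrix.cons_val, hB1]
    · simp only [Fin.reduceFinMk, Matrix.cons_val, e1, hB1]
    · simp only [Fin.reduceFinMk, Matrix.cons_val, hB3]
  · simp only [Matrix.cons_val]
    rw [tr_halfTurn_mul]
    have : 1 < Real.cosh (1 - 0) := Real.one_lt_cosh.2 (by norm_num)
    linarith

end SL
end HexagonSpace

/-! ### The double cover SL(2,ℝ) → PU(1,1) and the continuous elliptic lift. -/

namespace HexagonSpace
open SL

/-- The Cayley transform of a real matrix. -/
noncomputable def cayMat (A : SL) : Matrix (Fin 2) (Fin 2) ℂ :=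
  !![⟨(A.1 0 0 + A.1 1 1) / 2, (A.1 0 1 - A.1 1 0) / 2⟩,
      ⟨(A.1 0 0 - A.1 1 1) / 2, -(A.1 0 1 + A.1 1 0) / 2⟩;
    ⟨(A.1 0 0 - A.1 1 1) / 2, (A.1 0 1 + A.1 1 0) / 2⟩,
      ⟨(A.1 0 0 + A.1 1 1) / 2, -(A.1 0 1 - A.1 1 0) / 2⟩]

theorem cayMat_mul (A B : SL) : cayMat (A * B) = cayMat A * cayMat B := by
  ext i j
  fin_cases i <;> fin_cases j <;> apply Complex.ext <;>
    simp [cayMat, SL.mul_apply, -Matrix.SpecialLinearGroup.coe_mul] <;> ring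

theorem cayMat_one : cayMat 1 = 1 := by
  ext i j
  fin_cases i <;> fin_cases j <;> apply Complex.ext <;>
    simp [cayMat]

theorem herm_cayMat (A : SL) (x y : Fin 2 → ℂ) :
    herm ((cayMat A).mulVec x) ((cayMat A).mulVec y) = herm x y := by
  have hd := det_eq A
  apply Complex.ext
  · simp [herm, cayMat, Matrix.mulVec, dotProduct]
    linear_combination ((x 0).re * (y 0).re + (x 0).im * (y 0).im - (x 1).re * (y 1).re -
      (x 1).im * (y 1).im) * hd
  · simp [herm, cayMat, Matrix.mulVec, dotProduct]
    linear_combination ((x 0).im * (y 0).re - (x 0).re * (y 0).im - (x 1).im * (y 1).re +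
      (x 1).re * (y 1).im) * hd

/-- The Cayley transform as a homomorphism into `U(1,1)`. -/
noncomputable def cay : SL →* U11 :=
  (MonoidHom.toHomUnits ⟨⟨cayMat, cayMat_one⟩, cayMat_mul⟩).codRestrict U11
    fun A => herm_cayMat A

theorem coe_cay (A : SL) : ((cay A : GL (Fin 2) ℂ) : Matrix (Fin 2) (Fin 2) ℂ) = cayMat A := rfl

theorem continuous_cayMat : Continuous cayMat := by
  refine continuous_matrix fun i j => ?_
  have h := continuous_entry
  have e : ∀ f g : SL → ℝ, Continuous f → Continuous g →
      Continuous fun A => (⟨f A, g A⟩ : ℂ) := fun f g hf hg => by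
    simp only [Complex.mk_eq_add_mul_I]; fun_prop
  fin_cases i <;> fin_cases j <;> refine e _ _ ?_ ?_ <;> fun_prop

theorem continuous_cay : Continuous cay := by
  refine continuous_induced_rng.2 (Units.continuous_iff.2 ⟨continuous_cayMat, ?_⟩)
  have : Continuous fun A : SL => cayMat A⁻¹ := continuous_cayMat.comp continuous_inv
  exact this

theorem cayMat_injective : Function.Injective cayMat := by
  intro A B h
  have h0 := congrFun (congrFun h 0) 0
  have h1 := congrFun (congrFun h 0) 1
  simp [cayMat] at h0 h1
  apply ext_entries <;> linarith

/-- The homomorphism from `SL(2,ℝ)` onto `PU(1,1)`. -/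
noncomputable def toPU : SL →* PU := (QuotientGroup.mk' _).comp cay

theorem toPU_apply (A : SL) : toPU A = QuotientGroup.mk (cay A) := rfl

theorem continuous_toPU : Continuous toPU := continuous_quotient_mk'.comp continuous_cay

theorem toPU_neg (A : SL) : toPU (-A) = toPU A := by
  rw [toPU_apply, toPU_apply, QuotientGroup.eq, Subgroup.mem_center_iff]
  intro g
  have : ∀ X : SL, cayMat (-X) = -cayMat X := by
    intro X
    ext i j
    fin_cases i <;> fin_cases j <;> apply Complex.ext <;>
      simp [cayMat, SL.neg_apply, -Matrix.SpecialLinearGroup.coe_neg] <;> ring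
  rw [← map_inv, ← map_mul]
  refine Subtype.ext (Units.ext ?_)
  have e : (-A)⁻¹ * A = -1 := by
    rw [inv_mul_eq_iff_eq_mul]; simp
  rw [e]
  simp only [Subgroup.coe_mul, Units.val_mul, coe_cay, this, cayMat_one]
  simp

theorem eq_or_eq_neg_of_toPU_eq {A B : SL} (h : toPU A = toPU B) : A = B ∨ A = -B := by
  rw [toPU_apply, toPU_apply, QuotientGroup.eq, Subgroup.mem_center_iff, ← map_inv, ← map_mul] at h
  set C := A⁻¹ * B with hC
  have comm : ∀ X, X * C = C * X := by
    intro X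
    apply cayMat_injective
    have := congrArg (fun u : U11 => ((u : GL (Fin 2) ℂ) : Matrix (Fin 2) (Fin 2) ℂ)) (h (cay X))
    simpa only [Subgroup.coe_mul, Units.val_mul, coe_cay, ← cayMat_mul] using this
  have hB : B = A * C := by rw [hC]; group
  have c1 := comm (SL.of 1 1 0 1 (by norm_num))
  have c2 := comm (SL.of 1 0 1 1 (by norm_num))
  have e1 := congrArg (fun X : SL => X.1 0 0) c1
  have e2 := congrArg (fun X : SL => X.1 0 1) c1
  have e3 := congrArg (fun X : SL => X.1 0 0) c2
  simp only [SL.mul_apply, of_zero_zero, of_zero_one, of_one_zero, of_one_one] at e1 e2 e3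
  have hd := det_eq C
  have h10 : C.1 1 0 = 0 := by linarith
  have h01 : C.1 0 1 = 0 := by linarith
  have h11 : C.1 1 1 = C.1 0 0 := by linarith
  rw [h10, h01, h11] at hd
  have : (C.1 0 0 - 1) * (C.1 0 0 + 1) = 0 := by linarith
  rcases mul_eq_zero.1 this with h0 | h0
  · left
    have : C = 1 := by
      apply ext_entries <;> simp only [one_zero_zero, one_zero_one, one_one_zero, one_one_one] <;>
        linarith
    rw [hB, this, mul_one]
  · right
    have : C = -1 := by
      apply ext_entries <;> simp only [SL.neg_apply, one_zero_zero, one_zero_one, one_one_zero,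
        one_one_one] <;> linarith
    rw [hB, this, mul_neg_one, neg_neg]

theorem exists_cayMat_eq {p q : ℂ} (h : p * conj p - q * conj q = 1) :
    ∃ B : SL, cayMat B = !![p, q; conj q, conj p] ∧ tr B = 2 * p.re ∧ B.1 1 0 = -p.im - q.im := by
  have h' := congrArg Complex.re h
  simp at h'
  refine ⟨SL.of (p.re + q.re) (p.im - q.im) (-p.im - q.im) (p.re - q.re) (by linarith), ?_, ?_, rfl⟩
  · ext i j
    fin_cases i <;> fin_cases j <;> apply Complex.ext <;>
      simp [cayMat, of_zero_zero, of_zero_one, of_one_zero, of_one_one]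
    ring
  · rw [tr, of_zero_zero, of_one_one]; ring

/-- The matrix of an element of `U(1,1)`. -/
abbrev umat (A : U11) : Matrix (Fin 2) (Fin 2) ℂ :=
  ((A : GL (Fin 2) ℂ) : Matrix (Fin 2) (Fin 2) ℂ)

theorem mulVec_pair (M : Matrix (Fin 2) (Fin 2) ℂ) (x y : ℂ) (i : Fin 2) :
    M.mulVec ![x, y] i = M i 0 * x + M i 1 * y := by
  simp [Matrix.mulVec, dotProduct]

theorem umat_col_zero (A : U11) :
    umat A 0 0 * conj (umat A 0 0) - umat A 1 0 * conj (umat A 1 0) = 1 := by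
  have := A.2 ![1, 0] ![1, 0]
  simpa [herm, mulVec_pair] using this

theorem umat_col_one (A : U11) :
    umat A 0 1 * conj (umat A 0 1) - umat A 1 1 * conj (umat A 1 1) = -1 := by
  have := A.2 ![0, 1] ![0, 1]
  simpa [herm, mulVec_pair] using this

theorem umat_col_zero_one (A : U11) :
    umat A 0 0 * conj (umat A 0 1) = umat A 1 0 * conj (umat A 1 1) := by
  have := A.2 ![1, 0] ![0, 1]
  simpa [herm, mulVec_pair, sub_eq_zero] using this

/-- Every element of `U(1,1)` is a unitary scalar times a Cayley transform. -/
theorem exists_umat_eq_smul (A : U11) :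
    ∃ (μ : ℂ) (B : SL), μ * conj μ = 1 ∧ umat A = μ • cayMat B := by
  have h0 := umat_col_zero A
  have h1 := umat_col_one A
  have h2 := umat_col_zero_one A
  have h2' := congrArg conj h2
  simp only [map_mul, Complex.conj_conj] at h2'
  obtain ⟨D, hD⟩ : ∃ D, D = umat A 0 0 * umat A 1 1 - umat A 0 1 * umat A 1 0 := ⟨_, rfl⟩
  have e1 : umat A 1 1 = D * conj (umat A 0 0) := by
    rw [hD]; linear_combination (-umat A 1 1) * h0 + umat A 1 0 * h2'
  have e2 : umat A 0 1 = D * conj (umat A 1 0) := by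
    rw [hD]; linear_combination (-umat A 0 1) * h0 + umat A 0 0 * h2'
  have hDD : D * conj D = 1 := by
    rw [e1, e2] at h1
    simp only [map_mul, Complex.conj_conj] at h1
    linear_combination (-1) * h1 - D * conj D * h0
  -- Dividing by a square root μ of the determinant D leaves a matrix of the form [[p, q], [q̄,
  -- p̄]], which is a Cayley transform.
  obtain ⟨μ, hμ⟩ := IsAlgClosed.exists_pow_nat_eq D (n := 2) (by norm_num)
  have hμμ : μ * conj μ = 1 := by
    rw [Complex.mul_conj] at hDD ⊢
    rw [← hμ, map_pow] at hDD
    norm_cast at hDD ⊢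
    exact (pow_eq_one_iff_of_nonneg (Complex.normSq_nonneg _) two_ne_zero).1 hDD
  obtain ⟨B, hB, -, -⟩ := exists_cayMat_eq (p := umat A 0 0 * conj μ) (q := conj (umat A 1 0) * μ) (by
    simp only [map_mul, Complex.conj_conj]
    linear_combination h0 + (umat A 0 0 * conj (umat A 0 0) - umat A 1 0 * conj (umat A 1 0)) * hμμ)
  refine ⟨μ, B, hμμ, ?_⟩
  rw [hB]
  ext i j
  fin_cases i <;> fin_cases j
  · simp; linear_combination (-umat A 0 0) * hμμ
  · simp; linear_combination e2 - conj (umat A 1 0) * hμ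
  · simp; linear_combination (-umat A 1 0) * hμμ
  · simp; linear_combination e1 - conj (umat A 0 0) * hμ

theorem toPU_eq_of_umat_eq_smul {A : U11} {μ : ℂ} {B : SL} (h : umat A = μ • cayMat B) :
    toPU B = QuotientGroup.mk A := by
  rw [toPU_apply, QuotientGroup.eq, Subgroup.mem_center_iff]
  intro g
  have e : umat ((cay B)⁻¹ * A) = μ • 1 := by
    rw [← map_inv]
    change umat (cay B⁻¹) * umat A = _
    rw [h, mul_smul_comm]
    change μ • (cayMat B⁻¹ * cayMat B) = _
    rw [← cayMat_mul, inv_mul_cancel, cayMat_one]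
  refine Subtype.ext (Units.ext ?_)
  change umat g * umat ((cay B)⁻¹ * A) = umat ((cay B)⁻¹ * A) * umat g
  rw [e]; simp

theorem toPU_surjective : Function.Surjective toPU := by
  intro g
  induction g using QuotientGroup.induction_on with
  | H A =>
    obtain ⟨μ, B, -, h⟩ := exists_umat_eq_smul A
    exact ⟨B, toPU_eq_of_umat_eq_smul h⟩

theorem exists_umat_eq_of_mk_eq {A A' : U11} (h : (QuotientGroup.mk A : PU) = QuotientGroup.mk A') :
    ∃ μ : ℂ, μ * conj μ = 1 ∧ umat A' = μ • umat A := by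
  obtain ⟨μ, B, hμ, hB⟩ := exists_umat_eq_smul A
  obtain ⟨ν, C, hν, hC⟩ := exists_umat_eq_smul A'
  have e : toPU C = toPU B := by
    rw [toPU_eq_of_umat_eq_smul hB, toPU_eq_of_umat_eq_smul hC, h]
  have hc : ∃ ε : ℂ, ε * conj ε = 1 ∧ cayMat C = ε • cayMat B := by
    rcases eq_or_eq_neg_of_toPU_eq e with rfl | rfl
    · exact ⟨1, by simp, by simp⟩
    · refine ⟨-1, by simp, ?_⟩
      ext i j
      fin_cases i <;> fin_cases j <;> apply Complex.ext <;>
        simp [cayMat, SL.neg_apply, -Matrix.SpecialLinearGroup.coe_neg] <;> ring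
  obtain ⟨ε, hε, hc⟩ := hc
  refine ⟨ν * ε * conj μ, ?_, ?_⟩
  · simp only [map_mul, Complex.conj_conj]
    linear_combination ε * conj ε * μ * conj μ * hν + μ * conj μ * hε + hμ
  · rw [hC, hc, hB, smul_smul, smul_smul]
    congr 1
    linear_combination (-ν * ε) * hμ

/-- The function on `PU(1,1)` induced by the squared modulus of the first matrix entry. -/
noncomputable def normEntry : PU → ℝ :=
  Quotient.lift (fun A : U11 => Complex.normSq (umat A 0 0)) (by
    intro A A' h
    obtain ⟨μ, hμ, e⟩ := exists_umat_eq_of_mk_eq (Quotient.sound h)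
    rw [Complex.mul_conj] at hμ
    norm_cast at hμ
    simp [e, hμ])

/-- The function on `PU(1,1)` induced by the product of the entries of the first column, the
second one conjugated. -/
noncomputable def colEntry : PU → ℂ :=
  Quotient.lift (fun A : U11 => umat A 0 0 * conj (umat A 1 0)) (by
    intro A A' h
    obtain ⟨μ, hμ, e⟩ := exists_umat_eq_of_mk_eq (Quotient.sound h)
    simp only [e, Matrix.smul_apply, smul_eq_mul, map_mul]
    linear_combination (-umat A 0 0 * conj (umat A 1 0)) * hμ)

theorem continuous_umat (i j : Fin 2) : Continuous fun A : U11 => umat A i j :=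
  (Units.continuous_val.comp continuous_subtype_val).matrix_elem i j

theorem continuous_normEntry : Continuous normEntry :=
  Continuous.quotient_lift (Complex.continuous_normSq.comp (continuous_umat 0 0)) _

theorem continuous_colEntry : Continuous colEntry :=
  Continuous.quotient_lift
    ((continuous_umat 0 0).mul (Complex.continuous_conj.comp (continuous_umat 1 0))) _

theorem exists_exp_eq (a : ℝ) : ∃ x y : ℝ, x = Real.cos a ∧ y = Real.sin a ∧
    Complex.exp (a * Complex.I) = x + y * Complex.I ∧
    conj (Complex.exp (a * Complex.I)) = x - y * Complex.I := by
  have h : Complex.exp (a * Complex.I) = Real.cos a + Real.sin a * Complex.I := by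
    rw [Complex.exp_mul_I]; simp
  refine ⟨_, _, rfl, rfl, h, ?_⟩
  rw [h, map_add, map_mul, Complex.conj_ofReal, Complex.conj_ofReal, Complex.conj_I]
  ring

theorem InClass.exists_ell {a : ℝ} (ha : a ∈ Set.Ioo 0 Real.pi) {g : PU} (h : InClass a g) :
    ∃ A : SL, Ell a A ∧ toPU A = g := by
  obtain ⟨c, A, hc, hA, rfl⟩ := h
  obtain ⟨x, y, hx, hy, hk, hk'⟩ := exists_exp_eq a
  have hs : 0 < y := hy ▸ sin_pos ha
  obtain ⟨N, hN⟩ : ∃ N : ℝ, N = (c 0).re ^ 2 + (c 0).im ^ 2 - (c 1).re ^ 2 - (c 1).im ^ 2 :=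
    ⟨_, rfl⟩
  have hcc : herm c c = N := by
    rw [hN, herm, Complex.mul_conj, Complex.mul_conj, Complex.normSq_apply, Complex.normSq_apply]
    push_cast
    ring
  have hN0 : 0 < N := by rw [hcc] at hc; exact_mod_cast hc
  have hN' : (N : ℂ) ≠ 0 := by exact_mod_cast hN0.ne'
  have hNc : (c 0) * conj (c 0) - c 1 * conj (c 1) = N := by rw [← hcc, herm]
  have hA0 := hA ![1, 0]
  have hA1 := hA ![0, 1]
  rw [hk', hk, hcc] at hA0 hA1
  have m00 := congrFun hA0 0
  have m10 := congrFun hA0 1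
  have m01 := congrFun hA1 0
  have m11 := congrFun hA1 1
  simp only [mulVec_pair, herm, Pi.add_apply, Pi.smul_apply, smul_eq_mul, Matrix.cons_val_zero,
    Matrix.cons_val_one, mul_one, mul_zero, add_zero, zero_add, one_mul, zero_mul, zero_sub,
    sub_zero] at m00 m10 m01 m11
  change umat A 0 0 = _ at m00
  change umat A 1 0 = _ at m10
  change umat A 0 1 = _ at m01
  change umat A 1 1 = _ at m11
  have e11 : umat A 1 1 = conj (umat A 0 0) := by
    rw [m00, m11]
    simp only [map_add, map_sub, map_mul, map_div₀, Complex.conj_conj, Complex.conj_ofReal,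
      Complex.conj_I]
    field_simp
    linear_combination (-2 * y * Complex.I) * hNc
  have e10 : umat A 1 0 = conj (umat A 0 1) := by
    rw [m10, m01]
    simp only [map_add, map_sub, map_mul, map_div₀, map_neg, Complex.conj_conj,
      Complex.conj_ofReal, Complex.conj_I]
    field_simp
    ring
  have hn := umat_col_zero A
  rw [e10, Complex.conj_conj] at hn
  have n00 : umat A 0 0 = ⟨x, y - 2 * y * (((c 0).re ^ 2 + (c 0).im ^ 2) / N)⟩ := by
    rw [m00]
    apply Complex.ext <;> simp <;> ring
  have n01 : (umat A 0 1).im = 2 * y * (((c 0).re * (c 1).re + (c 0).im * (c 1).im) / N) := by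
    rw [m01]
    simp
    ring
  obtain ⟨B, hB, htr, h10⟩ := exists_cayMat_eq (p := umat A 0 0) (q := umat A 0 1)
    (by rw [mul_comm (umat A 0 1)]; exact hn)
  refine ⟨B, ⟨?_, ?_⟩, ?_⟩
  · rw [htr, n00, hx]
  · rw [h10, n00, n01]
    -- The lower left entry turns out to be sin a · |c₀ − c₁|² / ⟨c,c⟩, and c₀ = c₁ would make c
    -- isotropic.
    have hpos : 0 < ((c 0).re - (c 1).re) ^ 2 + ((c 0).im - (c 1).im) ^ 2 := by
      by_contra hneg
      have e1 : (c 0).re = (c 1).re := by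
        nlinarith [sq_nonneg ((c 0).re - (c 1).re), sq_nonneg ((c 0).im - (c 1).im)]
      have e2 : (c 0).im = (c 1).im := by
        nlinarith [sq_nonneg ((c 0).re - (c 1).re), sq_nonneg ((c 0).im - (c 1).im)]
      rw [e1, e2] at hN
      linarith
    have : -(y - 2 * y * (((c 0).re ^ 2 + (c 0).im ^ 2) / N)) -
        2 * y * (((c 0).re * (c 1).re + (c 0).im * (c 1).im) / N) =
        y * ((((c 0).re - (c 1).re) ^ 2 + ((c 0).im - (c 1).im) ^ 2) / N) := by
      field_simp
      rw [hN]; ring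
    simp only [this]
    positivity
  · refine toPU_eq_of_umat_eq_smul (μ := 1) ?_
    rw [one_smul, hB]
    ext i j
    fin_cases i <;> fin_cases j <;> simp [e11, e10]

theorem SL.Ell.inClass {a : ℝ} (ha : a ∈ Set.Ioo 0 Real.pi) {A : SL} (h : Ell a A) :
    InClass a (toPU A) := by
  obtain ⟨B, rfl⟩ := exists_conj_rot h (sin_pos ha)
  rw [map_mul, map_mul, map_inv]
  refine InClass.conj ?_ _
  obtain ⟨x, y, hx, hy, hk, hk'⟩ := exists_exp_eq a
  refine ⟨![1, 0], cay (rot a), by simp [herm], fun p => ?_, rfl⟩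
  rw [hk', hk, coe_cay]
  ext i
  fin_cases i <;> apply Complex.ext <;>
    simp [herm, cayMat, Matrix.mulVec, dotProduct, rot, of_zero_zero, of_zero_one, of_one_zero,
      of_one_one, ← hx, ← hy] <;> ring

open Classical in
/-- The elliptic lift to `SL(2,ℝ)` of an element of the class `InClass a`. -/
noncomputable def lift (a : ℝ) (g : PU) : SL :=
  if h : ∃ A : SL, Ell a A ∧ toPU A = g then h.choose else 1

theorem lift_spec {a : ℝ} (ha : a ∈ Set.Ioo 0 Real.pi) {g : PU} (h : InClass a g) :
    Ell a (lift a g) ∧ toPU (lift a g) = g := by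
  have := h.exists_ell ha
  rw [lift, dif_pos this]
  exact this.choose_spec

theorem SL.Ell.eq_of_toPU_eq {a b : ℝ} {A B : SL} (hA : Ell a A) (hB : Ell b B)
    (h : toPU A = toPU B) : A = B := by
  rcases eq_or_eq_neg_of_toPU_eq h with h | h
  · exact h
  · have h1 := hA.2
    have h2 := hB.2
    rw [h, SL.neg_apply] at h1
    linarith

/-- The lift is defined by choice, so continuity comes from a formula. In the Cayley picture its
first entry p has real part cos a and a negative imaginary part determined by |p|², and the second
entry is `colEntry g / p`. Both |p|² and `colEntry` are well defined on PU(1,1). -/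
theorem continuous_lift {a : ℝ} (ha : a ∈ Set.Ioo 0 Real.pi) :
    Continuous fun g : {g : PU // InClass a g} => lift a g := by
  have key : ∀ g : {g : PU // InClass a g}, ∃ p q : ℂ, p = ⟨Real.cos a,
      -√(normEntry g - Real.cos a ^ 2)⟩ ∧ p ≠ 0 ∧ q = colEntry g / p ∧
      (lift a g).1 0 0 = p.re + q.re ∧ (lift a g).1 0 1 = p.im - q.im ∧
      (lift a g).1 1 0 = -p.im - q.im ∧ (lift a g).1 1 1 = p.re - q.re := by
    rintro ⟨g, hg⟩
    obtain ⟨hE, hgE⟩ := lift_spec ha hg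
    simp only
    generalize lift a g = B at *
    subst hgE
    obtain ⟨m, y, z, h00, h01, h10, h11, hy, hz, hyz⟩ := hE.coords (sin_pos ha).ne'
    have hp : cayMat B 0 0 = ⟨Real.cos a, -(y + z) / 2⟩ := by
      apply Complex.ext
      · simp [cayMat, h00, h11]
      · simp [cayMat, h01, h10]; ring
    have hn : normEntry (toPU B) - Real.cos a ^ 2 = ((y + z) / 2) ^ 2 := by
      change Complex.normSq (cayMat B 0 0) - _ = _
      rw [hp, Complex.normSq_mk]; ring
    have hc : colEntry (toPU B) = cayMat B 0 0 * cayMat B 0 1 := by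
      change cayMat B 0 0 * conj (cayMat B 1 0) = _
      congr 1
      apply Complex.ext
      · simp [cayMat]
      · simp [cayMat]; ring
    have hpe : (⟨Real.cos a, -√(normEntry (toPU B) - Real.cos a ^ 2)⟩ : ℂ) = cayMat B 0 0 := by
      rw [hn, Real.sqrt_sq (by positivity), hp]
      congr 1; ring
    have hp0 : cayMat B 0 0 ≠ 0 := by
      rw [hp]
      intro h0
      have := congrArg Complex.im h0
      simp at this
      linarith
    refine ⟨_, _, rfl, by rwa [hpe], rfl, ?_, ?_, ?_, ?_⟩ <;>
      rw [hpe, hc, mul_div_cancel_left₀ _ hp0] <;> simp [cayMat] <;> ring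
  have hp : Continuous fun g : {g : PU // InClass a g} =>
      (⟨Real.cos a, -√(normEntry g - Real.cos a ^ 2)⟩ : ℂ) := by
    simp only [Complex.mk_eq_add_mul_I]
    have := continuous_normEntry
    fun_prop
  have hq : Continuous fun g : {g : PU // InClass a g} => colEntry g /
      (⟨Real.cos a, -√(normEntry g - Real.cos a ^ 2)⟩ : ℂ) := by
    refine (continuous_colEntry.comp continuous_subtype_val).div hp fun g => ?_
    obtain ⟨p, q, h, h0, -⟩ := key g
    rwa [← h]
  have hre := Complex.continuous_re
  have him := Complex.continuous_im
  apply continuous_of_entries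
  · refine ((hre.comp hp).add (hre.comp hq)).congr fun g => ?_
    obtain ⟨p, q, h, h0, h1, h2, -⟩ := key g
    rw [h2, h1, h]; rfl
  · refine ((him.comp hp).sub (him.comp hq)).congr fun g => ?_
    obtain ⟨p, q, h, h0, h1, -, h2, -⟩ := key g
    rw [h2, h1, h]; rfl
  · refine ((him.comp hp).neg.sub (him.comp hq)).congr fun g => ?_
    obtain ⟨p, q, h, h0, h1, -, -, h2, -⟩ := key g
    rw [h2, h1, h]; rfl
  · refine ((hre.comp hp).sub (hre.comp hq)).congr fun g => ?_
    obtain ⟨p, q, h, h0, h1, -, -, -, h2⟩ := key g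
    rw [h2, h1, h]; rfl

end HexagonSpace

/-! ### The sign and the pair traces as continuous invariants on S. -/

namespace HexagonSpace
open SL

variable {a : Fin 4 → ℝ}

/-- A relation between elliptic elements of `SL(2,ℝ)`, up to sign. -/
def IsTuple (b : Fin 4 → ℝ) (A : Fin 4 → SL) : Prop :=
  (∀ j, Ell (b j) (A j)) ∧ (A 3 * A 2 * A 1 * A 0 = 1 ∨ A 3 * A 2 * A 1 * A 0 = -1)

/-- The elliptic lifts of the isometries of a relation. -/
noncomputable def lifts (P : Relations a) (j : Fin 4) : SL := lift (a (P.1.1 j)) (P.2.1 j)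

section
variable (ha : ∀ j, a j ∈ Set.Ioo 0 Real.pi)
include ha

theorem ell_lifts (P : Relations a) (j : Fin 4) : Ell (a (P.1.1 j)) (lifts P j) :=
  (lift_spec (ha _) (P.2.2.1 j)).1

theorem toPU_lifts (P : Relations a) (j : Fin 4) : toPU (lifts P j) = P.2.1 j :=
  (lift_spec (ha _) (P.2.2.1 j)).2

theorem isTuple_lifts (P : Relations a) : IsTuple (fun j => a (P.1.1 j)) (lifts P) := by
  refine ⟨ell_lifts ha P, ?_⟩
  apply eq_or_eq_neg_of_toPU_eq
  simp only [map_mul, toPU_lifts ha, map_one]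
  exact P.2.2.2

theorem lifts_eq {P : Relations a} {j : Fin 4} {A : SL} (h : Ell (a (P.1.1 j)) A)
    (h' : toPU A = P.2.1 j) : lifts P j = A :=
  (ell_lifts ha P j).eq_of_toPU_eq h (by rw [toPU_lifts ha, h'])

/-- The relation given by elliptic elements of `SL(2,ℝ)`. -/
noncomputable def ofTuple (β : Labeling) (A : Fin 4 → SL) (h : IsTuple (fun j => a (β.1 j)) A) :
    Relations a :=
  ⟨β, fun j => toPU (A j), fun j => (h.1 j).inClass (ha _), by
    rw [← map_mul, ← map_mul, ← map_mul]
    rcases h.2 with h | h <;> rw [h]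
    · rw [map_one]
    · rw [toPU_neg, map_one]⟩

theorem lifts_ofTuple (β : Labeling) (A : Fin 4 → SL) (h : IsTuple (fun j => a (β.1 j)) A)
    (j : Fin 4) : lifts (ofTuple ha β A h) j = A j :=
  lifts_eq ha (h.1 j) rfl

theorem ofTuple_lifts (P : Relations a) : ofTuple ha P.1 (lifts P) (isTuple_lifts ha P) = P :=
  Relations.ext' rfl fun j => toPU_lifts ha P j

theorem continuous_ofTuple {X : Type*} [TopologicalSpace X] (β : Labeling) {F : X → Fin 4 → SL}
    (hF : Continuous F) (h : ∀ x, IsTuple (fun j => a (β.1 j)) (F x)) :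
    Continuous fun x => ofTuple ha β (F x) (h x) := by
  refine continuous_sigmaMk.comp (Continuous.subtype_mk (continuous_pi fun j => ?_) _)
  exact continuous_toPU.comp ((continuous_apply j).comp hF)

theorem continuous_lifts (e : Labeling → Fin 4) :
    Continuous fun P : Relations a => lifts P (e P.1) := by
  refine continuous_sigma fun β => ?_
  have h : Continuous fun ρ : {ρ : Fin 4 → PU // (∀ j, InClass (a (β.1 j)) (ρ j)) ∧
      ρ 3 * ρ 2 * ρ 1 * ρ 0 = 1} =>
      (⟨ρ.1 (e β), ρ.2.1 (e β)⟩ : {g : PU // InClass (a (β.1 (e β))) g}) :=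
    Continuous.subtype_mk ((continuous_apply _).comp continuous_subtype_val) _
  exact (continuous_lift (ha _)).comp h

theorem ConjRel.exists_lifts {P Q : Relations a} (h : ConjRel P Q) :
    ∃ B : SL, ∀ j, lifts Q j = B * lifts P j * B⁻¹ := by
  obtain ⟨h1, g, hg⟩ := h
  obtain ⟨B, rfl⟩ := toPU_surjective g
  refine ⟨B, fun j => lifts_eq ha ?_ ?_⟩
  · rw [h1]
    exact (ell_lifts ha P j).conj (sin_pos (ha _)).ne' B
  · rw [map_mul, map_mul, map_inv, toPU_lifts ha, hg]

theorem conjRel_of_lifts {P Q : Relations a} (h1 : Q.1 = P.1) {B : SL}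
    (h : ∀ j, lifts Q j = B * lifts P j * B⁻¹) : ConjRel P Q := by
  refine ⟨h1, toPU B, fun j => ?_⟩
  rw [← toPU_lifts ha, ← toPU_lifts ha, h, map_mul, map_mul, map_inv]

theorem lifts_shift (P : Relations a) (j : Fin 4) : lifts (shift P) j =
    (![lifts P 1 * lifts P 0 * (lifts P 1)⁻¹, lifts P 2, lifts P 3, lifts P 1] : Fin 4 → SL) j := by
  have hl := shift_label P
  have h0 : (shift P).1.1 0 = P.1.1 0 := by rw [P.1.2, (shift P).1.2]
  fin_cases j
  · refine lifts_eq ha ?_ ?_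
    · simp only [Fin.zero_eta, Matrix.cons_val, h0]
      exact (ell_lifts ha P 0).conj (sin_pos (ha _)).ne' _
    · simp [toPU_lifts ha, shift]
  · refine lifts_eq ha ?_ ?_
    · simp only [Fin.mk_one, Matrix.cons_val, hl.1]
      exact ell_lifts ha P 2
    · simp [toPU_lifts ha, shift]
  · refine lifts_eq ha ?_ ?_
    · simp only [Fin.reduceFinMk, Matrix.cons_val, hl.2.1]
      exact ell_lifts ha P 3
    · simp [toPU_lifts ha, shift]
  · refine lifts_eq ha ?_ ?_
    · simp only [Fin.reduceFinMk, Matrix.cons_val, hl.2.2]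
      exact ell_lifts ha P 1
    · simp [toPU_lifts ha, shift]

omit ha in
/-- The lift of the isometry with the label `l`. -/
noncomputable def liftAt (P : Relations a) (l : Fin 4) : SL := lifts P (P.1.1.symm l)

omit ha in
theorem liftAt_label (P : Relations a) (j : Fin 4) : liftAt P (P.1.1 j) = lifts P j := by
  rw [liftAt, Equiv.symm_apply_apply]

theorem liftAt_shift (P : Relations a) {l : Fin 4} (hl : l ≠ 0) :
    liftAt (shift P) l = liftAt P l := by
  obtain ⟨h1, h2, h3⟩ := shift_label P
  rcases HexagonSpace.exists_label hl P with h | h | h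
  · rw [← h, liftAt_label, ← h3, liftAt_label, lifts_shift ha]; rfl
  · rw [← h, liftAt_label, ← h1, liftAt_label, lifts_shift ha]; rfl
  · rw [← h, liftAt_label, ← h2, liftAt_label, lifts_shift ha]; rfl

/-- The trace of the product of the isometries with the labels `i + 1` and `l + 1`. -/
noncomputable def pairTr (i l : Fin 3) : S a → ℝ :=
  Quot.lift (fun P => tr (liftAt P i.succ * liftAt P l.succ)) (by
    rintro P Q (h | rfl)
    · obtain ⟨B, hB⟩ := h.exists_lifts ha
      simp only [liftAt, h.1, hB]
      rw [← tr_conj B]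
      congr 1; group
    · simp only [liftAt_shift ha P (Fin.succ_ne_zero _)])

theorem pairTr_mk (P : Relations a) {i l : Fin 3} {j k : Fin 4} (hj : P.1.1 j = i.succ)
    (hk : P.1.1 k = l.succ) : pairTr ha i l (S.mk P) = tr (lifts P j * lifts P k) := by
  rw [← liftAt_label, ← liftAt_label, hj, hk]; rfl

theorem continuous_pairTr (i l : Fin 3) : Continuous (pairTr ha i l) := by
  refine continuous_quot_lift _ (continuous_tr.comp ?_)
  exact (continuous_lifts ha fun β => β.1.symm i.succ).mul
    (continuous_lifts ha fun β => β.1.symm l.succ)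

/-- The sign of the lift of a relation to `SL(2,ℝ)`. -/
noncomputable def relSign : S a → ℝ :=
  Quot.lift (fun P => tr (lifts P 3 * lifts P 2 * lifts P 1 * lifts P 0) / 2) (by
    rintro P Q (h | rfl)
    · obtain ⟨B, hB⟩ := h.exists_lifts ha
      simp only [hB]
      rw [← tr_conj B]
      congr 2; group
    · simp only [lifts_shift ha, Matrix.cons_val]
      rw [← tr_conj (lifts P 1)]
      congr 2; group)

theorem continuous_relSign : Continuous (relSign ha) := by
  refine continuous_quot_lift _ ((continuous_tr.comp ?_).div_const 2)
  exact (((continuous_lifts ha fun _ => 3).mul (continuous_lifts ha fun _ => 2)).mul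
    (continuous_lifts ha fun _ => 1)).mul (continuous_lifts ha fun _ => 0)

theorem relSign_mk_eq_one_iff (P : Relations a) : relSign ha (S.mk P) = 1 ↔
    lifts P 3 * lifts P 2 * lifts P 1 * lifts P 0 = 1 := by
  change tr (lifts P 3 * lifts P 2 * lifts P 1 * lifts P 0) / 2 = 1 ↔ _
  rcases (isTuple_lifts ha P).2 with h | h <;> rw [h]
  · simp [tr_one]
  · rw [tr_neg, tr_one]
    refine ⟨fun h => by norm_num at h, fun h => ?_⟩
    have := congrArg (fun X : SL => X.1 0 0) h
    simp only [SL.neg_apply, one_zero_zero] at this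
    norm_num at this

theorem relSign_mk_eq_neg_one_iff (P : Relations a) : relSign ha (S.mk P) = -1 ↔
    lifts P 3 * lifts P 2 * lifts P 1 * lifts P 0 = -1 := by
  change tr (lifts P 3 * lifts P 2 * lifts P 1 * lifts P 0) / 2 = -1 ↔ _
  rcases (isTuple_lifts ha P).2 with h | h <;> rw [h]
  · rw [tr_one]
    refine ⟨fun h => by norm_num at h, fun h => ?_⟩
    have := congrArg (fun X : SL => X.1 0 0) h
    simp only [SL.neg_apply, one_zero_zero] at this
    norm_num at this
  · simp [tr_neg, tr_one]

theorem relSign_eq (y : S a) : relSign ha y = 1 ∨ relSign ha y = -1 := by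
  obtain ⟨P, rfl⟩ := Quot.exists_rep y
  exact (isTuple_lifts ha P).2.imp (relSign_mk_eq_one_iff ha P).2
    (relSign_mk_eq_neg_one_iff ha P).2

theorem relSign_eq_of_mem {x y : S a} (h : y ∈ connectedComponent x) :
    relSign ha y = relSign ha x := by
  have hp := (isPreconnected_connectedComponent (x := x)).image (relSign ha)
    (continuous_relSign ha).continuousOn
  have hx := Set.mem_image_of_mem (relSign ha) (mem_connectedComponent (x := x))
  have hy := Set.mem_image_of_mem (relSign ha) h
  by_contra hne
  have h0 : (0 : ℝ) ∈ relSign ha '' connectedComponent x := by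
    rcases relSign_eq ha x with e | e <;> rcases relSign_eq ha y with e' | e' <;>
      rw [e] at hx <;> rw [e'] at hy
    · exact absurd (e'.trans e.symm) hne
    · exact hp.ordConnected.out hy hx ⟨by norm_num, by norm_num⟩
    · exact hp.ordConnected.out hx hy ⟨by norm_num, by norm_num⟩
    · exact absurd (e'.trans e.symm) hne
  obtain ⟨z, -, hz⟩ := h0
  rcases relSign_eq ha z with e | e <;> rw [hz] at e <;> norm_num at e

omit ha in
theorem hexType_eq_of_mem {x y : S a} (h : y ∈ connectedComponent x) :
    hexType y = hexType x := by
  have hc : Continuous fun z : S a => ((hexType z : ℤˣ) : ℤ) := by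
    refine isQuotientMap_quot_mk.continuous_iff.2 ?_
    refine continuous_sigma fun β => ?_
    exact continuous_of_const fun _ _ => rfl
  exact Units.ext ((isPreconnected_connectedComponent (x := x)).constant hc.continuousOn h
    mem_connectedComponent)

omit ha in
theorem exists_rep_three (l : Fin 3) (y : S a) : ∃ P : Relations a, P.1.1 3 = l.succ ∧ S.mk P = y := by
  obtain ⟨P, h, rfl⟩ := S.exists_label l y
  exact ⟨shift (shift P), by rw [(shift_label _).2.2, (shift_label _).1, h],
    by rw [S.mk_shift, S.mk_shift]⟩

omit ha in
-- The cyclic order and the label at one position determine the labeling. This allows comparing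
-- points of S through representatives with equal labels.
theorem Labeling.eq_of_sign_eq {β γ : Labeling} (h : β.1 3 = γ.1 3)
    (hs : Equiv.Perm.sign β.1 = Equiv.Perm.sign γ.1) : β = γ := by
  have key : ∀ σ : Equiv.Perm (Fin 4), σ 0 = 0 → σ 3 = 3 → Equiv.Perm.sign σ = 1 → σ = 1 := by
    decide
  have := key (β.1⁻¹ * γ.1) (by rw [Equiv.Perm.mul_apply, γ.2, Equiv.Perm.inv_eq_iff_eq, β.2])
    (by rw [Equiv.Perm.mul_apply, ← h, Equiv.Perm.inv_eq_iff_eq])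
    (by rw [map_mul, map_inv, hs, inv_mul_cancel])
  exact Subtype.ext (inv_mul_eq_one.1 this)

omit ha in
theorem exists_label_eq_succ (β : Labeling) {j : Fin 4} (hj : j ≠ 0) : ∃ l : Fin 3, β.1 j = l.succ := by
  have : β.1 j ≠ 0 := fun h => hj (β.1.injective (h.trans β.2.symm))
  obtain ⟨l, hl⟩ := Fin.exists_succ_eq.2 this
  exact ⟨l, hl.symm⟩

omit ha in
theorem exists_rep (β : Labeling) (y : S a) (h : Equiv.Perm.sign β.1 = hexType y) :
    ∃ P : Relations a, P.1 = β ∧ S.mk P = y := by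
  obtain ⟨l, hl⟩ := exists_label_eq_succ β (show (3 : Fin 4) ≠ 0 by decide)
  obtain ⟨P, hP, rfl⟩ := exists_rep_three l y
  exact ⟨P, Labeling.eq_of_sign_eq (hP.trans hl.symm) h.symm, rfl⟩

/-- Relations with the same labels and the same invariants are conjugate. -/
theorem exists_conj_of_invariants {P Q : Relations a} (h1 : Q.1 = P.1)
    (hs : lifts P 3 * lifts P 2 * lifts P 1 * lifts P 0 =
      lifts Q 3 * lifts Q 2 * lifts Q 1 * lifts Q 0)
    (h12 : tr (lifts P 1 * lifts P 2) = tr (lifts Q 1 * lifts Q 2))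
    (h13 : tr (lifts P 1 * lifts P 3) = tr (lifts Q 1 * lifts Q 3))
    (h23 : tr (lifts P 2 * lifts P 3) = tr (lifts Q 2 * lifts Q 3)) :
    ∃ B : SL, ∀ j, lifts Q j = B * lifts P j * B⁻¹ := by
  have hP := ell_lifts ha P
  have hQ := ell_lifts ha Q
  rw [h1] at hQ
  have t : ∀ j, tr (lifts P j) = tr (lifts Q j) := fun j => by rw [(hP j).1, (hQ j).1]
  have h0 : ∀ R : Relations a, tr (lifts R 3 * lifts R 2 * lifts R 1) =
      tr (lifts R 3 * lifts R 2 * lifts R 1 * lifts R 0) / 2 * tr (lifts R 0) := by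
    intro R
    rcases (isTuple_lifts ha R).2 with h | h
    · rw [h, tr_one, eq_inv_of_mul_eq_one_left h, tr_inv]; ring
    · rw [h, tr_neg, tr_one, eq_mul_inv_of_mul_eq h, neg_one_mul, tr_neg, tr_inv]; ring
  obtain ⟨B, b1, b2, b3⟩ := exists_conj_triple (sin_pos (ha (P.1.1 1))) (hP 1) (hQ 1) (t 2) (t 3)
    h12 h13 h23 (by rw [h0, h0, hs, t])
  have e0 : ∀ R : Relations a, lifts R 0 = (lifts R 3 * lifts R 2 * lifts R 1)⁻¹ *
      (lifts R 3 * lifts R 2 * lifts R 1 * lifts R 0) := fun R => by group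
  have hcomm : lifts P 3 * lifts P 2 * lifts P 1 * lifts P 0 =
      B * (lifts P 3 * lifts P 2 * lifts P 1 * lifts P 0) * B⁻¹ := by
    rcases (isTuple_lifts ha P).2 with h | h <;> rw [h] <;> simp
  refine ⟨B, fun j => ?_⟩
  fin_cases j
  · rw [Fin.zero_eta, e0 Q, ← hs, hcomm, ← b1, ← b2, ← b3]; group
  · exact b1.symm
  · exact b2.symm
  · exact b3.symm

/-- The invariants live on S, so equality in the quotient yields a conjugation without any analysis
of chains of shifts. -/
theorem exists_conj_of_mk_eq {P Q : Relations a} (h1 : Q.1 = P.1) (h : S.mk P = S.mk Q) :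
    ∃ B : SL, ∀ j, lifts Q j = B * lifts P j * B⁻¹ := by
  obtain ⟨l₁, e1⟩ := exists_label_eq_succ P.1 (show (1 : Fin 4) ≠ 0 by decide)
  obtain ⟨l₂, e2⟩ := exists_label_eq_succ P.1 (show (2 : Fin 4) ≠ 0 by decide)
  obtain ⟨l₃, e3⟩ := exists_label_eq_succ P.1 (show (3 : Fin 4) ≠ 0 by decide)
  have hQ : ∀ j, Q.1.1 j = P.1.1 j := fun j => by rw [h1]
  refine exists_conj_of_invariants ha h1 ?_ ?_ ?_ ?_
  · rcases (isTuple_lifts ha P).2 with hP | hP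
    · rw [hP, eq_comm, ← relSign_mk_eq_one_iff ha, ← h, relSign_mk_eq_one_iff ha, hP]
    · rw [hP, eq_comm, ← relSign_mk_eq_neg_one_iff ha, ← h, relSign_mk_eq_neg_one_iff ha, hP]
  · rw [← pairTr_mk ha P e1 e2, h, pairTr_mk ha Q ((hQ _).trans e1) ((hQ _).trans e2)]
  · rw [← pairTr_mk ha P e1 e3, h, pairTr_mk ha Q ((hQ _).trans e1) ((hQ _).trans e3)]
  · rw [← pairTr_mk ha P e2 e3, h, pairTr_mk ha Q ((hQ _).trans e2) ((hQ _).trans e3)]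

end
end HexagonSpace

/-! ### Connectedness of the relations of sign 1. -/

namespace HexagonSpace
open SL

variable {a : Fin 4 → ℝ}

/-- The expression is affine in α, with the positive values cos x + cos y at α = −1 and sin(x + y)
sin x at α = cos(x + y). -/
theorem SL.cos_sub_mul_cos_pos {x y α : ℝ} (hx : x ∈ Set.Ioo 0 Real.pi)
    (hy : y ∈ Set.Ioo 0 Real.pi) (h : x + y < Real.pi) (h1 : -1 ≤ α) (h2 : α ≤ Real.cos (x + y)) :
    0 < Real.cos y - α * Real.cos x := by
  have e1 : 0 < Real.cos x + Real.cos y := by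
    have := Real.cos_lt_cos_of_nonneg_of_le_pi hx.1.le (show Real.pi - y ≤ Real.pi by linarith [hy.1])
      (show x < Real.pi - y by linarith)
    rw [Real.cos_pi_sub] at this
    linarith
  have e2 : Real.cos y - Real.cos (x + y) * Real.cos x = Real.sin (x + y) * Real.sin x := by
    have := Real.cos_sub (x + y) x
    rw [add_sub_cancel_left] at this
    linarith
  have e3 : 0 < Real.sin (x + y) * Real.sin x :=
    mul_pos (SL.sin_pos ⟨by linarith [hx.1, hy.1], h⟩) (SL.sin_pos hx)
  rcases le_total 0 (Real.cos x) with hc | hc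
  · nlinarith
  · nlinarith

theorem SL.cos_sub_mul_cos_neg {x y α : ℝ} (hx : x ∈ Set.Ioo 0 Real.pi)
    (hy : y ∈ Set.Ioo 0 Real.pi) (h : Real.pi < x + y) (h1 : -1 ≤ α)
    (h2 : α ≤ Real.cos (x + y)) : Real.cos y - α * Real.cos x < 0 := by
  have := SL.cos_sub_mul_cos_pos (x := Real.pi - x) (y := Real.pi - y) (α := α)
    ⟨by linarith [hx.2], by linarith [hx.1]⟩ ⟨by linarith [hy.2], by linarith [hy.1]⟩
    (by linarith) h1 (by
      rwa [show Real.pi - x + (Real.pi - y) = 2 * Real.pi - (x + y) by ring,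
        Real.cos_two_pi_sub])
  rw [Real.cos_pi_sub, Real.cos_pi_sub] at this
  linarith

theorem mem_connectedComponent_of_continuous {X Y : Type*} [TopologicalSpace X]
    [TopologicalSpace Y] [PreconnectedSpace X] {f : X → Y} (hf : Continuous f) (x y : X) :
    f y ∈ connectedComponent (f x) :=
  (isPreconnected_range hf).subset_connectedComponent (Set.mem_range_self x)
    (Set.mem_range_self y)

theorem S.continuous_mk : Continuous (S.mk : Relations a → S a) := continuous_quot_mk

section
variable (ha : ∀ j, a j ∈ Set.Ioo 0 Real.pi)
include ha

theorem mk_ofTuple_conj {β : Labeling} {A A' : Fin 4 → SL} {h : IsTuple (fun j => a (β.1 j)) A}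
    {h' : IsTuple (fun j => a (β.1 j)) A'} {B : SL} (hB : ∀ j, A' j = B * A j * B⁻¹) :
    S.mk (ofTuple ha β A h) = S.mk (ofTuple ha β A' h') :=
  S.mk_conj (conjRel_of_lifts ha rfl (B := B) fun j => by
    rw [lifts_ofTuple, lifts_ofTuple, hB])

/-- The relations with a given elliptic, parabolic or hyperbolic partial product, whose trace is
prescribed, form a connected set. -/
theorem fiber_connected (β : Labeling) {A A' : Fin 4 → SL} (h : IsTuple (fun j => a (β.1 j)) A)
    (h' : IsTuple (fun j => a (β.1 j)) A') (h1 : A 3 * A 2 * A 1 * A 0 = 1)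
    (h1' : A' 3 * A' 2 * A' 1 * A' 0 = 1) (ht : tr (A 2 * A 1) = tr (A' 2 * A' 1))
    (hg : A 2 * A 1 ≠ 1) (hg' : A 2 * A 1 ≠ -1) :
    S.mk (ofTuple ha β A' h') ∈ connectedComponent (S.mk (ofTuple ha β A h)) := by
  have hs := fun j => SL.sin_pos (ha (β.1 j))
  -- After this conjugation both relations share A₁ and A₂, hence g = A₂A₁. Then A₃ moves to its
  -- target by a path in the centralizer of g, and A₀ follows from the relation.
  obtain ⟨B, b1, b2⟩ := exists_conj_pair (hs 1) (h'.1 1) (h.1 1) (A₂ := A' 2) (B₂ := A 2)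
    (by rw [(h'.1 2).1, (h.1 2).1]) (by rw [tr_mul_comm, ← ht, tr_mul_comm])
  have hrel : B * A' 3 * B⁻¹ * (A 2 * A 1) * (B * A' 0 * B⁻¹) = 1 := by
    rw [← b1, ← b2]
    calc _ = B * (A' 3 * A' 2 * A' 1 * A' 0) * B⁻¹ := by group
      _ = 1 := by rw [h1']; group
  have tr_eq : ∀ X g Y : SL, X * g * Y = 1 → tr (g * X) = tr Y := by
    intro X g Y hX
    rw [tr_mul_comm, eq_inv_of_mul_eq_one_left hX, tr_inv]
  obtain ⟨γ, hγ, hcomm, hγ0, hγ1⟩ := exists_path_conj (hs 3) (h.1 3)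
    ((h'.1 3).conj (hs 3).ne' B) (g := A 2 * A 1)
    (by rw [tr_eq _ _ _ hrel, tr_conj, tr_eq (A 3) _ (A 0) (by rw [← h1]; group), (h.1 0).1,
      (h'.1 0).1]) hg hg'
  have hγt : ∀ t, IsTuple (fun j => a (β.1 j))
      ![γ t * A 0 * (γ t)⁻¹, A 1, A 2, γ t * A 3 * (γ t)⁻¹] := by
    intro t
    refine ⟨fun j => ?_, Or.inl ?_⟩
    · fin_cases j
      · exact (h.1 0).conj (hs 0).ne' _
      · exact h.1 1
      · exact h.1 2
      · exact (h.1 3).conj (hs 3).ne' _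
    · simp only [Matrix.cons_val]
      calc _ = γ t * A 3 * ((γ t)⁻¹ * (A 2 * A 1 * γ t)) * A 0 * (γ t)⁻¹ := by group
        _ = γ t * (A 3 * A 2 * A 1 * A 0) * (γ t)⁻¹ := by rw [← hcomm]; group
        _ = 1 := by rw [h1]; group
  have hcont : Continuous fun t => ![γ t * A 0 * (γ t)⁻¹, A 1, A 2, γ t * A 3 * (γ t)⁻¹] := by
    refine continuous_pi fun j => ?_
    fin_cases j
    · exact (hγ.mul continuous_const).mul hγ.inv
    · exact continuous_const
    · exact continuous_const
    · exact (hγ.mul continuous_const).mul hγ.inv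
  have key := mem_connectedComponent_of_continuous
    (S.continuous_mk.comp (continuous_ofTuple ha β hcont hγt)) 0 1
  simp only [Function.comp_apply] at key
  have e0 : S.mk (ofTuple ha β _ (hγt 0)) = S.mk (ofTuple ha β A h) := by
    refine mk_ofTuple_conj ha (B := 1) fun j => ?_
    fin_cases j <;> simp [hγ0]
  have e1 : S.mk (ofTuple ha β A' h') = S.mk (ofTuple ha β _ (hγt 1)) := by
    refine mk_ofTuple_conj ha (B := B) fun j => ?_
    fin_cases j
    · simp only [Fin.zero_eta, Matrix.cons_val]
      rw [← hγ1] at hrel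
      have e : γ 1 * A 3 * (γ 1)⁻¹ * (A 2 * A 1) * (γ 1 * A 0 * (γ 1)⁻¹) = 1 := by
        calc _ = γ 1 * A 3 * ((γ 1)⁻¹ * (A 2 * A 1 * γ 1)) * A 0 * (γ 1)⁻¹ := by group
          _ = γ 1 * (A 3 * A 2 * A 1 * A 0) * (γ 1)⁻¹ := by rw [← hcomm]; group
          _ = 1 := by rw [h1]; group
      rw [eq_inv_of_mul_eq_one_right e, eq_inv_of_mul_eq_one_right hrel]
    · exact b1.symm
    · exact b2.symm
    · exact hγ1
  rw [e1, ← e0]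
  exact key

theorem mem_connectedComponent_of_section (β : Labeling) {I : Set ℝ} (hI : IsPreconnected I)
    {F : I → Fin 4 → SL} (hF : Continuous F)
    (hF' : ∀ α : I, (∀ j, Ell (a (β.1 j)) (F α j)) ∧ F α 3 * F α 2 * F α 1 * F α 0 = 1 ∧
      tr (F α 2 * F α 1) = 2 * α) (hFt : ∀ α : I, IsTuple (fun j => a (β.1 j)) (F α)) (α₀ : I)
    {A : Fin 4 → SL} (h : IsTuple (fun j => a (β.1 j)) A) (h1 : A 3 * A 2 * A 1 * A 0 = 1)
    (hα : tr (A 2 * A 1) / 2 ∈ I) (hg : A 2 * A 1 ≠ 1) (hg' : A 2 * A 1 ≠ -1) :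
    S.mk (ofTuple ha β A h) ∈ connectedComponent (S.mk (ofTuple ha β (F α₀) (hFt α₀))) := by
  have := isPreconnected_iff_preconnectedSpace.1 hI
  have k1 := mem_connectedComponent_of_continuous
    (S.continuous_mk.comp (continuous_ofTuple ha β hF hFt)) α₀ ⟨_, hα⟩
  have k2 := fiber_connected ha β h (hFt ⟨_, hα⟩) h1 (hF' _).2.1 (by rw [(hF' _).2.2]; ring) hg hg'
  simp only [Function.comp_apply] at k1
  rw [connectedComponent_eq k1, ← connectedComponent_eq k2]
  exact mem_connectedComponent

omit ha in
theorem tr_eq_tr_of_relation {A : Fin 4 → SL} (h : A 3 * A 2 * A 1 * A 0 = 1) :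
    tr (A 2 * A 1) = tr (A 0 * A 3) := by
  have : A 2 * A 1 = (A 0 * A 3)⁻¹ := by
    rw [eq_inv_iff_mul_eq_one]
    calc _ = (A 3)⁻¹ * (A 3 * A 2 * A 1 * A 0) * A 3 := by group
      _ = 1 := by rw [h]; group
  rw [this, tr_inv]

/-- One side of a pair condition fails: one of the two products in a relation is forced to rotate in
both directions. -/
def Bad (b : Fin 4 → ℝ) : Prop :=
  b 1 + b 2 < Real.pi ∧ Real.pi < b 0 + b 3 ∨ Real.pi < b 1 + b 2 ∧ b 0 + b 3 < Real.pi

theorem section_of_bad {β : Labeling} (hb : Bad fun j => a (β.1 j)) : ∃ η : ℝ, η ^ 2 = 1 ∧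
    ∀ α, α ≤ Real.cos (a (β.1 1) + a (β.1 2)) → α ≤ Real.cos (a (β.1 0) + a (β.1 3)) →
      (α < -1 ∨ 0 < η * (Real.cos (a (β.1 2)) - α * Real.cos (a (β.1 1))) ∧
        0 < η * (α * Real.cos (a (β.1 3)) - Real.cos (a (β.1 0)))) := by
  rcases hb with ⟨h1, h2⟩ | ⟨h1, h2⟩
  · refine ⟨1, by norm_num, fun α hα hα' => ?_⟩
    rw [or_iff_not_imp_left, not_lt]
    intro h
    have e1 := SL.cos_sub_mul_cos_pos (ha (β.1 1)) (ha (β.1 2)) h1 h hα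
    have e2 := SL.cos_sub_mul_cos_neg (ha (β.1 3)) (ha (β.1 0)) (by linarith) h
      (by rwa [add_comm])
    exact ⟨by linarith, by linarith⟩
  · refine ⟨-1, by norm_num, fun α hα hα' => ?_⟩
    rw [or_iff_not_imp_left, not_lt]
    intro h
    have e1 := SL.cos_sub_mul_cos_neg (ha (β.1 1)) (ha (β.1 2)) h1 h hα
    have e2 := SL.cos_sub_mul_cos_pos (ha (β.1 3)) (ha (β.1 0)) (by linarith) h
      (by rwa [add_comm])
    exact ⟨by linarith, by linarith⟩

/-- The section exists over the full range of traces allowed by `tr_mul_le`, elliptic ones included,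
and A₂A₁ is never central, so all fibres are connected. -/
theorem connected_of_bad {β : Labeling} (hb : Bad fun j => a (β.1 j)) :
    ∃ z : S a, ∀ P : Relations a, P.1 = β → relSign ha (S.mk P) = 1 →
      S.mk P ∈ connectedComponent z := by
  obtain ⟨η, hη, h⟩ := section_of_bad ha hb
  have hs := fun j => SL.sin_pos (ha (β.1 j))
  obtain ⟨F, hF, hF'⟩ := exists_section hη hs
    (Set.Iic (min (Real.cos (a (β.1 1) + a (β.1 2))) (Real.cos (a (β.1 0) + a (β.1 3)))))
    fun α hα => ⟨hα.trans (min_le_left _ _), hα.trans (min_le_right _ _),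
      h α (hα.trans (min_le_left _ _)) (hα.trans (min_le_right _ _))⟩
  have hFt : ∀ α, IsTuple (fun j => a (β.1 j)) (F α) := fun α => ⟨(hF' α).1, Or.inl (hF' α).2.1⟩
  refine ⟨S.mk (ofTuple ha β (F ⟨min (Real.cos (a (β.1 1) + a (β.1 2)))
    (Real.cos (a (β.1 0) + a (β.1 3))), Set.mem_Iic.2 le_rfl⟩) (hFt _)), ?_⟩
  rintro P rfl hP
  rw [relSign_mk_eq_one_iff] at hP
  have e : S.mk P = S.mk (ofTuple ha P.1 (lifts P) (isTuple_lifts ha P)) := by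
    rw [ofTuple_lifts]
  rw [e]
  have hl := ell_lifts ha P
  have k1 := tr_mul_le (hl 2) (hl 1) (hs 2).ne' (hs 1).ne'
  have k2 := tr_mul_le (hl 0) (hl 3) (hs 0).ne' (hs 3).ne'
  rw [← tr_eq_tr_of_relation hP] at k2
  rw [add_comm] at k1
  refine mem_connectedComponent_of_section ha _ isPreconnected_Iic hF hF' hFt _ _ hP ?_ ?_ ?_
  · exact Set.mem_Iic.2 (le_min (by linarith) (by linarith))
  · intro h1
    rw [h1, tr_one] at k1
    linarith [SL.cos_add_lt_one (ha (P.1.1 1)) (ha (P.1.1 2))]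
  · intro h1
    have := SL.add_eq_pi_of_mul_eq_neg_one (ha _) (ha _) (hl 1) (hl 2) h1
    simp only [Bad] at hb
    rcases hb with hb | hb <;> linarith [hb.1]

/-- Here a section over the hyperbolic traces α < −1 suffices by `hyperbolic_of_good`. The
exceptional relations with A₂A₁ = −1 consist of half-turns and are joined to hyperbolic ones by
`exists_halfTurn_path`. -/
theorem connected_of_good {β : Labeling}
    (hb : a (β.1 1) + a (β.1 2) ≤ Real.pi ∧ a (β.1 0) + a (β.1 3) ≤ Real.pi ∨
      Real.pi ≤ a (β.1 1) + a (β.1 2) ∧ Real.pi ≤ a (β.1 0) + a (β.1 3))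
    (hb' : a (β.1 1) + a (β.1 2) = Real.pi → a (β.1 0) + a (β.1 3) = Real.pi →
      ∀ j, a (β.1 j) = Real.pi / 2) :
    ∃ z : S a, ∀ P : Relations a, P.1 = β → relSign ha (S.mk P) = 1 →
      S.mk P ∈ connectedComponent z := by
  have hs := fun j => SL.sin_pos (ha (β.1 j))
  obtain ⟨F, hF, hF'⟩ := exists_section (η := 1) (by norm_num) hs (Set.Iio (-1))
    fun α hα => ⟨(le_of_lt hα).trans (Real.neg_one_le_cos _),
      (le_of_lt hα).trans (Real.neg_one_le_cos _), Or.inl hα⟩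
  have hFt : ∀ α, IsTuple (fun j => a (β.1 j)) (F α) := fun α => ⟨(hF' α).1, Or.inl (hF' α).2.1⟩
  have h2 : (-2 : ℝ) ∈ Set.Iio (-1 : ℝ) := by norm_num [Set.mem_Iio]
  have key : ∀ (A : Fin 4 → SL) (h : IsTuple (fun j => a (β.1 j)) A),
      A 3 * A 2 * A 1 * A 0 = 1 → tr (A 2 * A 1) < -2 →
      S.mk (ofTuple ha β A h) ∈ connectedComponent (S.mk (ofTuple ha β (F ⟨-2, h2⟩) (hFt _))) := by
    intro A h h1 ht
    refine mem_connectedComponent_of_section ha _ isPreconnected_Iio hF hF' hFt _ h h1 ?_ ?_ ?_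
    · rw [Set.mem_Iio]; linarith
    · intro h0; rw [h0, tr_one] at ht; linarith
    · intro h0; rw [h0, tr_neg, tr_one] at ht; linarith
  refine ⟨S.mk (ofTuple ha β (F ⟨-2, h2⟩) (hFt _)), ?_⟩
  rintro P rfl hP
  rw [relSign_mk_eq_one_iff] at hP
  have e : S.mk P = S.mk (ofTuple ha P.1 (lifts P) (isTuple_lifts ha P)) := by
    rw [ofTuple_lifts]
  rw [e]
  have hl := ell_lifts ha P
  rcases hyperbolic_of_good (fun j => ha (P.1.1 j)) hl hP hb with ht | ⟨hm, e1, e2⟩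
  · exact key _ _ hP ht
  · have hh := hb' e1 e2
    obtain ⟨γ, hγ, hγ', ⟨B, hB⟩, hγ1⟩ := exists_halfTurn_path
      (fun j => by have := hl j; rwa [hh j] at this) hP hm
    have hγt : ∀ t, IsTuple (fun j => a (P.1.1 j)) (γ t) := fun t =>
      ⟨fun j => by simp only [hh j]; exact (hγ' t).1 j, Or.inl (hγ' t).2⟩
    have k1 := mem_connectedComponent_of_continuous
      (S.continuous_mk.comp (continuous_ofTuple ha P.1 hγ hγt)) 1 0
    simp only [Function.comp_apply] at k1
    rw [mk_ofTuple_conj ha (h' := hγt 0) hB]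
    rw [connectedComponent_eq (key (γ 1) (hγt 1) (hγ' 1).2 hγ1)]
    exact k1

theorem exists_rel_of_trace {β : Labeling} {η α : ℝ} (hη : η ^ 2 = 1)
    (h1 : α ≤ Real.cos (a (β.1 1) + a (β.1 2))) (h2 : α ≤ Real.cos (a (β.1 0) + a (β.1 3)))
    (h3 : (α < -1 ∨ 0 < η * (Real.cos (a (β.1 2)) - α * Real.cos (a (β.1 1))) ∧
        0 < η * (α * Real.cos (a (β.1 3)) - Real.cos (a (β.1 0))))) :
    ∃ P : Relations a, P.1 = β ∧ relSign ha (S.mk P) = 1 ∧ tr (lifts P 2 * lifts P 1) = 2 * α := by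
  have hs := fun j => SL.sin_pos (ha (β.1 j))
  obtain ⟨F, hF, hF'⟩ := exists_section (b := fun j => a (β.1 j)) hη hs {α}
    (by rintro _ rfl; exact ⟨h1, h2, h3⟩)
  obtain ⟨e1, e2, e3⟩ := hF' ⟨α, Set.mem_singleton α⟩
  have ht : IsTuple (fun j => a (β.1 j)) (F ⟨α, Set.mem_singleton α⟩) := ⟨e1, Or.inl e2⟩
  refine ⟨ofTuple ha β _ ht, rfl, ?_, ?_⟩
  · rw [relSign_mk_eq_one_iff]
    simp only [lifts_ofTuple]
    exact e2
  · rw [lifts_ofTuple, lifts_ofTuple, e3]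

end
end HexagonSpace

/-! ### Compactness of the components of sign −1. -/

namespace HexagonSpace
open SL

namespace SL

/-- The sign −1 turns the upper bound on tr(ZW) into a lower bound on tr(XY). -/
theorem neg_two_lt_tr_of_mul_eq_neg_one {z w : ℝ} {X Y Z W : SL} (hz : z ∈ Set.Ioo 0 Real.pi)
    (hw : w ∈ Set.Ioo 0 Real.pi) (hZ : Ell z Z) (hW : Ell w W) (h : X * Y * Z * W = -1) :
    -2 < tr (X * Y) := by
  have e : X * Y = -(Z * W)⁻¹ := by
    rw [mul_assoc] at h
    rw [eq_mul_inv_of_mul_eq h, neg_one_mul]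
  rw [e, tr_neg, tr_inv]
  linarith [tr_mul_le hZ hW (sin_pos hz).ne' (sin_pos hw).ne', cos_add_lt_one hz hw]

theorem ell_iff_of_nonneg {b : ℝ} (hb : b ∈ Set.Ioo 0 Real.pi) (A : SL) :
    Ell b A ↔ tr A = 2 * Real.cos b ∧ 0 ≤ A.1 1 0 := by
  refine ⟨fun h => ⟨h.1, h.2.le⟩, fun h => ⟨h.1, lt_of_le_of_ne h.2 fun h0 => ?_⟩⟩
  have h1 := det_eq A
  have h2 := h.1
  have h3 := Real.sin_sq_add_cos_sq b
  have h4 := sin_pos hb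
  rw [← h0] at h1
  rw [tr] at h2
  have h5 : (A.1 0 0 - A.1 1 1) ^ 2 = -4 * Real.sin b ^ 2 := by
    linear_combination (A.1 0 0 + A.1 1 1 + 2 * Real.cos b) * h2 - 4 * h1 + 4 * h3
  nlinarith [sq_nonneg (A.1 0 0 - A.1 1 1)]

theorem isClosed_ell {b : ℝ} (hb : b ∈ Set.Ioo 0 Real.pi) : IsClosed {A : SL | Ell b A} := by
  simp only [ell_iff_of_nonneg hb]
  exact (isClosed_eq continuous_tr continuous_const).inter
    (isClosed_le continuous_const (continuous_entry 1 0))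

theorem isCompact_entries (N : ℝ) : IsCompact {A : SL | ∀ i j, A.1 i j ∈ Set.Icc (-N) N} := by
  have hc : Topology.IsClosedEmbedding (fun A : SL => A.1) :=
    (isClosed_eq (Continuous.matrix_det continuous_id) continuous_const).isClosedEmbedding_subtypeVal
  have hk : IsCompact (Set.univ.pi fun _ => Set.univ.pi fun _ => Set.Icc (-N) N :
      Set (Fin 2 → Fin 2 → ℝ)) :=
    isCompact_univ_pi fun _ => isCompact_univ_pi fun _ => isCompact_Icc
  convert hc.isCompact_preimage hk using 1
  ext A
  exact ⟨fun h i _ j _ => h i j, fun h i j => h i trivial j trivial⟩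

/-- tr(rot a · A) = 2 cos a cos b − sin a (y + z), so the bound confines y + z, that is, the
distance of the centre of A from i. -/
theorem exists_entries_bound {a b : ℝ} (ha : 0 < Real.sin a) (hb : 0 < Real.sin b) : ∃ N : ℝ,
    ∀ A : SL, Ell b A → -2 < tr (rot a * A) → ∀ i j, A.1 i j ∈ Set.Icc (-N) N := by
  refine ⟨1 + (2 * Real.cos a * Real.cos b + 2) / Real.sin a, fun A hA h => ?_⟩
  rw [tr_rot_mul, hA.1] at h
  have h1 : A.1 1 0 - A.1 0 1 ≤ (2 * Real.cos a * Real.cos b + 2) / Real.sin a := by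
    rw [le_div_iff₀ ha]; linarith
  generalize (2 * Real.cos a * Real.cos b + 2) / Real.sin a = N at h1
  obtain ⟨m, y, z, h00, h01, h10, h11, hy, hz, hyz⟩ := hA.coords hb.ne'
  rw [h10, h01] at h1
  have hm : |m| ≤ N := abs_le_of_sq_le_sq (by nlinarith [sq_nonneg (Real.sin b)]) (by linarith)
  rw [abs_le] at hm
  have c1 := Real.cos_le_one b
  have c2 := Real.neg_one_le_cos b
  intro i j
  fin_cases i <;> fin_cases j <;> simp only [Fin.zero_eta, Fin.mk_one, h00, h01, h10, h11] <;>
    constructor <;> linarith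

end SL

variable {a : Fin 4 → ℝ}

section
variable (ha : ∀ j, a j ∈ Set.Ioo 0 Real.pi)
include ha

theorem neg_two_lt_tr_of_relSign {P : Relations a} (h : relSign ha (S.mk P) = -1) :
    -2 < tr (lifts P 2 * lifts P 1) ∧ -2 < tr (lifts P 3 * lifts P 1) := by
  rw [relSign_mk_eq_neg_one_iff] at h
  have hl := ell_lifts ha P
  constructor
  · refine neg_two_lt_tr_of_mul_eq_neg_one (ha _) (ha _) (hl 0) (hl 3) ?_
    calc _ = (lifts P 3)⁻¹ * (lifts P 3 * lifts P 2 * lifts P 1 * lifts P 0) * lifts P 3 := by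
          group
      _ = -1 := by rw [h]; simp
  -- A₁ is brought next to A₃ by A₂A₁ = A₁(A₁⁻¹A₂A₁).
  · refine neg_two_lt_tr_of_mul_eq_neg_one (ha _) (ha _)
      ((hl 2).conj (SL.sin_pos (ha _)).ne' (lifts P 1)⁻¹) (hl 0) ?_
    rw [← h]; group

theorem isCompact_of_relSign {y : S a} (hy : relSign ha y = -1) :
    IsCompact (connectedComponent y) := by
  obtain ⟨P₀, rfl⟩ := Quot.exists_rep y
  have hs := fun j => SL.sin_pos (ha (P₀.1.1 j))
  obtain ⟨N₂, hN₂⟩ := exists_entries_bound (hs 1) (hs 2)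
  obtain ⟨N₃, hN₃⟩ := exists_entries_bound (hs 1) (hs 3)
  -- T parametrizes (A₂, A₃) after normalizing A₁ to a rotation about i; A₀ is solved from the
  -- relation with sign −1. The component is a closed subset of the image of this compact set.
  let T : Set (SL × SL) := {q | (Ell (a (P₀.1.1 2)) q.1 ∧ Ell (a (P₀.1.1 3)) q.2 ∧
    Ell (a (P₀.1.1 0)) (-(q.2 * q.1 * rot (a (P₀.1.1 1)))⁻¹))} ∩
    ({A : SL | ∀ i j, A.1 i j ∈ Set.Icc (-N₂) N₂} ×ˢ {A : SL | ∀ i j, A.1 i j ∈ Set.Icc (-N₃) N₃})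
  have hcont : Continuous fun q : SL × SL => -(q.2 * q.1 * rot (a (P₀.1.1 1)))⁻¹ := by
    have h1 : Continuous fun q : SL × SL => (q.2 * q.1 * rot (a (P₀.1.1 1)))⁻¹ :=
      ((continuous_snd.mul continuous_fst).mul continuous_const).inv
    apply continuous_of_entries <;> simp only [SL.neg_apply] <;>
      exact ((continuous_entry _ _).comp h1).neg
  have hT : IsCompact T :=
    ((isCompact_entries N₂).prod (isCompact_entries N₃)).inter_left
      (((isClosed_ell (ha _)).preimage continuous_fst).inter
        (((isClosed_ell (ha _)).preimage continuous_snd).inter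
          ((isClosed_ell (ha _)).preimage hcont)))
  have : CompactSpace T := isCompact_iff_compactSpace.1 hT
  let F : T → Fin 4 → SL := fun q =>
    ![-(q.1.2 * q.1.1 * rot (a (P₀.1.1 1)))⁻¹, rot (a (P₀.1.1 1)), q.1.1, q.1.2]
  have hF : Continuous F := by
    refine continuous_pi fun j => ?_
    fin_cases j
    · exact hcont.comp continuous_subtype_val
    · exact continuous_const
    · exact continuous_fst.comp continuous_subtype_val
    · exact continuous_snd.comp continuous_subtype_val
  have hFt : ∀ q, IsTuple (fun j => a (P₀.1.1 j)) (F q) := by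
    refine fun q => ⟨fun j => ?_, Or.inr ?_⟩
    · fin_cases j
      · exact q.2.1.2.2
      · exact ell_rot (ha _)
      · exact q.2.1.1
      · exact q.2.1.2.1
    · simp [F]
  refine (isCompact_range (S.continuous_mk.comp (continuous_ofTuple ha P₀.1 hF hFt))).of_isClosed_subset
    isClosed_connectedComponent fun z hz => ?_
  obtain ⟨P, hP, rfl⟩ := exists_rep P₀.1 z (hexType_eq_of_mem hz).symm
  have hzs := (relSign_eq_of_mem ha hz).trans hy
  obtain ⟨t2, t3⟩ := neg_two_lt_tr_of_relSign ha hzs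
  rw [relSign_mk_eq_neg_one_iff] at hzs
  have hl := ell_lifts ha P
  simp only [hP] at hl
  obtain ⟨B, hB⟩ := exists_conj_rot (hl 1) (hs 1)
  have hB' : B⁻¹ * lifts P 1 * B = rot (a (P₀.1.1 1)) := by rw [hB]; group
  have hl' : ∀ j, Ell (a (P₀.1.1 j)) (B⁻¹ * lifts P j * B) := fun j => by
    simpa using (hl j).conj (hs j).ne' B⁻¹
  have h0 : -(B⁻¹ * lifts P 3 * B * (B⁻¹ * lifts P 2 * B) * rot (a (P₀.1.1 1)))⁻¹ =
      B⁻¹ * lifts P 0 * B := by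
    rw [← hB', eq_comm, eq_comm, neg_eq_iff_eq_neg, inv_eq_iff_mul_eq_one, mul_neg,
      neg_eq_iff_eq_neg]
    calc _ = B⁻¹ * (lifts P 3 * lifts P 2 * lifts P 1 * lifts P 0) * B := by group
      _ = -1 := by rw [hzs]; simp
  have tt : ∀ j, -2 < tr (lifts P j * lifts P 1) →
      -2 < tr (rot (a (P₀.1.1 1)) * (B⁻¹ * lifts P j * B)) := by
    intro j hj
    rwa [tr_mul_comm, ← hB', ← tr_conj B,
      show B * (B⁻¹ * lifts P j * B * (B⁻¹ * lifts P 1 * B)) * B⁻¹ = lifts P j * lifts P 1 by group]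
  refine ⟨⟨(B⁻¹ * lifts P 2 * B, B⁻¹ * lifts P 3 * B), ⟨hl' 2, hl' 3, ?_⟩,
    hN₂ _ (hl' 2) (tt 2 t2), hN₃ _ (hl' 3) (tt 3 t3)⟩, ?_⟩
  · change Ell _ (-(B⁻¹ * lifts P 3 * B * (B⁻¹ * lifts P 2 * B) * rot (a (P₀.1.1 1)))⁻¹)
    rw [h0]; exact hl' 0
  · refine S.mk_conj (conjRel_of_lifts ha hP (B := B) fun j => ?_)
    rw [lifts_ofTuple]
    fin_cases j
    · simp only [F, Fin.zero_eta, Matrix.cons_val]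
      rw [h0]; group
    · exact hB
    · simp only [F, Fin.reduceFinMk, Matrix.cons_val]; group
    · simp only [F, Fin.reduceFinMk, Matrix.cons_val]; group

end
end HexagonSpace

/-! ### Dehn twists along elliptic products. -/

namespace HexagonSpace
open SL

namespace SL

/-- An elliptic element lies on a circle subgroup. -/
theorem exists_circle_hom {g : SL} (hg : -2 < tr g) (hg' : tr g < 2) : ∃ (h : Circle →* SL)
    (θ : ℝ), Continuous h ∧ Function.Injective h ∧ h (Circle.exp θ) = g ∧
      tr g = 2 * Real.cos θ := by
  have hd := det_eq g
  obtain ⟨θ, hθ⟩ : ∃ θ, θ = Real.arccos (tr g / 2) := ⟨_, rfl⟩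
  have hc : Real.cos θ = tr g / 2 := by rw [hθ, Real.cos_arccos (by linarith) (by linarith)]
  have hs : 0 < Real.sin θ := by
    rw [hθ, Real.sin_arccos, Real.sqrt_pos]; nlinarith
  have hsc := Real.sin_sq_add_cos_sq θ
  have ht : tr g = g.1 0 0 + g.1 1 1 := rfl
  have hk : ((g.1 0 0 - g.1 1 1) / 2) ^ 2 + g.1 0 1 * g.1 1 0 = -Real.sin θ ^ 2 := by
    rw [hc, ht] at hsc; linarith
  -- The traceless part of g multiplied by w squares to −1, so it plays the role of the imaginary
  -- unit.
  obtain ⟨w, hw⟩ : ∃ w, w = (Real.sin θ)⁻¹ := ⟨_, rfl⟩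
  have hw1 : w * Real.sin θ = 1 := by rw [hw, inv_mul_cancel₀ hs.ne']
  have hk' : w ^ 2 * (((g.1 0 0 - g.1 1 1) / 2) ^ 2 + g.1 0 1 * g.1 1 0) = -1 := by
    rw [hk]; linear_combination (-(w * Real.sin θ) - 1) * hw1
  have hz : ∀ z : Circle, (z : ℂ).re ^ 2 + (z : ℂ).im ^ 2 = 1 := by
    intro z
    have := Circle.normSq_coe z
    rw [Complex.normSq_apply] at this
    linarith
  obtain ⟨f, hf⟩ : ∃ f : Circle → SL, f = fun z : Circle =>
      SL.of ((z : ℂ).re + (z : ℂ).im * (w * ((g.1 0 0 - g.1 1 1) / 2))) ((z : ℂ).im * (w * g.1 0 1))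
        ((z : ℂ).im * (w * g.1 1 0)) ((z : ℂ).re - (z : ℂ).im * (w * ((g.1 0 0 - g.1 1 1) / 2)))
        (by linear_combination hz z - (z : ℂ).im ^ 2 * hk') := ⟨_, rfl⟩
  have f1 : f 1 = 1 := by
    rw [hf]
    apply ext_entries <;> simp [of_zero_zero, of_zero_one, of_one_zero, of_one_one]
  have fm : ∀ z z', f (z * z') = f z * f z' := by
    intro z z'
    rw [hf]
    apply ext_entries <;> simp only [SL.mul_apply, of_zero_zero, of_zero_one, of_one_zero,
      of_one_one, Circle.coe_mul, Complex.mul_re, Complex.mul_im]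
    · linear_combination -((z : ℂ).im * (z' : ℂ).im) * hk'
    · ring
    · ring
    · linear_combination -((z : ℂ).im * (z' : ℂ).im) * hk'
  refine ⟨⟨⟨f, f1⟩, fm⟩, θ, ?_, ?_, ?_, by linarith⟩
  · change Continuous f
    have c1 : Continuous fun z : Circle => (z : ℂ).re := by fun_prop
    have c2 : Continuous fun z : Circle => (z : ℂ).im := by fun_prop
    rw [hf]
    apply continuous_of_entries <;> simp only [of_zero_zero, of_zero_one, of_one_zero,
      of_one_one] <;> fun_prop
  · rw [injective_iff_map_eq_one]
    intro z h
    change f z = 1 at h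
    have e0 := congrArg (fun X : SL => X.1 0 0) h
    have e1 := congrArg (fun X : SL => X.1 1 1) h
    rw [hf] at e0 e1
    simp only [of_zero_zero, of_one_one, one_zero_zero, one_one_one] at e0 e1
    have hre : (z : ℂ).re = 1 := by linarith
    have him : (z : ℂ).im = 0 := by
      have := hz z
      rw [hre] at this
      exact pow_eq_zero_iff two_ne_zero |>.1 (by linarith)
    exact Circle.ext (Complex.ext hre him)
  · change f (Circle.exp θ) = g
    have r : ((Circle.exp θ : Circle) : ℂ).re = Real.cos θ := by
      rw [Circle.coe_exp, Complex.exp_ofReal_mul_I_re]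
    have i : ((Circle.exp θ : Circle) : ℂ).im = Real.sin θ := by
      rw [Circle.coe_exp, Complex.exp_ofReal_mul_I_im]
    rw [hf]
    apply ext_entries <;> simp only [of_zero_zero, of_zero_one, of_one_zero, of_one_one, r, i]
    · rw [hc, ht]; linear_combination ((g.1 0 0 - g.1 1 1) / 2) * hw1
    · linear_combination g.1 0 1 * hw1
    · linear_combination g.1 1 0 * hw1
    · rw [hc, ht]; linear_combination -((g.1 0 0 - g.1 1 1) / 2) * hw1

theorem exists_rat_of_exp_pow_eq_one {θ : ℝ} {n : ℕ} (hn : n ≠ 0) (h : Circle.exp θ ^ n = 1) :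
    ∃ q : ℚ, θ = Real.pi * q := by
  rw [← Circle.exp_nsmul, Circle.exp_eq_one] at h
  obtain ⟨m, hm⟩ := h
  refine ⟨2 * m / n, ?_⟩
  have : (n : ℝ) ≠ 0 := Nat.cast_ne_zero.2 hn
  rw [nsmul_eq_mul] at hm
  push_cast
  field_simp
  linarith

end SL

variable {a : Fin 4 → ℝ}

theorem hexType_modS (l : Fin 3) (x : S a) : hexType (modS l x) = -hexType x := by
  obtain ⟨P, hP, rfl⟩ := S.exists_label l x
  rw [modS_of_label l P hP]
  change Equiv.Perm.sign (surgery P).1.1 = -Equiv.Perm.sign P.1.1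
  rw [surgery, Equiv.Perm.sign_mul, Equiv.Perm.sign_swap (by decide), mul_neg, mul_one]

/-- The product of two modifications. -/
def twist (i l : Fin 3) : Equiv.Perm (S a) := (modS_modS i).toPerm * (modS_modS l).toPerm

theorem twist_mem (i l : Fin 3) : twist i l ∈ M a :=
  ⟨mul_mem (Subgroup.subset_closure ⟨i, rfl⟩) (Subgroup.subset_closure ⟨l, rfl⟩), fun x => by
    change hexType (modS i (modS l x)) = _
    rw [hexType_modS, hexType_modS, neg_neg]⟩

theorem twist_mk {i l : Fin 3} (P : Relations a) (hi : P.1.1 1 = i.succ) (hl : P.1.1 2 = l.succ) :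
    twist i l (S.mk P) = S.mk (surgery (surgery P)) := by
  change modS i (modS l (S.mk P)) = _
  rw [modS_of_label l P hl, modS_of_label i _ ((surgery_label P).2.1.trans hi)]

section
variable (ha : ∀ j, a j ∈ Set.Ioo 0 Real.pi)
include ha

/-- The Dehn twist. -/
theorem twist_ofTuple {i l : Fin 3} {β : Labeling} (hi : β.1 1 = i.succ) (hl : β.1 2 = l.succ)
    {A A' : Fin 4 → SL} (h : IsTuple (fun j => a (β.1 j)) A)
    (h' : IsTuple (fun j => a (β.1 j)) A') (h0 : A' 0 = A 0)
    (h1 : A' 1 = A 2 * A 1 * A 1 * (A 2 * A 1)⁻¹) (h2 : A' 2 = A 2 * A 1 * A 2 * (A 2 * A 1)⁻¹)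
    (h3 : A' 3 = A 3) :
    twist i l (S.mk (ofTuple ha β A h)) = S.mk (ofTuple ha β A' h') := by
  rw [twist_mk _ hi hl]
  congr 1
  refine Relations.ext' (Subtype.ext ?_) fun j => ?_
  · simp only [surgery, mul_assoc, Equiv.swap_mul_self, mul_one]
    rfl
  · fin_cases j
    · simp [surgery, ofTuple, h0]
    · simp [surgery, ofTuple, h1, mul_assoc]
    · simp [surgery, ofTuple, h2, mul_assoc]
    · simp [surgery, ofTuple, h3]

theorem ofTuple_fst (β : Labeling) (A : Fin 4 → SL) (h : IsTuple (fun j => a (β.1 j)) A) :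
    (ofTuple ha β A h).1 = β := rfl

omit ha in
/-- The tuple obtained by the conjugation of the middle elements. -/
def bend (A : Fin 4 → SL) (k : SL) : Fin 4 → SL :=
  ![A 0, k * A 1 * k⁻¹, k * A 2 * k⁻¹, A 3]

omit ha in
theorem bend_zero (A : Fin 4 → SL) (k : SL) : bend A k 0 = A 0 := rfl

omit ha in
theorem bend_three (A : Fin 4 → SL) (k : SL) : bend A k 3 = A 3 := rfl

omit ha in
theorem bend_one (A : Fin 4 → SL) (k : SL) : bend A k 1 = k * A 1 * k⁻¹ := rfl

omit ha in
theorem bend_two (A : Fin 4 → SL) (k : SL) : bend A k 2 = k * A 2 * k⁻¹ := rfl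

omit ha in
theorem bend_one_right (A : Fin 4 → SL) : bend A 1 = A := by
  funext j
  rw [bend, inv_one]
  simp only [one_mul, mul_one]
  fin_cases j <;> rfl

omit ha in
theorem bend_mul {A : Fin 4 → SL} {k : SL} (hk : k * (A 2 * A 1) = A 2 * A 1 * k) :
    bend A k 2 * bend A k 1 = A 2 * A 1 := by
  calc bend A k 2 * bend A k 1 = k * (A 2 * A 1) * k⁻¹ := by
        rw [bend_one, bend_two]; group
    _ = A 2 * A 1 := mul_inv_eq_iff_eq_mul.2 hk

theorem isTuple_bend {β : Labeling} {A : Fin 4 → SL} (h : IsTuple (fun j => a (β.1 j)) A) {k : SL}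
    (hk : k * (A 2 * A 1) = A 2 * A 1 * k) : IsTuple (fun j => a (β.1 j)) (bend A k) := by
  have hs := fun j => SL.sin_pos (ha (β.1 j))
  refine ⟨fun j => ?_, ?_⟩
  · fin_cases j
    · exact h.1 0
    · exact (h.1 1).conj (hs 1).ne' _
    · exact (h.1 2).conj (hs 2).ne' _
    · exact h.1 3
  · rw [mul_assoc (bend A k 3), bend_mul hk, ← mul_assoc]
    exact h.2

omit ha in
theorem continuous_bend {X : Type*} [TopologicalSpace X] (A : Fin 4 → SL) {k : X → SL}
    (hk : Continuous k) : Continuous fun x => bend A (k x) := by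
  refine continuous_pi fun j => ?_
  fin_cases j
  · exact continuous_const
  · exact (hk.mul continuous_const).mul hk.inv
  · exact (hk.mul continuous_const).mul hk.inv
  · exact continuous_const

theorem mk_bend_one {β : Labeling} {A : Fin 4 → SL} (h : IsTuple (fun j => a (β.1 j)) A)
    (h' : IsTuple (fun j => a (β.1 j)) (bend A 1)) :
    S.mk (ofTuple ha β _ h') = S.mk (ofTuple ha β A h) := by
  congr 2
  exact bend_one_right A

theorem twist_bend {i l : Fin 3} {β : Labeling} (hi : β.1 1 = i.succ) (hl : β.1 2 = l.succ)
    {A : Fin 4 → SL} {k k' : SL} (hk : k * (A 2 * A 1) = A 2 * A 1 * k) (hk' : k' = A 2 * A 1 * k)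
    (h : IsTuple (fun j => a (β.1 j)) (bend A k)) (h' : IsTuple (fun j => a (β.1 j)) (bend A k')) :
    twist i l (S.mk (ofTuple ha β _ h)) = S.mk (ofTuple ha β _ h') := by
  subst hk'
  refine twist_ofTuple ha hi hl h h' (by rw [bend_zero, bend_zero]) ?_ ?_
    (by rw [bend_three, bend_three])
  · rw [bend_mul hk, bend_one, bend_one]
    group
  · rw [bend_mul hk, bend_two, bend_two]
    group

/-- A conjugation between the two bends fixes A₀ and A₃, whose centres differ, so it is by ±1. Then
k⁻¹k′ commutes with A₁ and A₂, whose centres differ as well. -/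
theorem bend_eq {β : Labeling} {A : Fin 4 → SL} {k k' : SL} (hA : ∀ j, Ell (a (β.1 j)) (A j))
    (h : IsTuple (fun j => a (β.1 j)) (bend A k)) (h' : IsTuple (fun j => a (β.1 j)) (bend A k'))
    (h12 : tr (A 1 * A 2) ≠ 2 * Real.cos (a (β.1 1) + a (β.1 2)))
    (h03 : tr (A 0 * A 3) ≠ 2 * Real.cos (a (β.1 0) + a (β.1 3)))
    (he : S.mk (ofTuple ha β _ h) = S.mk (ofTuple ha β _ h')) : k⁻¹ * k' = 1 ∨ k⁻¹ * k' = -1 := by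
  have hs := fun j => SL.sin_pos (ha (β.1 j))
  obtain ⟨B, hB⟩ := exists_conj_of_mk_eq ha
    ((ofTuple_fst ha β _ h').trans (ofTuple_fst ha β _ h).symm) he
  simp only [lifts_ofTuple] at hB
  have k0 := hB 0
  have k1 := hB 1
  have k2 := hB 2
  have k3 := hB 3
  rw [bend_zero, bend_zero] at k0
  rw [bend_one, bend_one] at k1
  rw [bend_two, bend_two] at k2
  rw [bend_three, bend_three] at k3
  have b0 : B * A 0 = A 0 * B := mul_inv_eq_iff_eq_mul.1 k0.symm
  have b3 : B * A 3 = A 3 * B := mul_inv_eq_iff_eq_mul.1 k3.symm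
  have hB1 := eq_one_or_neg_one_of_commute (hs 0) (hs 3) (hA 0) (hA 3) h03 b0 b3
  have hBc : ∀ X : SL, B * X * B⁻¹ = X := by
    intro X
    rcases hB1 with h | h <;> rw [h] <;> simp
  have hk : ∀ j, k' * A j * k'⁻¹ = k * A j * k⁻¹ → k⁻¹ * k' * A j = A j * (k⁻¹ * k') := by
    intro j hj
    rw [← mul_inv_eq_iff_eq_mul]
    calc _ = k⁻¹ * (k' * A j * k'⁻¹) * k := by group
      _ = A j := by rw [hj]; group
  exact eq_one_or_neg_one_of_commute (hs 1) (hs 2) (hA 1) (hA 2) h12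
    (hk 1 (k1.trans (hBc _))) (hk 2 (k2.trans (hBc _)))

/-- The Dehn twists about a product that rotates by an irrational angle do not act discretely. -/
theorem not_actsDiscretely {x : S a} {P : Relations a} (hP : S.mk P ∈ connectedComponent x)
    (ht : -2 < tr (lifts P 2 * lifts P 1)) (ht' : tr (lifts P 2 * lifts P 1) < 2)
    (hirr : ∀ q : ℚ, tr (lifts P 2 * lifts P 1) ≠ 2 * Real.cos (Real.pi * q))
    (h12 : tr (lifts P 1 * lifts P 2) ≠ 2 * Real.cos (a (P.1.1 1) + a (P.1.1 2)))
    (h03 : tr (lifts P 0 * lifts P 3) ≠ 2 * Real.cos (a (P.1.1 0) + a (P.1.1 3))) :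
    ¬ ActsDiscretely (M a) (connectedComponent x) := by
  intro hdisc
  obtain ⟨i, hi⟩ := exists_label_eq_succ P.1 (show (1 : Fin 4) ≠ 0 by decide)
  obtain ⟨l, hl⟩ := exists_label_eq_succ P.1 (show (2 : Fin 4) ≠ 0 by decide)
  obtain ⟨h, θ, hcont, hinj, hθ, htr⟩ := exists_circle_hom ht ht'
  have hcomm : ∀ z, h z * (lifts P 2 * lifts P 1) = lifts P 2 * lifts P 1 * h z := fun z => by
    rw [← hθ, ← map_mul, mul_comm, map_mul]
  have hF := fun z => isTuple_bend ha (isTuple_lifts ha P) (hcomm z)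
  obtain ⟨E, hEd⟩ : ∃ E : Circle → S a, E = fun z => S.mk (ofTuple ha P.1 _ (hF z)) := ⟨_, rfl⟩
  have hE : Continuous E := by
    rw [hEd]
    exact S.continuous_mk.comp (continuous_ofTuple ha P.1 (continuous_bend (lifts P) hcont) hF)
  have hE1 : E 1 = S.mk P := by
    have e : S.mk P = S.mk (ofTuple ha P.1 (lifts P) (isTuple_lifts ha P)) := by
      rw [ofTuple_lifts]
    have h1 : IsTuple (fun j => a (P.1.1 j)) (bend (lifts P) 1) := by
      have := hF 1
      rwa [map_one] at this
    rw [e, ← mk_bend_one ha (isTuple_lifts ha P) h1, hEd]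
    simp only [map_one]
  have hT : ∀ z, twist i l (E z) = E (Circle.exp θ * z) := by
    intro z
    rw [hEd]
    exact twist_bend ha hi hl (hcomm z) (by rw [map_mul, hθ]) _ _
  have hTn : ∀ n : ℕ, (twist i l ^ n) (S.mk P) = E (Circle.exp θ ^ n) := by
    intro n
    induction n with
    | zero => rw [pow_zero, pow_zero, hE1, Equiv.Perm.one_apply]
    | succ n ih => rw [pow_succ', Equiv.Perm.mul_apply, ih, hT, pow_succ']
  have key : ∀ m n : ℕ, m < n → E (Circle.exp θ ^ m) = E (Circle.exp θ ^ n) → False := by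
    intro m n hmn he
    obtain ⟨k, rfl⟩ := Nat.exists_eq_add_of_lt hmn
    rw [hEd] at he
    have h1 := bend_eq ha (ell_lifts ha P) _ _ h12 h03 he
    rw [add_assoc, pow_add, map_mul, inv_mul_cancel_left] at h1
    -- Squaring absorbs the sign ±1; the rotation by θ would have finite order, against `hirr`.
    have h2 : h ((Circle.exp θ ^ (k + 1)) ^ 2) = 1 := by
      rw [map_pow]
      rcases h1 with h1 | h1 <;> rw [h1] <;> simp
    rw [← pow_mul] at h2
    obtain ⟨q, hq⟩ := exists_rat_of_exp_pow_eq_one (by omega) (hinj (h2.trans (map_one h).symm))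
    exact hirr q (by rw [htr, hq])
  clear hEd
  have hEC : ∀ z, E z ∈ connectedComponent x := by
    intro z
    have := mem_connectedComponent_of_continuous hE 1 z
    rwa [hE1, ← connectedComponent_eq hP] at this
  obtain ⟨U, hU, hfin⟩ := hdisc _ hP
  -- The powers of an element of the compact circle return to every neighbourhood of 1, so
  -- infinitely many powers of the twist bring the point back to U. Finiteness then forces two
  -- powers to coincide on the component.
  have hfreq : ∃ᶠ n : ℕ in Filter.atTop, Circle.exp θ ^ n ∈ E ⁻¹' U :=
    (mapClusterPt_one_atTop_pow (Circle.exp θ)).frequently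
      (hE.continuousAt.preimage_mem_nhds (by rwa [hE1]))
  obtain ⟨m, hm, n, hn, hmn, hfmn⟩ :=
    (Nat.frequently_atTop_iff_infinite.1 hfreq).exists_ne_map_eq_of_mapsTo
    (f := fun n : ℕ => fun y : connectedComponent x => (twist i l ^ n) (y : S a))
    (fun n hn => by
      refine ⟨twist i l ^ n, pow_mem (twist_mem i l) n, rfl, (twist i l ^ n) (S.mk P),
        ⟨_, ⟨mem_of_mem_nhds hU, hP⟩, rfl⟩, ?_, ?_⟩
      · rw [hTn]; exact hn
      · rw [hTn]; exact hEC _) hfin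
  have hEmn : E (Circle.exp θ ^ m) = E (Circle.exp θ ^ n) := by
    rw [← hTn, ← hTn]
    exact congrFun hfmn ⟨_, hP⟩
  rcases lt_or_gt_of_ne hmn with h | h
  · exact key _ _ h hEmn
  · exact key _ _ h hEmn.symm

end
end HexagonSpace

/-! ### Consequences of discreteness, and the conclusion. -/

namespace HexagonSpace
open SL

variable {a : Fin 4 → ℝ}

section
variable (ha : ∀ j, a j ∈ Set.Ioo 0 Real.pi)
include ha

theorem tr_mul_eq_or_eq_neg (P : Relations a) : tr (lifts P 2 * lifts P 1) =
    tr (lifts P 0 * lifts P 3) ∨ tr (lifts P 2 * lifts P 1) = -tr (lifts P 0 * lifts P 3) := by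
  rcases (isTuple_lifts ha P).2 with h | h
  · exact Or.inl (tr_eq_tr_of_relation h)
  · right
    have e : lifts P 2 * lifts P 1 = -(lifts P 0 * lifts P 3)⁻¹ := by
      rw [← neg_one_mul, eq_mul_inv_iff_mul_eq]
      calc _ = (lifts P 3)⁻¹ * (lifts P 3 * lifts P 2 * lifts P 1 * lifts P 0) * lifts P 3 := by
            group
        _ = -1 := by rw [h]; simp
    rw [e, tr_neg, tr_inv]

/-- A discrete action forces the trace of a partial product to be constant on a component where it
takes an elliptic value. -/
theorem pairTr_eq_of_actsDiscretely {x : S a}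
    (hdisc : ActsDiscretely (M a) (connectedComponent x)) {β : Labeling}
    (hβ : Equiv.Perm.sign β.1 = hexType x) {i l : Fin 3} (hi : β.1 2 = i.succ)
    (hl : β.1 1 = l.succ) {y y' : S a} (hy : y ∈ connectedComponent x)
    (hy' : y' ∈ connectedComponent x) (h1 : -2 < pairTr ha i l y) (h2 : pairTr ha i l y < 2) :
    pairTr ha i l y = pairTr ha i l y' := by
  by_contra hne
  -- The excluded traces are those of rational rotations and those where a pair has a common centre.
  -- Both signs occur for the pair {0, 3} because tr(A₂A₁) = ± tr(A₀A₃). An interval of elliptic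
  -- values cannot lie in this countable set.
  obtain ⟨D, hD⟩ : ∃ D : Set ℝ, D = Set.range (fun q : ℚ => 2 * Real.cos (Real.pi * q)) ∪
    {2 * Real.cos (a (β.1 1) + a (β.1 2)), 2 * Real.cos (a (β.1 0) + a (β.1 3)),
      -(2 * Real.cos (a (β.1 0) + a (β.1 3)))} := ⟨_, rfl⟩
  have hDc : D.Countable := by
    rw [hD]
    exact (Set.countable_range _).union (Set.toFinite _).countable
  have hoc := (isPreconnected_connectedComponent (x := x)).image (pairTr ha i l)
    (continuous_pairTr ha i l).continuousOn |>.ordConnected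
  obtain ⟨v, hv, hvD, hv1, hv2⟩ : ∃ v ∈ pairTr ha i l '' connectedComponent x, v ∉ D ∧
      -2 < v ∧ v < 2 := by
    rcases lt_or_gt_of_ne hne with h | h
    · obtain ⟨v, hv, hv'⟩ := (hDc.dense_compl ℝ).exists_between (lt_min h h2)
      exact ⟨v, hoc.out (Set.mem_image_of_mem _ hy) (Set.mem_image_of_mem _ hy')
        ⟨hv'.1.le, (hv'.2.trans_le (min_le_left _ _)).le⟩, hv, h1.trans hv'.1,
        hv'.2.trans_le (min_le_right _ _)⟩
    · obtain ⟨v, hv, hv'⟩ := (hDc.dense_compl ℝ).exists_between (max_lt h h1)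
      exact ⟨v, hoc.out (Set.mem_image_of_mem _ hy') (Set.mem_image_of_mem _ hy)
        ⟨((le_max_left _ _).trans_lt hv'.1).le, hv'.2.le⟩, hv, (le_max_right _ _).trans_lt hv'.1,
        hv'.2.trans h2⟩
  obtain ⟨w, hw, rfl⟩ := hv
  obtain ⟨P, rfl, rfl⟩ := exists_rep β w (hβ.trans (hexType_eq_of_mem hw).symm)
  rw [pairTr_mk ha P hi hl] at hvD hv1 hv2
  simp only [hD, Set.mem_union, Set.mem_range, Set.mem_insert_iff, Set.mem_singleton_iff,
    not_or, not_exists] at hvD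
  obtain ⟨d1, d2, d3, d4⟩ := hvD
  refine not_actsDiscretely ha hw hv1 hv2 (fun q h => d1 q h.symm) ?_ (fun h => ?_) hdisc
  · rwa [tr_mul_comm]
  · rcases tr_mul_eq_or_eq_neg ha P with e | e
    · exact d3 (e.trans h)
    · exact d4 (by rw [e, h])

theorem pairTr_eq_of_relSign {x : S a} (hx : relSign ha x = -1)
    (hdisc : ActsDiscretely (M a) (connectedComponent x)) {β : Labeling}
    (hβ : Equiv.Perm.sign β.1 = hexType x) {i l : Fin 3} (hi : β.1 2 = i.succ)
    (hl : β.1 1 = l.succ) {y y' : S a} (hy : y ∈ connectedComponent x)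
    (hy' : y' ∈ connectedComponent x) : pairTr ha i l y = pairTr ha i l y' := by
  obtain ⟨P, rfl, rfl⟩ := exists_rep β y (hβ.trans (hexType_eq_of_mem hy).symm)
  refine pairTr_eq_of_actsDiscretely ha hdisc hβ hi hl hy hy' ?_ ?_
  · rw [pairTr_mk ha P hi hl]
    exact (neg_two_lt_tr_of_relSign ha ((relSign_eq_of_mem ha hy).trans hx)).1
  · rw [pairTr_mk ha P hi hl]
    have := tr_mul_le (ell_lifts ha P 2) (ell_lifts ha P 1) (SL.sin_pos (ha _)).ne'
      (SL.sin_pos (ha _)).ne'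
    linarith [SL.cos_add_lt_one (ha (P.1.1 2)) (ha (P.1.1 1))]

/-- For sign −1 every pair trace is elliptic, hence constant on the component. The three pair
traces, one for each cyclic shift, are complete invariants there, so the component would be a point.
-/
theorem relSign_eq_one_of_actsDiscretely {x : S a} (hne : (connectedComponent x).Nontrivial)
    (hdisc : ActsDiscretely (M a) (connectedComponent x)) : relSign ha x = 1 := by
  refine (relSign_eq ha x).resolve_right fun hx => ?_
  obtain ⟨y, hy, y', hy', hyy⟩ := hne
  obtain ⟨P, rfl⟩ := Quot.exists_rep y
  change S.mk P ∈ _ at hy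
  have hβ : Equiv.Perm.sign P.1.1 = hexType x := hexType_eq_of_mem hy
  obtain ⟨Q, hQ, rfl⟩ := exists_rep P.1 y' (hβ.trans (hexType_eq_of_mem hy').symm)
  obtain ⟨l₁, e1⟩ := exists_label_eq_succ P.1 (show (1 : Fin 4) ≠ 0 by decide)
  obtain ⟨l₂, e2⟩ := exists_label_eq_succ P.1 (show (2 : Fin 4) ≠ 0 by decide)
  obtain ⟨l₃, e3⟩ := exists_label_eq_succ P.1 (show (3 : Fin 4) ≠ 0 by decide)
  have hQl : ∀ j, Q.1.1 j = P.1.1 j := fun j => by rw [hQ]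
  obtain ⟨s1, s2, s3⟩ := shift_label P
  obtain ⟨r1, r2, r3⟩ := shift_label (shift P)
  have hsh : ∀ R : Relations a, Equiv.Perm.sign (shift R).1.1 = Equiv.Perm.sign R.1.1 :=
    fun R => congrArg hexType (S.mk_shift R)
  have k12 := pairTr_eq_of_relSign ha hx hdisc hβ e2 e1 hy hy'
  have k23 := pairTr_eq_of_relSign ha hx hdisc (β := (shift P).1) ((hsh P).trans hβ)
    (s2.trans e3) (s1.trans e2) hy hy'
  have k31 := pairTr_eq_of_relSign ha hx hdisc (β := (shift (shift P)).1)
    (((hsh _).trans (hsh P)).trans hβ) (r2.trans (s3.trans e1)) (r1.trans (s2.trans e3)) hy hy'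
  have k12 : pairTr ha l₂ l₁ (S.mk P) = pairTr ha l₂ l₁ (S.mk Q) := k12
  have k23 : pairTr ha l₃ l₂ (S.mk P) = pairTr ha l₃ l₂ (S.mk Q) := k23
  have k31 : pairTr ha l₁ l₃ (S.mk P) = pairTr ha l₁ l₃ (S.mk Q) := k31
  rw [pairTr_mk ha P e2 e1, pairTr_mk ha Q ((hQl _).trans e2) ((hQl _).trans e1)] at k12
  rw [pairTr_mk ha P e3 e2, pairTr_mk ha Q ((hQl _).trans e3) ((hQl _).trans e2)] at k23
  rw [pairTr_mk ha P e1 e3, pairTr_mk ha Q ((hQl _).trans e1) ((hQl _).trans e3)] at k31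
  have hP := (relSign_mk_eq_neg_one_iff ha P).1 ((relSign_eq_of_mem ha hy).trans hx)
  have hQ' := (relSign_mk_eq_neg_one_iff ha Q).1 ((relSign_eq_of_mem ha hy').trans hx)
  obtain ⟨B, hB⟩ := exists_conj_of_invariants ha hQ (hP.trans hQ'.symm)
    (by rw [tr_mul_comm, k12, tr_mul_comm]) k31 (by rw [tr_mul_comm, k23, tr_mul_comm])
  exact hyy (S.mk_conj (conjRel_of_lifts ha hQ hB))

theorem not_bad_of_actsDiscretely {P : Relations a} (hx : relSign ha (S.mk P) = 1)
    (hdisc : ActsDiscretely (M a) (connectedComponent (S.mk P))) :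
    ¬ Bad fun j => a (P.1.1 j) := by
  intro hb
  obtain ⟨z, hz⟩ := connected_of_bad ha hb
  obtain ⟨η, hη, h⟩ := section_of_bad ha hb
  have n1 : a (P.1.1 1) + a (P.1.1 2) ≠ Real.pi := by
    simp only [Bad] at hb
    intro h0
    rcases hb with hb | hb <;> linarith [hb.1]
  have n2 : a (P.1.1 0) + a (P.1.1 3) ≠ Real.pi := by
    simp only [Bad] at hb
    intro h0
    rcases hb with hb | hb <;> linarith [hb.2]
  -- An elliptic value 2α, to be played against the hyperbolic value −4 on the same component.
  obtain ⟨α, hα, hα'⟩ := exists_between (lt_min (neg_one_lt_cos_add (ha _) (ha _) n1)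
    (neg_one_lt_cos_add (ha _) (ha _) n2))
  rw [lt_min_iff] at hα'
  obtain ⟨Q, hQ, hQs, hQt⟩ := exists_rel_of_trace ha hη hα'.1.le hα'.2.le
    (h α hα'.1.le hα'.2.le)
  have c1 := Real.neg_one_le_cos (a (P.1.1 1) + a (P.1.1 2))
  have c2 := Real.neg_one_le_cos (a (P.1.1 0) + a (P.1.1 3))
  obtain ⟨R, hR, hRs, hRt⟩ := exists_rel_of_trace ha (β := P.1) (α := -2) hη (by linarith)
    (by linarith) (Or.inl (by norm_num))
  have hC := connectedComponent_eq (hz P rfl hx)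
  obtain ⟨l, hl⟩ := exists_label_eq_succ P.1 (show (1 : Fin 4) ≠ 0 by decide)
  obtain ⟨i, hi⟩ := exists_label_eq_succ P.1 (show (2 : Fin 4) ≠ 0 by decide)
  have tQ : pairTr ha i l (S.mk Q) = 2 * α := by
    rw [pairTr_mk ha Q (by rw [hQ, hi]) (by rw [hQ, hl]), hQt]
  have tR : pairTr ha i l (S.mk R) = 2 * (-2) := by
    rw [pairTr_mk ha R (by rw [hR, hi]) (by rw [hR, hl]), hRt]
  have := pairTr_eq_of_actsDiscretely ha hdisc (β := P.1) rfl hi hl (y := S.mk Q) (y' := S.mk R)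
    (hC ▸ hz Q hQ hQs) (hC ▸ hz R hR hRs) (by linarith)
    (by linarith [Real.cos_le_one (a (P.1.1 1) + a (P.1.1 2))])
  linarith

omit ha in
-- Shifting each label l to position 3 shows that a₀ + a_l and the complementary sum are never
-- strictly separated by π. Whether the total of all four angles is at most or at least 2π then
-- decides the side for all pairs at once.
theorem sums_of_not_bad {x : S a}
    (h : ∀ P : Relations a, S.mk P = x → ¬ Bad fun j => a (P.1.1 j)) :
    (∀ j k, j ≠ k → a j + a k ≤ Real.pi) ∨ (∀ j k, j ≠ k → Real.pi ≤ a j + a k) := by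
  have key : ∀ l : Fin 3, ¬ (a 0 + a 1 + a 2 + a 3 - a 0 - a l.succ < Real.pi ∧
      Real.pi < a 0 + a l.succ ∨ Real.pi < a 0 + a 1 + a 2 + a 3 - a 0 - a l.succ ∧
      a 0 + a l.succ < Real.pi) := by
    intro l
    obtain ⟨P, hP, hPx⟩ := exists_rep_three l x
    have h1 := h P hPx
    have hsum := Equiv.sum_comp P.1.1 a
    rw [Fin.sum_univ_four, Fin.sum_univ_four, hP, P.1.2] at hsum
    simp only [Bad] at h1
    rw [hP, P.1.2, show a (P.1.1 1) + a (P.1.1 2) = a 0 + a 1 + a 2 + a 3 - a 0 - a l.succ by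
      linarith] at h1
    exact h1
  have k1 := key 0
  have k2 := key 1
  have k3 := key 2
  simp only [Fin.succ_zero_eq_one, Fin.succ_one_eq_two, show Fin.succ (2 : Fin 3) = 3 from rfl]
    at k1 k2 k3
  push Not at k1 k2 k3
  rcases le_total (a 0 + a 1 + a 2 + a 3) (2 * Real.pi) with hS | hS
  · left
    have f : ∀ s t : ℝ, s + t ≤ 2 * Real.pi → (s < Real.pi → t ≤ Real.pi) →
        (Real.pi < s → Real.pi ≤ t) → s ≤ Real.pi ∧ t ≤ Real.pi := by
      intro s t hst h1 h2
      constructor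
      · by_contra! h; linarith [h2 h]
      · by_contra! h; linarith [h1 (by linarith)]
    have f1 := f _ _ (by linarith) k1.1 k1.2
    have f2 := f _ _ (by linarith) k2.1 k2.2
    have f3 := f _ _ (by linarith) k3.1 k3.2
    intro j k hjk
    fin_cases j <;> fin_cases k <;>
      first | exact absurd rfl hjk | (simp only [Fin.zero_eta, Fin.mk_one, Fin.reduceFinMk]; linarith)
  · right
    have f : ∀ s t : ℝ, 2 * Real.pi ≤ s + t → (s < Real.pi → t ≤ Real.pi) →
        (Real.pi < s → Real.pi ≤ t) → Real.pi ≤ s ∧ Real.pi ≤ t := by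
      intro s t hst h1 h2
      constructor
      · by_contra! h; linarith [h1 h]
      · by_contra! h; linarith [h2 (by linarith)]
    have f1 := f _ _ (by linarith) k1.1 k1.2
    have f2 := f _ _ (by linarith) k2.1 k2.2
    have f3 := f _ _ (by linarith) k3.1 k3.2
    intro j k hjk
    fin_cases j <;> fin_cases k <;>
      first | exact absurd rfl hjk | (simp only [Fin.zero_eta, Fin.mk_one, Fin.reduceFinMk]; linarith)

theorem connected_of_sums (β : Labeling)
    (h : (∀ j k, j ≠ k → a j + a k ≤ Real.pi) ∨ (∀ j k, j ≠ k → Real.pi ≤ a j + a k)) :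
    ∃ z : S a, ∀ P : Relations a, P.1 = β → relSign ha (S.mk P) = 1 →
      S.mk P ∈ connectedComponent z := by
  have hβ : ∀ j k : Fin 4, j ≠ k → β.1 j ≠ β.1 k := fun j k => β.1.injective.ne
  refine connected_of_good ha ?_ ?_
  · exact h.imp (fun h => ⟨h _ _ (hβ _ _ (by decide)), h _ _ (hβ _ _ (by decide))⟩)
      fun h => ⟨h _ _ (hβ _ _ (by decide)), h _ _ (hβ _ _ (by decide))⟩
  · intro e1 e2
    -- If two complementary sums equal π, the total is 2π, so all the other inequalities are
    -- equalities.
    have key : ∀ j, a (β.1 j) = Real.pi / 2 := by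
      rcases h with h | h
      all_goals
        have h01 := h _ _ (hβ 0 1 (by decide))
        have h02 := h _ _ (hβ 0 2 (by decide))
        have h13 := h _ _ (hβ 1 3 (by decide))
        have h23 := h _ _ (hβ 2 3 (by decide))
        intro j
        fin_cases j <;> simp only [Fin.zero_eta, Fin.mk_one, Fin.reduceFinMk] <;> linarith
    exact key

theorem not_isCompact_connectedComponent {P : Relations a} (hx : relSign ha (S.mk P) = 1)
    {z : S a} (hz : ∀ Q : Relations a, Q.1 = P.1 → relSign ha (S.mk Q) = 1 →
      S.mk Q ∈ connectedComponent z) : ¬ IsCompact (connectedComponent (S.mk P)) := by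
  intro hc
  obtain ⟨l, hl⟩ := exists_label_eq_succ P.1 (show (1 : Fin 4) ≠ 0 by decide)
  obtain ⟨i, hi⟩ := exists_label_eq_succ P.1 (show (2 : Fin 4) ≠ 0 by decide)
  obtain ⟨m, hm⟩ := (hc.image (continuous_pairTr ha i l)).bddBelow
  have c1 := Real.neg_one_le_cos (a (P.1.1 1) + a (P.1.1 2))
  have c2 := Real.neg_one_le_cos (a (P.1.1 0) + a (P.1.1 3))
  have l1 : min m (-1) - 1 ≤ m - 1 := by linarith [min_le_left m (-1)]
  have l2 : min m (-1) - 1 ≤ -2 := by linarith [min_le_right m (-1)]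
  -- This α lies below −1, where relations exist for any angles, and 2α lies below the supposed
  -- lower bound m of the pair trace.
  obtain ⟨Q, hQ, hQs, hQt⟩ := exists_rel_of_trace ha (β := P.1) (η := 1) (α := min m (-1) - 1)
    (by norm_num) (by linarith) (by linarith) (Or.inl (by linarith))
  have hC := connectedComponent_eq (hz P rfl hx)
  have := hm (Set.mem_image_of_mem _ (hC ▸ hz Q hQ hQs))
  rw [pairTr_mk ha Q (by rw [hQ, hi]) (by rw [hQ, hl]), hQt] at this
  linarith

end
end HexagonSpace

open HexagonSpace in
theorem lemma4p6p1 (a : Fin 4 → ℝ) (ha : ∀ j, a j ∈ Set.Ioo 0 Real.pi)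
    (C : Set (HexagonSpace.S a)) (x : HexagonSpace.S a) (hC : C = connectedComponent x)
    (hne : C.Nontrivial) (hdisc : HexagonSpace.ActsDiscretely (HexagonSpace.M a) C) :
    ¬ IsCompact C ∧
    (∀ y : HexagonSpace.S a, HexagonSpace.hexType y = HexagonSpace.hexType x →
      ¬ IsCompact (connectedComponent y) → connectedComponent y = C) ∧
    ((∀ j k, j ≠ k → a j + a k ≤ Real.pi) ∨ (∀ j k, j ≠ k → Real.pi ≤ a j + a k)) := by
  subst hC
  have hx := relSign_eq_one_of_actsDiscretely ha hne hdisc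
  have hsum : (∀ j k, j ≠ k → a j + a k ≤ Real.pi) ∨ (∀ j k, j ≠ k → Real.pi ≤ a j + a k) :=
    sums_of_not_bad (x := x) fun P hP => by
      subst hP
      exact not_bad_of_actsDiscretely ha hx hdisc
  obtain ⟨P, -, rfl⟩ := S.exists_label 0 x
  obtain ⟨z, hz⟩ := connected_of_sums ha P.1 hsum
  refine ⟨not_isCompact_connectedComponent ha hx hz, fun y hy hyc => ?_, hsum⟩
  obtain ⟨Q, hQ, rfl⟩ := exists_rep P.1 y hy.symm
  -- Noncompactness excludes the sign −1, and the relations of sign 1 with the labeling of P share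
  -- one component.
  have hQs := (relSign_eq ha _).resolve_right fun h => hyc (isCompact_of_relSign ha h)
  rw [← connectedComponent_eq (hz Q hQ hQs), ← connectedComponent_eq (hz P rfl hx)]
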